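/- Let $n\ge 1$ and let $\Gamma:\mathbb R\to\mathbb R^{n+1}$ be a $C^2$ curve parametrized by arc length, with a relatively parallel adapted frame: $C^1$ fields $N_1,\dots,N_n$ such that $T=\Gamma',N_1,\dots,N_n$ are orthonormal and $T'=\sum_j k_jN_j$, $N_j'=-k_jT$ for continuous functions $k_j:\mathbb R\to\mathbb R$. Let $\Theta=(\Theta_1,\dots,\Theta_n):\mathbb R\to\mathbb R^n$ be of class $C^1$ with $\Theta_1^2+\cdots+\Theta_n^2=1$, put $N_\Theta=\sum_j\Theta_jN_j$, let $\varepsilon>0$, $\Lambda=\mathbb R\times(0,1)$ and $$\mathcal L_\varepsilon(s,t)=\Gamma(s)+\varepsilon t\,N_\Theta(s).$$ Let $\Omega_\varepsilon$ be the strip parametrized by $\mathcal L_\varepsilon$ on $\Lambda$, i.e. $\Lambda$ with the Riemannian metric induced by $\mathcal L_\varepsilon$, and let $-\Delta_\varepsilon^{DN}$ be the self-adjoint operator in $L^2(\Omega_\varepsilon)$ associated with the quadratic form $a_\varepsilon(\varphi)=\int_{\Omega_\varepsilon}|\nabla\varphi|^2\,dx$ on $\{\varphi\in H^1(\Omega_\varepsilon):\varphi=0\text{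 on the edge }t=0\}$ (Dirichlet condition on the edge $t=0$, Neumann condition on the edge $t=1$). Suppose that the strip is purely twisted, $k\cdot\Theta=\sum_jk_j\Theta_j=0$ on $\mathbb R$, and that $\Theta'$ does not vanish identically. Then $-\Delta_\varepsilon^{DN}$ is self-adjoint, its spectrum is nonempty and bounded below, and $$\inf\sigma(-\Delta_\varepsilon^{DN})<\left(\frac{\pi}{2\varepsilon}\right)^2 .$$ If moreover $|\Theta'(s)|\to0$ as $|s|\to\infty$, then the discrete spectrum of $-\Delta_\varepsilon^{DN}$ (the isolated points of the spectrum that are eigenvalues of finite multiplicity) is nonempty. -/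

import Mathlib

open MeasureTheory Set Filter Topology
open scoped ContDiff InnerProductSpace

noncomputable section

namespace RuledStrip

/-! ### The parameter strip and weak derivatives -/

/-- The parameter strip `Λ = ℝ × (0,1)`, with coordinates `(s, t)`. -/
def Lam : Set (ℝ × ℝ) := {p | 0 < p.2 ∧ p.2 < 1}

/-- `ℝ × [0,1)`: the parameter strip together with its lower edge `t = 0`. -/
def LamBottom : Set (ℝ × ℝ) := {p | 0 ≤ p.2 ∧ p.2 < 1}

/-- The coordinate directions: index `0` is `s`, index `1` is `t`. -/
def coordDir (i : Fin 2) : ℝ × ℝ := ![(1, 0), (0, 1)] i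

/-- `g` is the weak partial derivative `∂_i u` of `u` in the open set `Λ`. -/
def HasWeakPartial (i : Fin 2) (u g : ℝ × ℝ → ℂ) : Prop :=
  LocallyIntegrableOn u Lam ∧ LocallyIntegrableOn g Lam ∧
    ∀ φ : ℝ × ℝ → ℝ, ContDiff ℝ ∞ φ → HasCompactSupport φ → tsupport φ ⊆ Lam →
      ∫ p in Lam, fderiv ℝ φ p (coordDir i) • u p = -∫ p in Lam, φ p • g p

/-- `τ` is the trace on the edge `t = 0` of a function `u` on `Λ` with weak derivative
`g = ∂_t u`, in the sense of Green's formula: the test functions are compactly supported in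
`{t < 1}` and need not vanish on the edge `t = 0`. -/
def HasBottomTrace (u g : ℝ × ℝ → ℂ) (τ : ℝ → ℂ) : Prop :=
  LocallyIntegrableOn u LamBottom ∧ LocallyIntegrableOn g LamBottom ∧ LocallyIntegrable τ ∧
    ∀ φ : ℝ × ℝ → ℝ, ContDiff ℝ ∞ φ → HasCompactSupport φ → tsupport φ ⊆ {p | p.2 < 1} →
      ∫ p in Lam, (fderiv ℝ φ p (coordDir 1) • u p + φ p • g p) = -∫ s, φ (s, 0) • τ s

/-! ### The surface parametrized by a map `L` on `Λ`, with the induced metric -/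

section Surface

variable {d : ℕ} (L : ℝ × ℝ → EuclideanSpace ℝ (Fin d))

/-- The coordinate tangent vector `∂_i L` at `p`. -/
def tangentVec (i : Fin 2) (p : ℝ × ℝ) : EuclideanSpace ℝ (Fin d) :=
  fderiv ℝ L p (coordDir i)

/-- The metric `G_{ij} = ⟨∂_i L, ∂_j L⟩` induced on `Λ` by the map `L`. -/
def inducedMetric (p : ℝ × ℝ) : Matrix (Fin 2) (Fin 2) ℝ :=
  Matrix.gram ℝ fun i => tangentVec L i p

/-- The Riemannian area measure `√(det G) ds dt` on `Λ`. -/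
def area : Measure (ℝ × ℝ) :=
  (volume.restrict Lam).withDensity fun p => ENNReal.ofReal √(inducedMetric L p).det

/-- The Hilbert space `L²` of complex functions on the surface. -/
abbrev L2 := Lp ℂ 2 (area L)

/-- The Hilbert space of square integrable complex vector fields along the surface. -/
abbrev L2Vec := Lp (EuclideanSpace ℂ (Fin d)) 2 (area L)

/-- The (complex bilinear) product `⟨∂_i L, v⟩` of a coordinate tangent vector with a complex
vector. -/
def tangentPairing (i : Fin 2) (p : ℝ × ℝ) (v : EuclideanSpace ℂ (Fin d)) : ℂ :=
  ∑ m, ((tangentVec L i p m : ℝ) : ℂ) * v m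

/-- The vector `v` lies in the (complexified) tangent plane of the surface at `p`. -/
def IsTangent (p : ℝ × ℝ) (v : EuclideanSpace ℂ (Fin d)) : Prop :=
  ∃ c : Fin 2 → ℂ, ∀ m, v m = ∑ i, c i * ((tangentVec L i p m : ℝ) : ℂ)

/-- `V` is the weak gradient of `u` for the induced metric: the tangent field with
`⟨V, ∂_i L⟩ = ∂_i u`.  Vectors are regarded as vectors of the ambient space, so that
`|V|² = ∑ G^{ij} ∂_i u conj(∂_j u)`. -/
def HasWeakGradient (u : ℝ × ℝ → ℂ) (V : ℝ × ℝ → EuclideanSpace ℂ (Fin d)) : Prop :=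
  (∀ᵐ p ∂(volume.restrict Lam), IsTangent L p (V p)) ∧
    ∀ i, HasWeakPartial i u fun p => tangentPairing L i p (V p)

/-- `u` has weak gradient `V` and vanishes on the edge `t = 0` in the sense of traces. -/
def HasDirichletGradient (u : ℝ × ℝ → ℂ) (V : ℝ × ℝ → EuclideanSpace ℂ (Fin d)) : Prop :=
  HasWeakGradient L u V ∧ HasBottomTrace u (fun p => tangentPairing L 1 p (V p)) 0

end Surface

/-! ### Linearity of these notions -/

lemma integrableOn_test_smul {φ : ℝ × ℝ → ℝ} {u : ℝ × ℝ → ℂ} {S : Set (ℝ × ℝ)}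
    (hφ : Continuous φ) (hc : HasCompactSupport φ)
    (hsub : tsupport φ ∩ {p | 0 ≤ p.2} ⊆ S) (hu : LocallyIntegrableOn u S) :
    IntegrableOn (fun p => φ p • u p) Lam := by
  have hK : IsCompact (tsupport φ ∩ {p : ℝ × ℝ | 0 ≤ p.2}) :=
    hc.isCompact.inter_right (isClosed_le continuous_const continuous_snd)
  have h1 := hu.integrableOn_compact_subset hsub hK
  have h2 : IntegrableOn (fun p => φ p • u p) (tsupport φ ∩ {p : ℝ × ℝ | 0 ≤ p.2}) :=
    h1.continuousOn_smul hφ.continuousOn hK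
  refine h2.of_forall_sdiff_eq_zero (t := Lam) ?_ ?_
  · exact (measurableSet_lt measurable_const measurable_snd).inter
      (measurableSet_lt measurable_snd measurable_const)
  · rintro p ⟨hp, hp'⟩
    have : p ∉ tsupport φ := fun h => hp' ⟨h, hp.1.le⟩
    simp [image_eq_zero_of_notMem_tsupport this]

lemma tsupport_deriv_subset (φ : ℝ × ℝ → ℝ) (i : Fin 2) :
    tsupport (fun p => fderiv ℝ φ p (coordDir i)) ⊆ tsupport φ :=
  tsupport_fderiv_apply_subset ℝ _

lemma continuous_deriv {φ : ℝ × ℝ → ℝ} (hφ : ContDiff ℝ ∞ φ) (i : Fin 2) :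
    Continuous fun p => fderiv ℝ φ p (coordDir i) :=
  (hφ.continuous_fderiv (by simp)).clm_apply continuous_const

lemma hasCompactSupport_deriv {φ : ℝ × ℝ → ℝ} (hc : HasCompactSupport φ) (i : Fin 2) :
    HasCompactSupport fun p => fderiv ℝ φ p (coordDir i) :=
  hc.fderiv_apply ℝ _

lemma HasWeakPartial.add {i : Fin 2} {u u' g g' : ℝ × ℝ → ℂ} (h : HasWeakPartial i u g)
    (h' : HasWeakPartial i u' g') : HasWeakPartial i (u + u') (g + g') := by
  refine ⟨h.1.add h'.1, h.2.1.add h'.2.1, fun φ hφ hc hs => ?_⟩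
  have hs' : tsupport φ ∩ {p | 0 ≤ p.2} ⊆ Lam := fun p hp => hs hp.1
  have hd : tsupport (fun p => fderiv ℝ φ p (coordDir i)) ∩ {p | 0 ≤ p.2} ⊆ Lam :=
    fun p hp => hs (tsupport_deriv_subset φ i hp.1)
  have e1 := h.2.2 φ hφ hc hs
  have e2 := h'.2.2 φ hφ hc hs
  simp only [Pi.add_apply, smul_add]
  rw [integral_add (integrableOn_test_smul (continuous_deriv hφ i)
      (hasCompactSupport_deriv hc i) hd h.1) (integrableOn_test_smul 
      (continuous_deriv hφ i) (hasCompactSupport_deriv hc i) hd h'.1),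
    integral_add (integrableOn_test_smul hφ.continuous hc hs' h.2.1)
      (integrableOn_test_smul hφ.continuous hc hs' h'.2.1), e1, e2]
  ring

lemma HasWeakPartial.smul {i : Fin 2} {u g : ℝ × ℝ → ℂ} (c : ℂ) (h : HasWeakPartial i u g) :
    HasWeakPartial i (c • u) (c • g) := by
  refine ⟨h.1.smul c, h.2.1.smul c, fun φ hφ hc hs => ?_⟩
  simp only [Pi.smul_apply, smul_comm _ c]
  rw [integral_smul, integral_smul, h.2.2 φ hφ hc hs, smul_neg]

lemma HasWeakPartial.zero (i : Fin 2) : HasWeakPartial i 0 0 := by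
  refine ⟨?_, ?_, fun φ _ _ _ => by simp⟩ <;> exact locallyIntegrableOn_zero

lemma HasBottomTrace.add {u u' g g' : ℝ × ℝ → ℂ} (h : HasBottomTrace u g 0)
    (h' : HasBottomTrace u' g' 0) : HasBottomTrace (u + u') (g + g') 0 := by
  refine ⟨h.1.add h'.1, h.2.1.add h'.2.1, h.2.2.1, fun φ hφ hc hs => ?_⟩
  have hs' : tsupport φ ∩ {p | 0 ≤ p.2} ⊆ LamBottom := fun p hp => ⟨hp.2, hs hp.1⟩
  have hd : tsupport (fun p => fderiv ℝ φ p (coordDir 1)) ∩ {p | 0 ≤ p.2} ⊆ LamBottom :=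
    fun p hp => ⟨hp.2, hs (tsupport_deriv_subset φ 1 hp.1)⟩
  have e1 := h.2.2.2 φ hφ hc hs
  have e2 := h'.2.2.2 φ hφ hc hs
  have key : ∀ {v k : ℝ × ℝ → ℂ}, HasBottomTrace v k 0 → IntegrableOn (fun p =>
      fderiv ℝ φ p (coordDir 1) • v p + φ p • k p) Lam := fun hv =>
    (integrableOn_test_smul (continuous_deriv hφ 1)
      (hasCompactSupport_deriv hc 1) hd hv.1).add
      (integrableOn_test_smul hφ.continuous hc hs' hv.2.1)
  have e : ∀ p, fderiv ℝ φ p (coordDir 1) • (u + u') p + φ p • (g + g') p =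
      (fderiv ℝ φ p (coordDir 1) • u p + φ p • g p) +
        (fderiv ℝ φ p (coordDir 1) • u' p + φ p • g' p) := fun p => by
    simp only [Pi.add_apply, smul_add]; abel
  simp only [e]
  rw [integral_add (key h) (key h'), e1, e2]
  simp

lemma HasBottomTrace.smul {u g : ℝ × ℝ → ℂ} (c : ℂ) (h : HasBottomTrace u g 0) :
    HasBottomTrace (c • u) (c • g) 0 := by
  refine ⟨h.1.smul c, h.2.1.smul c, h.2.2.1, fun φ hφ hc hs => ?_⟩
  have e1 := h.2.2.2 φ hφ hc hs
  simp only [Pi.smul_apply, smul_comm _ c, ← smul_add]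
  rw [integral_smul, e1]
  simp

lemma HasBottomTrace.zero : HasBottomTrace 0 0 0 :=
  ⟨locallyIntegrableOn_zero, locallyIntegrableOn_zero, locallyIntegrable_zero,
    fun φ _ _ _ => by simp⟩

/-! ### The operator associated with a quadratic form -/

/-- Let `D` be the graph of a linear operator `∇` from a subspace of `H` to `K`, and consider the
form `a(v, u) = ⟨∇v, ∇u⟩` on the domain of `∇`.  The pair `(u, w)` belongs to the graph of the
operator associated with `a` iff `u` is in the form domain and `a(v, u) = ⟨v, w⟩` for every `v` in
the form domain. -/
def formOperatorGraph {H K : Type*} [NormedAddCommGroup H] [InnerProductSpace ℂ H]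
    [NormedAddCommGroup K] [InnerProductSpace ℂ K] (D : Submodule ℂ (H × K)) :
    Submodule ℂ (H × H) where
  carrier := {x | ∃ V, (x.1, V) ∈ D ∧ ∀ v W, (v, W) ∈ D → ⟪W, V⟫_ℂ = ⟪v, x.2⟫_ℂ}
  add_mem' := by
    rintro x y ⟨V, hV, h⟩ ⟨V', hV', h'⟩
    refine ⟨V + V', D.add_mem hV hV', fun v W hW => ?_⟩
    rw [Prod.snd_add, inner_add_right, inner_add_right, h v W hW, h' v W hW]
  zero_mem' := ⟨0, D.zero_mem, fun v W _ => by simp⟩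
  smul_mem' := by
    rintro c x ⟨V, hV, h⟩
    refine ⟨c • V, D.smul_mem c hV, fun v W hW => ?_⟩
    rw [Prod.smul_snd, inner_smul_right, inner_smul_right, h v W hW]

section Operator

variable {d : ℕ} (L : ℝ × ℝ → EuclideanSpace ℝ (Fin d))

lemma tangentPairing_add (i : Fin 2) (V W : ℝ × ℝ → EuclideanSpace ℂ (Fin d)) :
    (fun p => tangentPairing L i p ((V + W) p)) =
      (fun p => tangentPairing L i p (V p)) + fun p => tangentPairing L i p (W p) := by
  funext p
  simp [tangentPairing, mul_add, Finset.sum_add_distrib]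

lemma tangentPairing_smul (i : Fin 2) (c : ℂ) (V : ℝ × ℝ → EuclideanSpace ℂ (Fin d)) :
    (fun p => tangentPairing L i p ((c • V) p)) =
      c • fun p => tangentPairing L i p (V p) := by
  funext p
  simp [tangentPairing, Finset.mul_sum, mul_left_comm]

lemma tangentPairing_zero (i : Fin 2) :
    (fun p => tangentPairing L i p ((0 : ℝ × ℝ → EuclideanSpace ℂ (Fin d)) p)) = 0 := by
  funext p
  simp [tangentPairing]

lemma HasDirichletGradient.add {u u' : ℝ × ℝ → ℂ} {V V' : ℝ × ℝ → EuclideanSpace ℂ (Fin d)}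
    (h : HasDirichletGradient L u V) (h' : HasDirichletGradient L u' V') :
    HasDirichletGradient L (u + u') (V + V') := by
  refine ⟨⟨?_, fun i => ?_⟩, ?_⟩
  · filter_upwards [h.1.1, h'.1.1] with p ⟨c, hc⟩ ⟨c', hc'⟩
    exact ⟨c + c', fun m => by simp [hc, hc', add_mul]; ring⟩
  · rw [tangentPairing_add]; exact (h.1.2 i).add (h'.1.2 i)
  · rw [tangentPairing_add]; exact h.2.add h'.2

lemma HasDirichletGradient.smul {u : ℝ × ℝ → ℂ} {V : ℝ × ℝ → EuclideanSpace ℂ (Fin d)}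
    (c : ℂ) (h : HasDirichletGradient L u V) : HasDirichletGradient L (c • u) (c • V) := by
  refine ⟨⟨?_, fun i => ?_⟩, ?_⟩
  · filter_upwards [h.1.1] with p ⟨b, hb⟩
    exact ⟨c • b, fun m => by simp [hb, mul_add, mul_assoc]⟩
  · rw [tangentPairing_smul]; exact (h.1.2 i).smul c
  · rw [tangentPairing_smul]; exact h.2.smul c

lemma HasDirichletGradient.zero : HasDirichletGradient L 0 0 := by
  refine ⟨⟨?_, fun i => ?_⟩, ?_⟩
  · exact Eventually.of_forall fun p => ⟨0, fun m => by simp⟩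
  · rw [tangentPairing_zero]; exact HasWeakPartial.zero i
  · rw [tangentPairing_zero]; exact HasBottomTrace.zero

/-! ### The Dirichlet–Neumann Laplacian -/

/-- The graph of the gradient `u ↦ ∇u` on the form domain
`{u ∈ H¹ ; u = 0 on the edge t = 0}`, as a subspace of `L² × L²(vector fields)`. -/
def gradientGraph : Submodule ℂ (L2 L × L2Vec L) where
  carrier := {x | ∃ u V, x.1 =ᵐ[area L] u ∧ x.2 =ᵐ[area L] V ∧ HasDirichletGradient L u V}
  add_mem' := by
    rintro x y ⟨u, V, hu, hV, h⟩ ⟨u', V', hu', hV', h'⟩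
    exact ⟨u + u', V + V', (Lp.coeFn_add _ _).trans (hu.add hu'),
      (Lp.coeFn_add _ _).trans (hV.add hV'), h.add L h'⟩
  zero_mem' := ⟨0, 0, Lp.coeFn_zero _ _ _, Lp.coeFn_zero _ _ _, HasDirichletGradient.zero L⟩
  smul_mem' := by
    rintro c x ⟨u, V, hu, hV, h⟩
    exact ⟨c • u, c • V, (Lp.coeFn_smul _ _).trans (hu.const_smul c),
      (Lp.coeFn_smul _ _).trans (hV.const_smul c), h.smul L c⟩

/-- The graph of the operator associated with the form `a(v, u) = ∫ ⟨∇v, ∇u⟩`. -/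
def laplacianGraph : Submodule ℂ (L2 L × L2 L) := formOperatorGraph (gradientGraph L)

/-- The Laplacian `-Δ^{DN}` of the surface parametrized by `L` on `Λ`, with Dirichlet condition on
the edge `t = 0` and (natural) Neumann condition on the edge `t = 1`. -/
def dnLaplacian : L2 L →ₗ.[ℂ] L2 L := (laplacianGraph L).toLinearPMap

end Operator

/-! ### Spectrum of an unbounded operator -/

section Spec

variable {H : Type*} [NormedAddCommGroup H] [InnerProductSpace ℂ H]

/-- `z` is in the resolvent set of `T` iff `T - z` maps the domain of `T` bijectively onto the
whole space, with a bounded inverse. -/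
def opResolventSet (T : H →ₗ.[ℂ] H) : Set ℂ :=
  {z | ∃ R : H →L[ℂ] H,
    (∀ w : H, ∃ x : T.domain, (x : H) = R w ∧ T x - z • (x : H) = w) ∧
    ∀ x : T.domain, R (T x - z • (x : H)) = x}

/-- The spectrum of `T`. -/
def opSpectrum (T : H →ₗ.[ℂ] H) : Set ℂ := (opResolventSet T)ᶜ

/-- The real numbers in the spectrum of `T` (the whole spectrum when `T` is self-adjoint). -/
def realSpectrum (T : H →ₗ.[ℂ] H) : Set ℝ := {lam | (lam : ℂ) ∈ opSpectrum T}

/-- The eigenspace `ker (T - z)`, as a subspace of the domain of `T`. -/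
def eigenspace (T : H →ₗ.[ℂ] H) (z : ℂ) : Submodule ℂ T.domain :=
  LinearMap.ker (T.toFun - z • T.domain.subtype)

/-- The discrete spectrum: the isolated points of the spectrum that are eigenvalues of finite
multiplicity. -/
def discreteSpectrum (T : H →ₗ.[ℂ] H) : Set ℂ :=
  {z | z ∈ opSpectrum T ∧ (∃ δ > 0, ∀ z' ∈ opSpectrum T, ‖z' - z‖ < δ → z' = z) ∧
    eigenspace T z ≠ ⊥ ∧ Module.Finite ℂ (eigenspace T z)}

end Spec

/-! ### Ruled strips along a curve -/

/-- `N₁, …, N_n` (with coefficients `k₁, …, k_n`) is a relatively parallel adapted frame of class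
`C¹` for the unit speed curve `Γ` of class `C²`. -/
structure IsRelativelyParallelFrame {n : ℕ} (Γ : ℝ → EuclideanSpace ℝ (Fin (n + 1)))
    (N : Fin n → ℝ → EuclideanSpace ℝ (Fin (n + 1))) (k : Fin n → ℝ → ℝ) : Prop where
  contDiff_curve : ContDiff ℝ 2 Γ
  contDiff_normal : ∀ j, ContDiff ℝ 1 (N j)
  continuous_coeff : ∀ j, Continuous (k j)
  /-- `T = Γ'`, `N₁, …, N_n` are orthonormal; in particular `Γ` has unit speed. -/
  orthonormal : ∀ s, Orthonormal ℝ (Fin.cons (deriv Γ s) fun j => N j s :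
    Fin (n + 1) → EuclideanSpace ℝ (Fin (n + 1)))
  /-- `T' = k₁ N₁ + ⋯ + k_n N_n`. -/
  deriv_tangent : ∀ s, deriv (deriv Γ) s = ∑ j, k j s • N j s
  /-- `N_j' = -k_j T`. -/
  deriv_normal : ∀ j s, deriv (N j) s = -(k j s) • deriv Γ s

/-- The map `(s, t) ↦ Γ(s) + ε t N_Θ(s)` with `N_Θ = Θ₁ N₁ + ⋯ + Θ_n N_n`. -/
def stripMap {n : ℕ} (Γ : ℝ → EuclideanSpace ℝ (Fin (n + 1)))
    (N : Fin n → ℝ → EuclideanSpace ℝ (Fin (n + 1))) (Θ : ℝ → EuclideanSpace ℝ (Fin n)) (ε : ℝ) :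
    ℝ × ℝ → EuclideanSpace ℝ (Fin (n + 1)) :=
  fun p => Γ p.1 + (ε * p.2) • ∑ j, Θ p.1 j • N j p.1

end RuledStrip

end

open RuledStrip

/-! Since k·Θ = 0, the curvature of Γ drops out of ∂_s L, and differentiating |Θ|² = 1 shows that
the coordinate lines are orthogonal. The metric is h² ds² + ε² dt² with h(s,t) = √(1 + ε²t²|Θ'(s)|²)
≥ 1 (`stretch`), so the function q = |Θ'|² is all that remains of the geometry.

Energy below the threshold. For u = φ(s) sin(πt/2), the difference ‖∇u‖² − (π/2ε)²‖u‖² is at most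
ε∫φ'² plus π²/(4ε) times ∫ φ(s)² ∫₀¹ h(s,t) cos(πt) dt ds. Here h is nondecreasing in t, while
cos(πt) is odd about t = 1/2 and positive before it. Hence the inner integral is ≤ 0, and it is
negative wherever Θ' ≠ 0: twisting adds weight near the Neumann edge. A long plateau φ costs O(1/R)
and keeps a fixed negative gain (`exists_trial`).

Passage to the operator. The operator T of the closed form is studied through R = (1 + T)⁻¹, which
is bounded, self-adjoint and injective, and is obtained by orthogonal projection onto the gradient
graph. Points λ of σ(T) correspond to points 1/(1+λ) of σ(R). The number ‖R‖ lies in σ(R) and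
corresponds to the bottom of σ(T), and a trial function with Rayleigh quotient below E forces ‖R‖ >
1/(1+E) (`lt_norm_of_trial`).

Discrete spectrum. When Θ' → 0 at infinity, for each E below the threshold the form is at least E on
the orthogonal complement of finitely many functions (`exists_finite_orthogonality`). Far out h is
close to 1, and the sharp Poincaré inequality on vertical segments suffices. The remaining bounded
piece is cut into small squares, on each of which functions of mean zero have large energy. Such a
bound makes R − ‖R‖ bounded below on a subspace of finite codimension, so approximate eigenvectors
have convergent subsequences. This yields an eigenvector, isolation and finite multiplicity
(`discreteSpectrum_nonempty_of_form_bound`) without any theory of the essential spectrum.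

Both Poincaré inequalities require weakly differentiable functions to be a.e. integrals of their
derivative along segments. `ae_sub_eq_segmentIntegral` proves this by testing the weak identity
against averages of test functions along segments. -/

noncomputable section

namespace RuledStrip

/-! ### The resolvent at `-1` of the operator associated with a closed form -/

section FormOperator

variable {H K : Type*} [NormedAddCommGroup H] [InnerProductSpace ℂ H]
    [NormedAddCommGroup K] [InnerProductSpace ℂ K]

/-- `R` is the inverse of `1 + T`, where `T` is the operator of the form with gradient graph `D`. -/
def IsFormResolvent (D : Submodule ℂ (H × K)) (R : H →L[ℂ] H) : Prop :=
  ∀ w, ∃ V, (R w, V) ∈ D ∧ ∀ v W, (v, W) ∈ D → ⟪W, V⟫_ℂ = ⟪v, w - R w⟫_ℂ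

/-- The orthogonal projection of (w, 0) onto D in the Hilbert sum H ⊕ K is the pair (R w, V):
orthogonality of the remainder to every (v, W) in D is exactly the weak equation. This takes the
place of a Riesz or Lax–Milgram argument, and closedness of D is what makes the projection exist. -/
lemma exists_isFormResolvent [CompleteSpace H] [CompleteSpace K] {D : Submodule ℂ (H × K)}
    (hD : IsClosed (D : Set (H × K))) : ∃ R : H →L[ℂ] H, IsFormResolvent D R := by
  -- The norm of H × K is a sup norm, so the projection has to be taken in the ℓ² product.
  let e := WithLp.prodContinuousLinearEquiv 2 ℂ H K
  let D' : Submodule ℂ (WithLp 2 (H × K)) := D.comap (e : WithLp 2 (H × K) →ₗ[ℂ] H × K)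
  have hD' : IsClosed (D' : Set (WithLp 2 (H × K))) := hD.preimage e.continuous
  have : CompleteSpace D' := hD'.completeSpace_coe
  let R : H →L[ℂ] H := (ContinuousLinearMap.fst ℂ H K).comp ((e : WithLp 2 (H × K) →L[ℂ] H × K).comp
    (D'.starProjection.comp ((e.symm : H × K →L[ℂ] WithLp 2 (H × K)).comp
      (ContinuousLinearMap.inl ℂ H K))))
  refine ⟨R, fun w => ⟨(e (D'.starProjection (e.symm (w, 0)))).2, ?_, fun v W hv => ?_⟩⟩
  · exact D'.starProjection_apply_mem (e.symm (w, 0))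
  · have h1 : e.symm (v, W) ∈ D' := by
      change e (e.symm (v, W)) ∈ D
      simpa using hv
    have h2 := Submodule.starProjection_inner_eq_zero (K := D') (e.symm (w, 0)) (e.symm (v, W)) h1
    rw [← inner_conj_symm, map_eq_zero, inner_sub_right, sub_eq_zero] at h2
    rw [WithLp.prod_inner_apply, WithLp.prod_inner_apply] at h2
    rw [inner_sub_right]
    have h3 : ⟪v, w⟫_ℂ + ⟪W, (0 : K)⟫_ℂ = ⟪v, R w⟫_ℂ +
      ⟪W, (e (D'.starProjection (e.symm (w, 0)))).2⟫_ℂ := h2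
    rw [inner_zero_right, add_zero] at h3
    rw [h3]; ring

variable {D : Submodule ℂ (H × K)} {R : H →L[ℂ] H}

lemma IsFormResolvent.mem_graph (hR : IsFormResolvent D R) (x : H) :
    (R x, x - R x) ∈ formOperatorGraph D := hR x

/-- Two weak solutions of u + Tu = f differ by an element d of the form domain with ‖∇d‖² = −‖d‖²,
hence d = 0. -/
lemma IsFormResolvent.apply_of_mem_graph (hR : IsFormResolvent D R) {u w : H}
    (h : (u, w) ∈ formOperatorGraph D) : R (w + u) = u := by
  obtain ⟨V, hV, hVw⟩ := h
  obtain ⟨V', hV', hV'w⟩ := hR (w + u)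
  have hd : (u - R (w + u), V - V') ∈ D := D.sub_mem hV hV'
  have h1 := hVw _ _ hd
  have h2 := hV'w _ _ hd
  simp only at h1
  have h3 : ⟪V - V', V - V'⟫_ℂ = -⟪u - R (w + u), u - R (w + u)⟫_ℂ := by
    rw [inner_sub_right (V - V'), h1, h2, ← inner_sub_right, ← inner_neg_right]
    congr 1; abel
  have h4 := congrArg Complex.re h3
  have a1 := inner_self_nonneg (𝕜 := ℂ) (x := V - V')
  have a2 := inner_self_nonneg (𝕜 := ℂ) (x := u - R (w + u))
  simp only [Complex.neg_re, RCLike.re_to_complex] at h4 a1 a2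
  have h5 : RCLike.re ⟪u - R (w + u), u - R (w + u)⟫_ℂ = 0 := by
    simp only [RCLike.re_to_complex]; linarith
  rw [inner_self_eq_norm_sq] at h5
  have := norm_eq_zero.1 (pow_eq_zero_iff (two_ne_zero) |>.1 h5)
  exact (sub_eq_zero.1 this).symm

lemma IsFormResolvent.mem_graph_iff (hR : IsFormResolvent D R) {x : H × H} :
    x ∈ formOperatorGraph D ↔ R (x.2 + x.1) = x.1 := by
  refine ⟨fun h => hR.apply_of_mem_graph h, fun h => ?_⟩
  have := hR.mem_graph (x.2 + x.1)
  rw [h] at this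
  simpa using this

/-- Both sides equal ⟨Rx, Ry⟩ + ⟨∇Rx, ∇Ry⟩. -/
lemma IsFormResolvent.symmetric (hR : IsFormResolvent D R) (x y : H) :
    ⟪R x, y⟫_ℂ = ⟪x, R y⟫_ℂ := by
  obtain ⟨V, hV, h⟩ := hR x
  obtain ⟨V', hV', h'⟩ := hR y
  have e1 := h _ _ hV'
  have e2 := h' _ _ hV
  rw [inner_sub_right] at e1 e2
  have e3 : ⟪R x, y⟫_ℂ = ⟪R x, R y⟫_ℂ + ⟪V, V'⟫_ℂ := by rw [e2]; ring
  have e4 : ⟪R y, x⟫_ℂ = ⟪R y, R x⟫_ℂ + ⟪V', V⟫_ℂ := by rw [e1]; ring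
  rw [e3, ← inner_conj_symm x, e4, map_add, inner_conj_symm, inner_conj_symm]

/-- `⟨w, R w⟩ = ‖R w‖² + ‖∇ R w‖²`. -/
lemma IsFormResolvent.re_inner_apply (hR : IsFormResolvent D R) (w : H) :
    ∃ V, (R w, V) ∈ D ∧ RCLike.re ⟪w, R w⟫_ℂ = ‖R w‖ ^ 2 + ‖V‖ ^ 2 := by
  obtain ⟨V, hV, h⟩ := hR w
  refine ⟨V, hV, ?_⟩
  have e := h _ _ hV
  rw [inner_sub_right] at e
  have e2 : ⟪R w, w⟫_ℂ = ⟪R w, R w⟫_ℂ + ⟪V, V⟫_ℂ := by rw [e]; ring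
  rw [inner_re_symm, e2, map_add, inner_self_eq_norm_sq, inner_self_eq_norm_sq]

lemma IsFormResolvent.isSelfAdjoint [CompleteSpace H] (hR : IsFormResolvent D R) :
    IsSelfAdjoint R :=
  ContinuousLinearMap.isSelfAdjoint_iff_isSymmetric.2 hR.symmetric

/-- If R x = 0, the equation tested with R x itself gives ∇R x = 0, so that x is orthogonal to the
whole form domain, which is dense. -/
lemma IsFormResolvent.injective (hR : IsFormResolvent D R)
    (hdense : ∀ x : H, (∀ v W, (v, W) ∈ D → ⟪v, x⟫_ℂ = 0) → x = 0) {x : H} (hx : R x = 0) :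
    x = 0 := by
  refine hdense x fun v W hv => ?_
  obtain ⟨V, hV, h⟩ := hR x
  have h0 : ⟪V, V⟫_ℂ = 0 := by
    rw [h _ _ hV, hx, inner_zero_left]
  have hV0 : V = 0 := inner_self_eq_zero.1 h0
  have := h v W hv
  rw [hV0, inner_zero_right, hx, sub_zero] at this
  exact this.symm

lemma IsFormResolvent.norm_apply_le (hR : IsFormResolvent D R) (w : H) : ‖R w‖ ≤ ‖w‖ := by
  obtain ⟨V, -, h⟩ := hR.re_inner_apply w
  have h1 : RCLike.re ⟪w, R w⟫_ℂ ≤ ‖w‖ * ‖R w‖ := re_inner_le_norm _ _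
  by_contra! hlt
  nlinarith [norm_nonneg w, sq_nonneg ‖V‖]

/-! ### Self-adjointness -/

lemma graph_toLinearPMap_formOperatorGraph (hR : IsFormResolvent D R)
    (hinj : ∀ x, R x = 0 → x = 0) :
    (formOperatorGraph D).toLinearPMap.graph = formOperatorGraph D := by
  refine Submodule.toLinearPMap_graph_eq _ fun x hx h0 => ?_
  rw [hR.mem_graph_iff, h0, add_zero] at hx
  exact hinj _ hx

lemma mem_domain_formOperator (hR : IsFormResolvent D R) (x : H) :
    R x ∈ (formOperatorGraph D).toLinearPMap.domain := by
  rw [Submodule.toLinearPMap_domain]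
  exact ⟨_, hR.mem_graph x, rfl⟩

lemma formOperator_apply (hR : IsFormResolvent D R) (hinj : ∀ x, R x = 0 → x = 0)
    (x : (formOperatorGraph D).toLinearPMap.domain) :
    R ((formOperatorGraph D).toLinearPMap x + x) = x := by
  have h : ((x : H), (formOperatorGraph D).toLinearPMap x) ∈ formOperatorGraph D := by
    have hx := LinearPMap.mem_graph _ x
    rwa [graph_toLinearPMap_formOperatorGraph hR hinj] at hx
  exact hR.apply_of_mem_graph h

lemma formOperator_resolvent_apply (hR : IsFormResolvent D R) (hinj : ∀ x, R x = 0 → x = 0)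
    (x : H) : (formOperatorGraph D).toLinearPMap ⟨R x, mem_domain_formOperator hR x⟩ =
      x - R x := by
  have h := formOperator_apply hR hinj ⟨R x, mem_domain_formOperator hR x⟩
  have h2 := hinj ((formOperatorGraph D).toLinearPMap ⟨R x, mem_domain_formOperator hR x⟩ + R x - x)
    (by rw [map_sub, h]; simp)
  rw [eq_sub_iff_add_eq]
  exact sub_eq_zero.1 h2

/-- The operator is R⁻¹ − 1 with R bounded, symmetric and injective. Its domain, the range of R, is
dense because a vector x orthogonal to the range satisfies ⟨Rx, Rx⟩ = ⟨R(Rx), x⟩ = 0. A pair (a, b)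
in the adjoint graph, tested against all pairs (Ry, y − Ry), satisfies R(b + a) = a. -/
theorem isSelfAdjoint_formOperator [CompleteSpace H] (hR : IsFormResolvent D R)
    (hinj : ∀ x, R x = 0 → x = 0) : IsSelfAdjoint (formOperatorGraph D).toLinearPMap := by
  set T := (formOperatorGraph D).toLinearPMap with hT
  have hdense : Dense (T.domain : Set H) := by
    rw [Submodule.dense_iff_topologicalClosure_eq_top, Submodule.topologicalClosure_eq_top_iff,
      Submodule.eq_bot_iff]
    intro x hx
    apply hinj
    rw [← inner_self_eq_zero (𝕜 := ℂ), ← hR.symmetric]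
    exact Submodule.inner_right_of_mem_orthogonal (mem_domain_formOperator hR (R x)) hx
  rw [LinearPMap.isSelfAdjoint_def]
  apply LinearPMap.eq_of_eq_graph
  rw [LinearPMap.adjoint_graph_eq_graph_adjoint hdense,
    graph_toLinearPMap_formOperatorGraph hR hinj]
  ext ⟨a, b⟩
  rw [Submodule.mem_adjoint_iff, hR.mem_graph_iff]
  constructor
  · intro h
    simp only at h ⊢
    refine ext_inner_left ℂ fun y => ?_
    have := h _ _ (hR.mem_graph y)
    rw [← hR.symmetric, inner_add_right]
    rw [inner_sub_left] at this
    linear_combination -this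
  · intro h u w huw
    rw [hR.mem_graph_iff] at huw
    simp only at h huw ⊢
    have e : ⟪w + u, R (b + a)⟫_ℂ = ⟪R (w + u), b + a⟫_ℂ := (hR.symmetric _ _).symm
    rw [h, huw, inner_add_left, inner_add_right] at e
    linear_combination e

/-! ### The spectrum in terms of the resolvent -/

lemma one_sub_smul_apply (c : ℂ) (A : H →L[ℂ] H) (y : H) : (1 - c • A) y = y - c • A y := rfl

/-- On the domain, T − z = (1 − (1 + z)R) ∘ R⁻¹, so T − z has a bounded inverse exactly when the
bounded factor is invertible. In this form z = −1 needs no exception. -/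
lemma mem_opSpectrum_iff (hR : IsFormResolvent D R) (hinj : ∀ x, R x = 0 → x = 0)
    [CompleteSpace H] (z : ℂ) :
    z ∈ opSpectrum (formOperatorGraph D).toLinearPMap ↔ ¬ IsUnit (1 - (1 + z) • R) := by
  rw [opSpectrum, Set.mem_compl_iff, not_iff_not]
  have key : ∀ y : H, (1 - (1 + z) • R) y = (formOperatorGraph D).toLinearPMap
      ⟨R y, mem_domain_formOperator hR y⟩ - z • R y := fun y => by
    rw [formOperator_resolvent_apply hR hinj]
    rw [one_sub_smul_apply, add_smul, one_smul]
    abel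
  constructor
  · rintro ⟨Q, hQ1, hQ2⟩
    rw [ContinuousLinearMap.isUnit_iff_bijective]
    constructor
    · rw [injective_iff_map_eq_zero]
      intro y hy
      have h := hQ2 ⟨R y, mem_domain_formOperator hR y⟩
      rw [← key, hy, map_zero] at h
      exact hinj y h.symm
    · intro w
      obtain ⟨x, -, hx⟩ := hQ1 w
      refine ⟨(formOperatorGraph D).toLinearPMap x + x, ?_⟩
      rw [← hx]
      rw [one_sub_smul_apply, formOperator_apply hR hinj, add_smul, one_smul]
      abel
  · rintro ⟨U, hU⟩
    refine ⟨R.comp (U⁻¹ : (H →L[ℂ] H)ˣ).1, fun w => ⟨⟨R ((U⁻¹ : (H →L[ℂ] H)ˣ).1 w),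
      mem_domain_formOperator hR _⟩, rfl, ?_⟩, fun x => ?_⟩
    · rw [← key, ← hU]
      exact congrArg (fun f : H →L[ℂ] H => f w) U.mul_inv
    · have hx : (formOperatorGraph D).toLinearPMap x - z • (x : H) =
          U.1 ((formOperatorGraph D).toLinearPMap x + x) := by
        rw [hU]
        rw [one_sub_smul_apply, formOperator_apply hR hinj, add_smul, one_smul]
        abel
      have h2 : (U⁻¹ : (H →L[ℂ] H)ˣ).1 (U.1 ((formOperatorGraph D).toLinearPMap x + x)) =
          (formOperatorGraph D).toLinearPMap x + x :=
        congrArg (fun f : H →L[ℂ] H => f ((formOperatorGraph D).toLinearPMap x + x)) U.inv_mul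
      rw [hx, ContinuousLinearMap.comp_apply, h2, formOperator_apply hR hinj]

lemma mem_opSpectrum_iff_mem_spectrum [CompleteSpace H] (hR : IsFormResolvent D R)
    (hinj : ∀ x, R x = 0 → x = 0) {z : ℂ} (hz : 1 + z ≠ 0) :
    z ∈ opSpectrum (formOperatorGraph D).toLinearPMap ↔ (1 + z)⁻¹ ∈ spectrum ℂ R := by
  rw [mem_opSpectrum_iff hR hinj, spectrum.mem_iff, not_iff_not]
  have h : (1 - (1 + z) • R) = Units.mk0 (1 + z) hz •
      (algebraMap ℂ (H →L[ℂ] H) (1 + z)⁻¹ - R) := by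
    rw [Units.smul_mk0, smul_sub, Algebra.algebraMap_eq_smul_one, smul_smul,
      mul_inv_cancel₀ hz, one_smul]
  rw [h]
  exact isUnit_smul_iff _ _

/-- A real point of the spectrum of a bounded self-adjoint operator is an approximate
eigenvalue. -/
lemma exists_approx_eigenvector [CompleteSpace H] {A : H →L[ℂ] H} (hA : IsSelfAdjoint A) {μ : ℝ}
    (hμ : (μ : ℂ) ∈ spectrum ℂ A) {η : ℝ} (hη : 0 < η) :
    ∃ y : H, ‖y‖ = 1 ∧ ‖A y - (μ : ℂ) • y‖ < η := by
  by_contra! hcon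
  have hb : ∀ y : H, η * ‖y‖ ≤ ‖A y - (μ : ℂ) • y‖ := fun y => by
    rcases eq_or_ne y 0 with rfl | hy
    · simp
    · have hy' : ‖y‖ ≠ 0 := norm_ne_zero_iff.2 hy
      have h1 := hcon (((‖y‖⁻¹ : ℝ) : ℂ) • y) (by
        rw [norm_smul, Complex.norm_real, norm_inv, norm_norm, inv_mul_cancel₀ hy'])
      rw [map_smul, smul_comm, ← smul_sub, norm_smul, Complex.norm_real, norm_inv, norm_norm,
        ← div_eq_inv_mul, le_div_iff₀ (norm_pos_iff.2 hy)] at h1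
      exact h1
  apply hμ
  have hsym := ContinuousLinearMap.isSelfAdjoint_iff_isSymmetric.1 hA
  set B : H →L[ℂ] H := algebraMap ℂ (H →L[ℂ] H) μ - A with hB
  have hBa : ∀ y, B y = (μ : ℂ) • y - A y := fun y => by
    simp [hB, Algebra.algebraMap_eq_smul_one]
  have hanti : AntilipschitzWith (Real.toNNReal η)⁻¹ B := by
    refine B.antilipschitz_of_bound fun y => ?_
    rw [NNReal.coe_inv, Real.coe_toNNReal _ hη.le, hBa, norm_sub_rev, inv_mul_eq_div,
      le_div_iff₀ hη, mul_comm]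
    exact hb y
  rw [spectrum.mem_resolventSet_iff, ContinuousLinearMap.isUnit_iff_bijective,
    ContinuousLinearMap.bijective_iff_dense_range_and_antilipschitz]
  refine ⟨?_, _, hanti⟩
  -- As μ is real and A symmetric, the orthogonal complement of the range of B is its kernel, which
  -- the lower bound makes trivial. Dense range and the lower bound together give bijectivity.
  rw [Submodule.topologicalClosure_eq_top_iff, Submodule.eq_bot_iff]
  intro x hx
  have h0 : B x = 0 := by
    refine ext_inner_left ℂ fun y => ?_
    have hs : ⟪A y, x⟫_ℂ = ⟪y, A x⟫_ℂ := hsym y x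
    rw [inner_zero_right, hBa, inner_sub_right, inner_smul_right, ← hs]
    have := hx (B y) ⟨y, rfl⟩
    rw [hBa, inner_sub_left, inner_smul_left, Complex.conj_ofReal] at this
    exact this
  have := hb x
  rw [norm_sub_rev, ← hBa, h0, norm_zero] at this
  have h3 : ‖x‖ ≤ 0 := by by_contra! h; nlinarith
  exact norm_le_zero_iff.1 h3

/-- The real spectrum of a nonnegative form operator is nonnegative. -/
lemma nonneg_of_mem_realSpectrum [CompleteSpace H] (hR : IsFormResolvent D R)
    (hinj : ∀ x, R x = 0 → x = 0) {l : ℝ} (hl : l ∈ realSpectrum (formOperatorGraph D).toLinearPMap) :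
    0 ≤ l := by
  have hl' : (l : ℂ) ∈ opSpectrum (formOperatorGraph D).toLinearPMap := hl
  by_contra! hneg
  -- The value l = −1 has no counterpart 1/(1 + l) and is treated apart: there the operator to
  -- invert is the identity.
  rcases eq_or_ne (1 + (l : ℂ)) 0 with h0 | h0
  · rw [mem_opSpectrum_iff hR hinj, h0, zero_smul, sub_zero] at hl'
    exact hl' isUnit_one
  · rw [mem_opSpectrum_iff_mem_spectrum hR hinj h0] at hl'
    have hμ : ((1 + (l : ℂ))⁻¹) = (((1 + l)⁻¹ : ℝ) : ℂ) := by push_cast; rfl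
    rw [hμ] at hl'
    have h0' : 1 + l ≠ 0 := fun h => h0 (by exact_mod_cast h)
    set μ : ℝ := (1 + l)⁻¹ with hμd
    -- A negative l puts μ = 1/(1 + l) outside [0, 1], whereas ⟨y, R y⟩ lies in [0, 1] for unit
    -- vectors y. An approximate eigenvector with error smaller than the distance η from μ to [0, 1]
    -- is then impossible.
    have hout : μ < 0 ∨ 1 < μ := by
      rcases lt_or_gt_of_ne h0' with h | h
      · exact Or.inl (inv_neg''.2 h)
      · exact Or.inr ((one_lt_inv₀ h).2 (by linarith))
    have hη : ∃ η > 0, μ ≤ -η ∨ 1 + η ≤ μ := by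
      rcases hout with h | h
      · exact ⟨-μ, by linarith, Or.inl (by linarith)⟩
      · exact ⟨μ - 1, by linarith, Or.inr (by linarith)⟩
    obtain ⟨η, hη0, hη⟩ := hη
    obtain ⟨y, hy1, hy2⟩ := exists_approx_eigenvector hR.isSelfAdjoint hl' hη0
    have e1 : |RCLike.re ⟪y, R y⟫_ℂ - μ| < η := by
      have : ⟪y, R y - (μ : ℂ) • y⟫_ℂ = ⟪y, R y⟫_ℂ - μ := by
        rw [inner_sub_right, inner_smul_right, inner_self_eq_norm_sq_to_K, hy1]
        simp
      have h2 : RCLike.re ⟪y, R y - (μ : ℂ) • y⟫_ℂ = RCLike.re ⟪y, R y⟫_ℂ - μ := by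
        rw [this]; simp
      rw [← h2]
      calc |RCLike.re ⟪y, R y - (μ : ℂ) • y⟫_ℂ| ≤ ‖⟪y, R y - (μ : ℂ) • y⟫_ℂ‖ := RCLike.abs_re_le_norm _
        _ ≤ ‖y‖ * ‖R y - (μ : ℂ) • y‖ := norm_inner_le_norm _ _
        _ < η := by rw [hy1, one_mul]; exact hy2
    obtain ⟨V, -, e2⟩ := hR.re_inner_apply y
    have e3 : RCLike.re ⟪y, R y⟫_ℂ ≤ 1 := by
      have : RCLike.re ⟪y, R y⟫_ℂ ≤ ‖y‖ * ‖R y‖ := re_inner_le_norm _ _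
      have := hR.norm_apply_le y
      rw [hy1] at *; linarith
    rw [abs_lt] at e1
    have e4 : 0 ≤ RCLike.re ⟪y, R y⟫_ℂ := by rw [e2]; positivity
    rcases hη with h | h <;> linarith [e1.1, e1.2]

/-- The Rayleigh quotient of a trial function bounds the norm of the resolvent from below. -/
lemma lt_norm_of_trial (hR : IsFormResolvent D R) {u : H} {V : K} (huV : (u, V) ∈ D)
    {E : ℝ} (hE : 0 < E) (h : ‖V‖ ^ 2 < E * ‖u‖ ^ 2) : (1 + E)⁻¹ < ‖R‖ := by
  have hu : 0 < ‖u‖ := by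
    rcases (norm_nonneg u).eq_or_lt with h0 | h0
    · rw [← h0] at h; nlinarith [sq_nonneg ‖V‖]
    · exact h0
  obtain ⟨V', hV', hi⟩ := hR u
  obtain ⟨V'', hV'', hre⟩ := hR.re_inner_apply u
  -- ‖u‖² is the real part of the inner product of (u, V) with (Ru, V') in H ⊕ K. Cauchy–Schwarz and
  -- ‖Ru‖² + ‖V'‖² = Re⟨u, Ru⟩ ≤ ‖R‖‖u‖² then give ‖R‖ ≥ ‖u‖² / (‖u‖² + ‖V‖²) > 1/(1 + E).
  have e1 : ‖u‖ ^ 2 = RCLike.re ⟪u, R u⟫_ℂ + RCLike.re ⟪V, V'⟫_ℂ := by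
    rw [hi u V huV, inner_sub_right, map_sub, inner_self_eq_norm_sq]; ring
  have e2 : RCLike.re ⟪u, R u⟫_ℂ = ‖R u‖ ^ 2 + ‖V'‖ ^ 2 := by
    have := hi _ _ hV'
    rw [inner_sub_right] at this
    have e : ⟪R u, u⟫_ℂ = ⟪R u, R u⟫_ℂ + ⟪V', V'⟫_ℂ := by rw [this]; ring
    rw [inner_re_symm, e, map_add, inner_self_eq_norm_sq, inner_self_eq_norm_sq]
  have a1 : RCLike.re ⟪u, R u⟫_ℂ ≤ ‖u‖ * ‖R u‖ := re_inner_le_norm _ _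
  have a2 : RCLike.re ⟪V, V'⟫_ℂ ≤ ‖V‖ * ‖V'‖ := re_inner_le_norm _ _
  have a3 : ‖R u‖ ≤ ‖R‖ * ‖u‖ := R.le_opNorm u
  have b1 : ‖u‖ ^ 2 ≤ ‖u‖ * ‖R u‖ + ‖V‖ * ‖V'‖ := by linarith
  have b2 : (‖u‖ * ‖R u‖ + ‖V‖ * ‖V'‖) ^ 2 ≤ (‖u‖ ^ 2 + ‖V‖ ^ 2) * (‖R u‖ ^ 2 + ‖V'‖ ^ 2) := by
    nlinarith [sq_nonneg (‖u‖ * ‖V'‖ - ‖V‖ * ‖R u‖)]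
  have b3 : ‖R u‖ ^ 2 + ‖V'‖ ^ 2 ≤ ‖R‖ * ‖u‖ ^ 2 := by
    rw [← e2]; nlinarith [norm_nonneg u]
  have b4 : (‖u‖ ^ 2) ^ 2 ≤ (‖u‖ ^ 2 + ‖V‖ ^ 2) * (‖R‖ * ‖u‖ ^ 2) :=
    (pow_le_pow_left₀ (by positivity) b1 2).trans
      (b2.trans (mul_le_mul_of_nonneg_left b3 (by positivity)))
  have hu2 : 0 < ‖u‖ ^ 2 := by positivity
  have b5 : ‖u‖ ^ 2 ≤ (‖u‖ ^ 2 + ‖V‖ ^ 2) * ‖R‖ := by nlinarith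
  have hRp : 0 < ‖R‖ := by
    rcases (norm_nonneg R).eq_or_lt with h0 | h0
    · rw [← h0] at b5; linarith
    · exact h0
  rw [inv_lt_iff_one_lt_mul₀ (by linarith)]
  nlinarith

/-- For self-adjoint R the spectral radius is the norm, so some real z in σ(R) has |z| = ‖R‖.
Nonnegativity of the form excludes negative z, because 1/z − 1 belongs to the spectrum of the
operator. The point ‖R‖ of σ(R) corresponds to the bottom of that spectrum. -/
lemma norm_mem_spectrum [CompleteSpace H] [Nontrivial H] (hR : IsFormResolvent D R)
    (hinj : ∀ x, R x = 0 → x = 0) : ((‖R‖ : ℝ) : ℂ) ∈ spectrum ℂ R := by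
  obtain ⟨z, hz, hzr⟩ := spectrum.exists_nnnorm_eq_spectralRadius (A := H →L[ℂ] H) R
  rw [hR.isSelfAdjoint.spectralRadius_eq_nnnorm] at hzr
  have hz1 : ‖z‖ = ‖R‖ := by
    have : ‖z‖₊ = ‖R‖₊ := by exact_mod_cast hzr
    exact congrArg NNReal.toReal this
  have hz2 := hR.isSelfAdjoint.mem_spectrum_eq_re hz
  have hRp : 0 < ‖R‖ := by
    rw [norm_pos_iff]
    rintro rfl
    obtain ⟨x, hx⟩ := exists_ne (0 : H)
    exact hx (hinj x (by simp))
  have hz0 : z.re ≠ 0 := fun h => by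
    rw [h] at hz2
    rw [hz2] at hz1
    exact hRp.ne' (by rw [← hz1]; simp)
  have hl : (z.re)⁻¹ - 1 ∈ realSpectrum (formOperatorGraph D).toLinearPMap := by
    change (((z.re)⁻¹ - 1 : ℝ) : ℂ) ∈ opSpectrum _
    have e : (1 + (((z.re)⁻¹ - 1 : ℝ) : ℂ)) = ((z.re⁻¹ : ℝ) : ℂ) := by push_cast; ring
    rw [mem_opSpectrum_iff_mem_spectrum hR hinj (by
      rw [e]; exact_mod_cast inv_ne_zero hz0), e, Complex.ofReal_inv, inv_inv, ← hz2]
    exact hz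
  have hl2 := nonneg_of_mem_realSpectrum hR hinj hl
  have hpos : 0 < z.re := by
    by_contra! h
    have : z.re⁻¹ ≤ 0 := inv_nonpos.2 h
    linarith
  have : z.re = ‖R‖ := by
    rw [← hz1, hz2, Complex.norm_real, Real.norm_of_nonneg (by simpa using hpos.le)]
    simp
  rw [← this, ← hz2]
  exact hz

end FormOperator

/-! ### Discrete spectrum below the threshold of a form bound of finite codimension -/

section DiscreteSpectrum

variable {H K : Type*} [NormedAddCommGroup H] [InnerProductSpace ℂ H]
    [NormedAddCommGroup K] [InnerProductSpace ℂ K] {D : Submodule ℂ (H × K)} {R : H →L[ℂ] H}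

/-- By symmetry, y ⟂ R fᵢ means fᵢ ⟂ R y, so the form bound applies to R y and gives (1 + E)‖Ry‖² ≤
Re⟨y, Ry⟩. Inserting Ry = r y + e leaves r((1 + E)r − 1)‖y‖² ≤ (2(1 + E)r + 1)‖y‖‖e‖, and the left
coefficient is positive because r > 1/(1 + E). The quotient of the two coefficients is the constant
C. -/
lemma norm_le_of_form_bound (hR : IsFormResolvent D R) {ι : Type*} (f : ι → H) {E r : ℝ}
    (hE : 0 < E) (hr : (1 + E)⁻¹ < r)
    (hf : ∀ u V, (u, V) ∈ D → (∀ i, ⟪f i, u⟫_ℂ = 0) → E * ‖u‖ ^ 2 ≤ ‖V‖ ^ 2) :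
    ∃ C > 0, ∀ y ∈ (Submodule.span ℂ (range fun i => R (f i)))ᗮ,
      ‖y‖ ≤ C * ‖R y - (r : ℂ) • y‖ := by
  have hc : 0 < 1 + E := by linarith
  have hr0 : 0 < r := (inv_pos.2 hc).trans hr
  have hcr : 1 < (1 + E) * r := by
    rw [inv_lt_iff_one_lt_mul₀ hc] at hr; linarith
  have hgap : 0 < r * ((1 + E) * r - 1) := by
    apply mul_pos hr0; linarith
  refine ⟨(2 * (1 + E) * r + 1) / (r * ((1 + E) * r - 1)), by positivity, fun y hy => ?_⟩
  obtain ⟨V, hV, hre⟩ := hR.re_inner_apply y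
  have hb := hf _ _ hV fun i => by
    rw [← hR.symmetric]
    exact Submodule.inner_right_of_mem_orthogonal (Submodule.subset_span (mem_range_self i)) hy
  set e := R y - (r : ℂ) • y with he
  have hRy : R y = (r : ℂ) • y + e := by rw [he]; abel
  have h1 : RCLike.re ⟪y, R y⟫_ℂ = r * ‖y‖ ^ 2 + RCLike.re ⟪y, e⟫_ℂ := by
    rw [hRy, inner_add_right, inner_smul_right, map_add, inner_self_eq_norm_sq_to_K]
    congr 1
    change ((r : ℂ) * ((‖y‖ : ℝ) : ℂ) ^ 2).re = _
    rw [← Complex.ofReal_pow, ← Complex.ofReal_mul, Complex.ofReal_re]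
  have h2 : ‖R y‖ ^ 2 = r ^ 2 * ‖y‖ ^ 2 + 2 * (r * RCLike.re ⟪y, e⟫_ℂ) + ‖e‖ ^ 2 := by
    rw [hRy, @norm_add_sq ℂ, inner_smul_left, norm_smul, Complex.conj_ofReal, Complex.norm_real,
      Real.norm_of_nonneg hr0.le, mul_pow]
    congr 3
    simp
  have h3 : |RCLike.re ⟪y, e⟫_ℂ| ≤ ‖y‖ * ‖e‖ :=
    (RCLike.abs_re_le_norm _).trans (norm_inner_le_norm _ _)
  set q := RCLike.re ⟪y, e⟫_ℂ
  have h4 : r * ((1 + E) * r - 1) * ‖y‖ ^ 2 ≤ (2 * (1 + E) * r + 1) * (‖y‖ * ‖e‖) := by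
    have h5 : (1 + E) * ‖R y‖ ^ 2 ≤ r * ‖y‖ ^ 2 + q := by rw [← h1, hre]; linarith
    rw [h2] at h5
    have h6 := abs_le.1 h3
    have h7 : 0 ≤ (1 + E) * ‖e‖ ^ 2 := by positivity
    have h8 : q - 2 * (1 + E) * r * q ≤ (2 * (1 + E) * r + 1) * (‖y‖ * ‖e‖) := by
      have hp : 0 ≤ 2 * (1 + E) * r := by positivity
      nlinarith [mul_le_mul_of_nonneg_left h6.1 hp]
    nlinarith
  rw [div_mul_eq_mul_div, le_div_iff₀ hgap]
  rcases (norm_nonneg y).eq_or_lt with h0 | h0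
  · rw [← h0]; simp; positivity
  · have : ‖y‖ * (‖y‖ * (r * ((1 + E) * r - 1))) ≤ ‖y‖ * ((2 * (1 + E) * r + 1) * ‖e‖) := by
      linarith
    exact le_of_mul_le_mul_left this h0

/-- An operator `A` that is bounded below on the orthogonal complement of a finite dimensional
space is proper on bounded sets. -/
lemma exists_subseq_tendsto_of_bounded_below [CompleteSpace H] (A : H →L[ℂ] H)
    (S : Submodule ℂ H) [FiniteDimensional ℂ S] {C : ℝ} (hC0 : 0 < C)
    (hC : ∀ y ∈ Sᗮ, ‖y‖ ≤ C * ‖A y‖) {x : ℕ → H} (hx : ∀ n, ‖x n‖ ≤ 1)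
    (hA : Tendsto (fun n => A (x n)) atTop (𝓝 0)) :
    ∃ a : H, ∃ φ : ℕ → ℕ, StrictMono φ ∧ Tendsto (x ∘ φ) atTop (𝓝 a) := by
  have : ProperSpace S := FiniteDimensional.proper ℂ S
  have hbd : Bornology.IsBounded (Metric.closedBall (0 : S) 1) := Metric.isBounded_closedBall
  -- The components in S are bounded in a finite dimensional space, so they converge along a
  -- subsequence. The components in Sᗮ then have convergent images under A, and the lower bound
  -- turns this into a Cauchy property.
  obtain ⟨z, -, φ, hφ, hz⟩ := tendsto_subseq_of_bounded hbd
    (x := fun n => S.orthogonalProjectionOnto (x n)) fun n => by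
      rw [mem_closedBall_zero_iff]
      exact (S.norm_orthogonalProjectionOnto_apply_le (x n)).trans (hx n)
  have hz' : Tendsto (fun n => S.starProjection (x (φ n))) atTop (𝓝 (z : H)) :=
    (continuous_subtype_val.tendsto z).comp hz
  set y : ℕ → H := fun n => x (φ n) - S.starProjection (x (φ n)) with hy
  have hyS : ∀ n, y n ∈ Sᗮ := fun n => S.sub_starProjection_mem_orthogonal _
  have hAy : Tendsto (fun n => A (y n)) atTop (𝓝 (0 - A z)) := by
    simp only [hy, map_sub]
    exact (hA.comp hφ.tendsto_atTop).sub ((A.continuous.tendsto _).comp hz')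
  have hcau : CauchySeq y := by
    rw [Metric.cauchySeq_iff]
    intro η hη
    obtain ⟨n0, hn0⟩ := Metric.cauchySeq_iff.1 hAy.cauchySeq (η / C) (by positivity)
    refine ⟨n0, fun m hm n hn => ?_⟩
    have h1 := hn0 m hm n hn
    rw [dist_eq_norm, ← map_sub] at h1
    rw [dist_eq_norm]
    calc ‖y m - y n‖ ≤ C * ‖A (y m - y n)‖ := hC _ (Sᗮ.sub_mem (hyS m) (hyS n))
      _ < C * (η / C) := by gcongr
      _ = η := by field_simp
  obtain ⟨b, hb⟩ := cauchySeq_tendsto_of_complete hcau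
  refine ⟨b + z, φ, hφ, ?_⟩
  have := hb.add hz'
  simpa [hy, Function.comp_def] using this

/-- If the form is bounded below by `E` on a subspace of finite codimension, the bottom of the
spectrum is a discrete eigenvalue as soon as it lies below `E`. -/
theorem discreteSpectrum_nonempty_of_form_bound [CompleteSpace H] [Nontrivial H]
    (hR : IsFormResolvent D R) (hinj : ∀ x, R x = 0 → x = 0) {ι : Type*} [Finite ι] (f : ι → H)
    {E : ℝ} (hE : 0 < E) (hr : (1 + E)⁻¹ < ‖R‖)
    (hf : ∀ u V, (u, V) ∈ D → (∀ i, ⟪f i, u⟫_ℂ = 0) → E * ‖u‖ ^ 2 ≤ ‖V‖ ^ 2) :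
    (discreteSpectrum (formOperatorGraph D).toLinearPMap).Nonempty := by
  set r := ‖R‖ with hrd
  have hr0 : 0 < r := (inv_pos.2 (by linarith : 0 < 1 + E)).trans hr
  have hrC : (r : ℂ) ≠ 0 := by exact_mod_cast hr0.ne'
  set S := Submodule.span ℂ (range fun i => R (f i)) with hS
  have hSfin : FiniteDimensional ℂ S := FiniteDimensional.span_of_finite ℂ (finite_range _)
  obtain ⟨C, hC0, hC⟩ := norm_le_of_form_bound hR f hE hr hf
  set A : H →L[ℂ] H := R - (r : ℂ) • 1 with hAd
  have hA : ∀ y, A y = R y - (r : ℂ) • y := fun y => rfl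
  -- Compactness principle used for both existence and isolation: a bounded sequence of approximate
  -- kernel vectors of R − r subconverges to a kernel vector.
  have hsub : ∀ x : ℕ → H, (∀ n, ‖x n‖ ≤ 1) → Tendsto (fun n => A (x n)) atTop (𝓝 0) →
      ∃ a : H, ∃ φ : ℕ → ℕ, StrictMono φ ∧ Tendsto (x ∘ φ) atTop (𝓝 a) ∧ A a = 0 := by
    intro x hx hAx
    obtain ⟨a, φ, hφ, ha⟩ := exists_subseq_tendsto_of_bounded_below A S hC0 hC hx hAx
    exact ⟨a, φ, hφ, ha, tendsto_nhds_unique ((A.continuous.tendsto a).comp ha)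
      (hAx.comp hφ.tendsto_atTop)⟩
  have hinvpos : ∀ n : ℕ, (0 : ℝ) < 1 / (n + 1) := fun n => by positivity
  have hspec := norm_mem_spectrum hR hinj
  have heig : ∃ a : H, a ≠ 0 ∧ A a = 0 := by
    choose x hx1 hx2 using fun n : ℕ => exists_approx_eigenvector hR.isSelfAdjoint hspec (hinvpos n)
    obtain ⟨a, φ, hφ, ha, ha0⟩ := hsub x (fun n => (hx1 n).le) (by
      refine squeeze_zero_norm (fun n => (hx2 n).le) tendsto_one_div_add_atTop_nhds_zero_nat)
    refine ⟨a, ?_, ha0⟩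
    rintro rfl
    have := ha.norm
    simp only [Function.comp_def, hx1, norm_zero] at this
    exact one_ne_zero (tendsto_nhds_unique tendsto_const_nhds this)
  set T := (formOperatorGraph D).toLinearPMap with hT
  set z : ℂ := (r : ℂ)⁻¹ - 1 with hz
  have hz1 : 1 + z = (r : ℂ)⁻¹ := by rw [hz]; ring
  have hz0 : 1 + z ≠ 0 := by rw [hz1]; exact inv_ne_zero hrC
  refine ⟨z, ?_, ?_, ?_, ?_⟩
  · rw [mem_opSpectrum_iff_mem_spectrum hR hinj hz0, hz1, inv_inv]
    exact hspec
  · by_contra! hcon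
    -- If points μₙ ≠ r of σ(R) converged to r, their approximate eigenvectors xₙ would subconverge
    -- to a unit vector a with Ra = ra. Eigenvectors for distinct eigenvalues being orthogonal, ⟨a,
    -- xₙ⟩ should tend to 0, which contradicts xₙ → a.
    have hgap : ∃ δ > 0, ∀ μ : ℝ, (μ : ℂ) ∈ spectrum ℂ R → |μ - r| < δ → μ = r := by
      by_contra! hcon2
      choose μ hμs hμr hμne using fun n : ℕ => hcon2 (1 / (n + 1)) (hinvpos n)
      -- The tolerance carries the factor |μₙ − r| because (r − μₙ)⟨a, xₙ⟩ = ⟨a, (R − μₙ)xₙ⟩ will be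
      -- divided by r − μₙ.
      have hpos : ∀ n : ℕ, 0 < |μ n - r| * (1 / ((n : ℝ) + 1)) := fun n =>
        mul_pos (abs_pos.2 (sub_ne_zero.2 (hμne n))) (hinvpos n)
      choose x hx1 hx2 using fun n : ℕ =>
        exists_approx_eigenvector hR.isSelfAdjoint (hμs n) (hpos n)
      have hlim0 : Tendsto (fun n : ℕ => 1 / ((n : ℝ) + 1)) atTop (𝓝 0) :=
        tendsto_one_div_add_atTop_nhds_zero_nat
      have hAx : ∀ n, A (x n) = (R (x n) - (μ n : ℂ) • x n) + ((μ n : ℂ) - r) • x n := fun n => by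
        rw [hA, sub_smul]; abel
      have hone : ∀ n : ℕ, 1 / ((n : ℝ) + 1) ≤ 1 := fun n => by
        rw [div_le_one (by positivity)]
        linarith [n.cast_nonneg (α := ℝ)]
      obtain ⟨a, φ, hφ, ha, ha0⟩ := hsub x (fun n => (hx1 n).le) (by
        refine squeeze_zero_norm (a := fun n : ℕ => 1 / ((n : ℝ) + 1) + 1 / ((n : ℝ) + 1))
          (fun n => ?_) (by simpa using hlim0.add hlim0)
        rw [hAx]
        refine (norm_add_le _ _).trans (add_le_add ?_ ?_)
        · refine (hx2 n).le.trans ?_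
          have := (hμr n).le.trans (hone n)
          have := (hinvpos n).le
          nlinarith
        · rw [norm_smul, hx1, mul_one, ← Complex.ofReal_sub, Complex.norm_real]
          exact (hμr n).le)
      have hanorm : ‖a‖ = 1 := by
        have := ha.norm
        simp only [Function.comp_def, hx1] at this
        exact (tendsto_nhds_unique tendsto_const_nhds this).symm
      have hRa : R a = (r : ℂ) • a := sub_eq_zero.1 ha0
      have hsmall : ∀ n, ‖⟪a, x n⟫_ℂ‖ ≤ 1 / ((n : ℝ) + 1) := fun n => by
        have e : ⟪a, R (x n) - (μ n : ℂ) • x n⟫_ℂ = ((r : ℂ) - μ n) * ⟪a, x n⟫_ℂ := by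
          rw [inner_sub_right, ← hR.symmetric, hRa, inner_smul_left, inner_smul_right,
            Complex.conj_ofReal]
          ring
        have h1 : |μ n - r| * ‖⟪a, x n⟫_ℂ‖ ≤ |μ n - r| * (1 / ((n : ℝ) + 1)) := by
          calc |μ n - r| * ‖⟪a, x n⟫_ℂ‖ = ‖⟪a, R (x n) - (μ n : ℂ) • x n⟫_ℂ‖ := by
                rw [e, norm_mul, ← Complex.ofReal_sub, Complex.norm_real, Real.norm_eq_abs,
                  abs_sub_comm]
            _ ≤ ‖a‖ * ‖R (x n) - (μ n : ℂ) • x n‖ := norm_inner_le_norm _ _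
            _ ≤ _ := by rw [hanorm, one_mul]; exact (hx2 n).le
        exact le_of_mul_le_mul_left h1 (abs_pos.2 (sub_ne_zero.2 (hμne n)))
      have l1 : Tendsto (fun n => ⟪a, x (φ n)⟫_ℂ) atTop (𝓝 ⟪a, a⟫_ℂ) :=
        ((innerSL ℂ a).continuous.tendsto a).comp ha
      have l2 : Tendsto (fun n => ⟪a, x (φ n)⟫_ℂ) atTop (𝓝 0) :=
        (squeeze_zero_norm hsmall hlim0).comp hφ.tendsto_atTop
      have := inner_self_eq_zero.1 (tendsto_nhds_unique l1 l2)
      rw [this, norm_zero] at hanorm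
      exact zero_ne_one hanorm
    obtain ⟨δ, hδ, hgap⟩ := hgap
    have hcont : ContinuousAt (fun w : ℂ => (1 + w)⁻¹) z :=
      (continuousAt_const.add continuousAt_id).inv₀ hz0
    -- The radius is also kept below r to exclude w = −1, where the convention 0⁻¹ = 0 would put the
    -- image at distance exactly r.
    obtain ⟨δ', hδ', hcl⟩ := Metric.continuousAt_iff.1 hcont (min δ r) (lt_min hδ hr0)
    obtain ⟨w, hw, hwz, hwne⟩ := hcon δ' hδ'
    have h1 := hcl (x := w) (by rwa [dist_eq_norm])
    rw [hz1, inv_inv, dist_eq_norm, lt_min_iff] at h1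
    have hw0 : 1 + w ≠ 0 := fun h => by
      rw [h, inv_zero, zero_sub, norm_neg, Complex.norm_real, Real.norm_of_nonneg hr0.le] at h1
      exact lt_irrefl _ h1.2
    rw [mem_opSpectrum_iff_mem_spectrum hR hinj hw0] at hw
    have hre := hR.isSelfAdjoint.mem_spectrum_eq_re hw
    set m : ℝ := ((1 + w)⁻¹).re with hm
    have hre' : (1 + w)⁻¹ = (m : ℂ) := hre
    rw [hre'] at hw h1
    rw [← Complex.ofReal_sub, Complex.norm_real, Real.norm_eq_abs] at h1
    have hmr := hgap m hw h1.1
    apply hwne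
    rw [hmr] at hre'
    rw [hz, ← hre', inv_inv]; ring
  · obtain ⟨a, ha, ha0⟩ := heig
    have hRa : R a = (r : ℂ) • a := sub_eq_zero.1 ha0
    rw [Submodule.ne_bot_iff]
    refine ⟨⟨R a, mem_domain_formOperator hR a⟩, ?_, ?_⟩
    · rw [eigenspace, LinearMap.mem_ker]
      change T ⟨R a, mem_domain_formOperator hR a⟩ - z • R a = 0
      rw [formOperator_resolvent_apply hR hinj, sub_sub]
      have e : R a + z • R a = (1 + z) • R a := by rw [add_smul, one_smul]
      rw [e, hz1, hRa, smul_smul, inv_mul_cancel₀ hrC, one_smul, sub_self]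
    · intro h
      exact ha (hinj a (congrArg Subtype.val h))
  · have hRx : ∀ x : eigenspace T z, A ((x : T.domain) : H) = 0 := fun x => by
      have h0 : T (x : T.domain) - z • ((x : T.domain) : H) = 0 := x.2
      have h1 := formOperator_apply hR hinj (x : T.domain)
      change R (T (x : T.domain) + ((x : T.domain) : H)) = _ at h1
      rw [sub_eq_zero.1 h0] at h1
      nth_rewrite 2 [← one_smul ℂ ((x : T.domain) : H)] at h1
      rw [← add_smul, add_comm, hz1, map_smul, inv_smul_eq_iff₀ hrC] at h1
      rw [hA, h1, sub_self]
    -- Finite multiplicity: an eigenvector with zero projection on S lies in Sᗮ and is killed by R −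
    -- r, hence vanishes by the lower bound.
    let g : eigenspace T z →ₗ[ℂ] S := (S.orthogonalProjectionOnto : H →ₗ[ℂ] S).comp
      (T.domain.subtype.comp (eigenspace T z).subtype)
    refine FiniteDimensional.of_injective g ?_
    rw [injective_iff_map_eq_zero]
    intro x hx
    have hxS : ((x : T.domain) : H) ∈ Sᗮ := by
      rw [← Submodule.orthogonalProjectionOnto_eq_zero_iff]
      exact hx
    have h2 := hC _ hxS
    rw [← hA, hRx, norm_zero, mul_zero] at h2
    exact Subtype.ext (Subtype.ext (norm_le_zero_iff.1 h2))

end DiscreteSpectrum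

/-! ### Geometry of purely twisted strips -/

/-- A strip whose coordinate lines are orthogonal, with metric
`(1 + ε² t² q(s)) ds² + ε² dt²`. -/
structure IsOrthogonalStrip {d : ℕ} (L : ℝ × ℝ → EuclideanSpace ℝ (Fin d)) (ε : ℝ) (q : ℝ → ℝ) :
    Prop where
  pos : 0 < ε
  continuous_twist : Continuous q
  twist_nonneg : ∀ s, 0 ≤ q s
  continuous_tangentVec : ∀ i, Continuous (tangentVec L i)
  norm_sq_tangentVec_zero : ∀ p, ‖tangentVec L 0 p‖ ^ 2 = 1 + (ε * p.2) ^ 2 * q p.1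
  norm_tangentVec_one : ∀ p, ‖tangentVec L 1 p‖ = ε
  inner_tangentVec : ∀ p, ⟪tangentVec L 0 p, tangentVec L 1 p⟫_ℝ = 0

/-- The length of the horizontal coordinate vector of an orthogonal strip. -/
def stretch (ε : ℝ) (q : ℝ → ℝ) (p : ℝ × ℝ) : ℝ := √(1 + (ε * p.2) ^ 2 * q p.1)

section Strip

variable {n : ℕ} {Γ : ℝ → EuclideanSpace ℝ (Fin (n + 1))}
    {N : Fin n → ℝ → EuclideanSpace ℝ (Fin (n + 1))} {k : Fin n → ℝ → ℝ}
    {Θ : ℝ → EuclideanSpace ℝ (Fin n)}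

lemma IsRelativelyParallelFrame.inner_normal (h : IsRelativelyParallelFrame Γ N k) (s : ℝ)
    (i j : Fin n) : ⟪N i s, N j s⟫_ℝ = if i = j then 1 else 0 := by
  have := orthonormal_iff_ite.1 (h.orthonormal s) i.succ j.succ
  simpa [Fin.succ_inj] using this

lemma IsRelativelyParallelFrame.inner_tangent_normal (h : IsRelativelyParallelFrame Γ N k) (s : ℝ)
    (j : Fin n) : ⟪deriv Γ s, N j s⟫_ℝ = 0 := by
  have := orthonormal_iff_ite.1 (h.orthonormal s) 0 j.succ
  rw [if_neg (Fin.succ_ne_zero j).symm] at this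
  simpa using this

lemma IsRelativelyParallelFrame.norm_tangent (h : IsRelativelyParallelFrame Γ N k) (s : ℝ) :
    ‖deriv Γ s‖ = 1 := by
  simpa using (h.orthonormal s).1 0

lemma IsRelativelyParallelFrame.inner_combination (h : IsRelativelyParallelFrame Γ N k) (s : ℝ)
    (a b : Fin n → ℝ) : ⟪∑ j, a j • N j s, ∑ j, b j • N j s⟫_ℝ = ∑ j, a j * b j := by
  simp only [sum_inner, inner_sum, inner_smul_left, inner_smul_right, h.inner_normal]
  simp [mul_comm]

lemma IsRelativelyParallelFrame.inner_tangent_sum (h : IsRelativelyParallelFrame Γ N k) (s : ℝ)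
    (b : Fin n → ℝ) : ⟪deriv Γ s, ∑ j, b j • N j s⟫_ℝ = 0 := by
  simp only [inner_sum, inner_smul_right, h.inner_tangent_normal]
  simp

lemma hasDerivAt_coord (hΘ : ContDiff ℝ 1 Θ) (s : ℝ) (j : Fin n) :
    HasDerivAt (fun s => Θ s j) (deriv Θ s j) s :=
  ((EuclideanSpace.proj j : EuclideanSpace ℝ (Fin n) →L[ℝ] ℝ).hasFDerivAt).comp_hasDerivAt s
    ((hΘ.differentiable (by simp)) s).hasDerivAt

/-- The derivatives N_j' contribute −(k·Θ)T, which vanishes by pure twisting. Only Θ' survives, and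
no curvature enters the metric. -/
lemma hasDerivAt_normal_combination (h : IsRelativelyParallelFrame Γ N k) (hΘ : ContDiff ℝ 1 Θ)
    (hunbent : ∀ s, ∑ j, k j s * Θ s j = 0) (s : ℝ) :
    HasDerivAt (fun s => ∑ j, Θ s j • N j s) (∑ j, deriv Θ s j • N j s) s := by
  have h1 : ∀ j ∈ Finset.univ, HasDerivAt (fun s => Θ s j • N j s)
      (Θ s j • (-(k j s) • deriv Γ s) + deriv Θ s j • N j s) s := fun j _ => by
    have hN := (((h.contDiff_normal j).differentiable (by simp)) s).hasDerivAt
    rw [h.deriv_normal] at hN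
    exact (hasDerivAt_coord hΘ s j).smul hN
  have h2 := HasDerivAt.fun_sum h1
  convert! h2 using 1
  rw [Finset.sum_add_distrib]
  simp only [smul_smul]
  rw [← Finset.sum_smul]
  have : ∑ j, Θ s j * -(k j s) = 0 := by
    rw [← neg_eq_zero, ← Finset.sum_neg_distrib, ← hunbent s]
    exact Finset.sum_congr rfl fun j _ => by ring
  rw [this, zero_smul, zero_add]

lemma contDiff_normal_combination (h : IsRelativelyParallelFrame Γ N k) (hΘ : ContDiff ℝ 1 Θ) :
    ContDiff ℝ 1 (fun s => ∑ j, Θ s j • N j s) :=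
  ContDiff.sum fun j _ => (((EuclideanSpace.proj j : EuclideanSpace ℝ (Fin n) →L[ℝ] ℝ).contDiff.comp
    hΘ).smul (h.contDiff_normal j))

lemma differentiable_stripMap (h : IsRelativelyParallelFrame Γ N k) (hΘ : ContDiff ℝ 1 Θ) (ε : ℝ) :
    Differentiable ℝ (stripMap Γ N Θ ε) := by
  have h1 : Differentiable ℝ Γ := h.contDiff_curve.differentiable (by simp)
  have h2 := (contDiff_normal_combination h hΘ).differentiable (by simp)
  exact (h1.comp differentiable_fst).add
    ((differentiable_snd.const_mul ε).smul (h2.comp differentiable_fst))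

lemma tangentVec_stripMap_zero (h : IsRelativelyParallelFrame Γ N k) (hΘ : ContDiff ℝ 1 Θ)
    (hunbent : ∀ s, ∑ j, k j s * Θ s j = 0) (ε : ℝ) (p : ℝ × ℝ) :
    tangentVec (stripMap Γ N Θ ε) 0 p =
      deriv Γ p.1 + (ε * p.2) • ∑ j, deriv Θ p.1 j • N j p.1 := by
  have hd := (differentiable_stripMap h hΘ ε p).hasFDerivAt
  have hl : HasDerivAt (fun s : ℝ => (s, p.2)) ((1 : ℝ), (0 : ℝ)) p.1 :=
    (hasDerivAt_id p.1).prodMk (hasDerivAt_const p.1 p.2)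
  have h1 := HasFDerivAt.comp_hasDerivAt p.1 (by exact hd) hl
  have h2 : HasDerivAt (fun s => Γ s + (ε * p.2) • ∑ j, Θ s j • N j s)
      (deriv Γ p.1 + (ε * p.2) • ∑ j, deriv Θ p.1 j • N j p.1) p.1 :=
    ((h.contDiff_curve.differentiable (by simp)) p.1).hasDerivAt.add
      ((hasDerivAt_normal_combination h hΘ hunbent p.1).fun_const_smul _)
  exact h1.unique h2

lemma tangentVec_stripMap_one (h : IsRelativelyParallelFrame Γ N k) (hΘ : ContDiff ℝ 1 Θ)
    (ε : ℝ) (p : ℝ × ℝ) :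
    tangentVec (stripMap Γ N Θ ε) 1 p = ε • ∑ j, Θ p.1 j • N j p.1 := by
  have hd := (differentiable_stripMap h hΘ ε p).hasFDerivAt
  have hl : HasDerivAt (fun t : ℝ => (p.1, t)) ((0 : ℝ), (1 : ℝ)) p.2 :=
    (hasDerivAt_const p.2 p.1).prodMk (hasDerivAt_id p.2)
  have h1 := HasFDerivAt.comp_hasDerivAt p.2 (by exact hd) hl
  have h2 : HasDerivAt (fun t => Γ p.1 + (ε * t) • ∑ j, Θ p.1 j • N j p.1)
      ((ε * 1) • ∑ j, Θ p.1 j • N j p.1) p.2 :=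
    (((hasDerivAt_id p.2).const_mul ε).smul_const _).const_add _
  rw [mul_one] at h2
  exact h1.unique h2

/-- The tangent vectors are T + εt ∑ Θ_j' N_j and ε ∑ Θ_j N_j. They are orthogonal because the frame
is orthonormal and Θ·Θ' = 0. The rest of the argument uses the strip only through this structure. -/
theorem isOrthogonalStrip_stripMap (h : IsRelativelyParallelFrame Γ N k) (hΘ : ContDiff ℝ 1 Θ)
    (hΘ_unit : ∀ s, ∑ j, Θ s j ^ 2 = 1) {ε : ℝ} (hε : 0 < ε)
    (hunbent : ∀ s, ∑ j, k j s * Θ s j = 0) :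
    IsOrthogonalStrip (stripMap Γ N Θ ε) ε (fun s => ‖deriv Θ s‖ ^ 2) where
  pos := hε
  continuous_twist := (hΘ.continuous_deriv (by simp)).norm.pow 2
  twist_nonneg s := sq_nonneg _
  continuous_tangentVec i := by
    have hc1 : Continuous (deriv Γ) := h.contDiff_curve.continuous_deriv (by simp)
    have hN : ∀ j, Continuous (N j) := fun j => (h.contDiff_normal j).continuous
    have hT : ∀ j, Continuous fun s => Θ s j := fun j =>
      (EuclideanSpace.proj j : EuclideanSpace ℝ (Fin n) →L[ℝ] ℝ).continuous.comp hΘ.continuous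
    have hT' : ∀ j, Continuous fun s => deriv Θ s j := fun j =>
      (EuclideanSpace.proj j : EuclideanSpace ℝ (Fin n) →L[ℝ] ℝ).continuous.comp
        (hΘ.continuous_deriv (by simp))
    fin_cases i
    · have e : tangentVec (stripMap Γ N Θ ε) 0 = _ :=
        funext (tangentVec_stripMap_zero h hΘ hunbent ε)
      simp only [Fin.zero_eta, e]
      fun_prop
    · have e : tangentVec (stripMap Γ N Θ ε) 1 = _ := funext (tangentVec_stripMap_one h hΘ ε)
      simp only [Fin.mk_one, e]
      fun_prop
  norm_sq_tangentVec_zero p := by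
    rw [tangentVec_stripMap_zero h hΘ hunbent, norm_add_sq_real, inner_smul_right,
      h.inner_tangent_sum, norm_smul, mul_pow, h.norm_tangent, ← real_inner_self_eq_norm_sq (∑ j, _),
      h.inner_combination, EuclideanSpace.real_norm_sq_eq]
    simp only [mul_zero, add_zero, one_pow, Real.norm_eq_abs, sq_abs]
    simp only [pow_two]
  norm_tangentVec_one p := by
    rw [tangentVec_stripMap_one h hΘ, norm_smul, Real.norm_of_nonneg hε.le]
    have : ‖∑ j, Θ p.1 j • N j p.1‖ ^ 2 = 1 := by
      rw [← real_inner_self_eq_norm_sq, h.inner_combination, ← hΘ_unit p.1]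
      exact Finset.sum_congr rfl fun j _ => by ring
    rw [(pow_eq_one_iff_of_nonneg (norm_nonneg _) two_ne_zero).1 this, mul_one]
  inner_tangentVec p := by
    rw [tangentVec_stripMap_zero h hΘ hunbent, tangentVec_stripMap_one h hΘ, inner_add_left,
      inner_smul_right, inner_smul_right, inner_smul_left, h.inner_tangent_sum, h.inner_combination]
    -- Differentiating |Θ|² = 1 gives Θ·Θ' = 0.
    have h1 : HasDerivAt (fun s => ∑ j, Θ s j ^ 2) (∑ j, 2 * Θ p.1 j ^ (2 - 1) * deriv Θ p.1 j) p.1 :=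
      HasDerivAt.fun_sum fun j _ => (hasDerivAt_coord hΘ p.1 j).pow 2
    have h2 : HasDerivAt (fun s => ∑ j, Θ s j ^ 2) 0 p.1 := by
      simp only [hΘ_unit]; exact hasDerivAt_const _ _
    have h3 := h1.unique h2
    have h4 : ∑ j, deriv Θ p.1 j * Θ p.1 j = 0 := by
      have : ∑ j, 2 * Θ p.1 j ^ (2 - 1) * deriv Θ p.1 j = 2 * ∑ j, deriv Θ p.1 j * Θ p.1 j := by
        rw [Finset.mul_sum]; exact Finset.sum_congr rfl fun j _ => by simp; ring
      rw [this] at h3; linarith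
    rw [h4]; simp

end Strip

/-! ### Stretch factor and area density -/

namespace IsOrthogonalStrip

variable {d : ℕ} {L : ℝ × ℝ → EuclideanSpace ℝ (Fin d)} {ε : ℝ} {q : ℝ → ℝ}

lemma one_le_stretch (h : IsOrthogonalStrip L ε q) (p : ℝ × ℝ) : 1 ≤ stretch ε q p := by
  rw [stretch, Real.one_le_sqrt]
  have := mul_nonneg (sq_nonneg (ε * p.2)) (h.twist_nonneg p.1)
  linarith

lemma stretch_pos (h : IsOrthogonalStrip L ε q) (p : ℝ × ℝ) : 0 < stretch ε q p :=
  zero_lt_one.trans_le (h.one_le_stretch p)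

lemma continuous_stretch (h : IsOrthogonalStrip L ε q) : Continuous (stretch ε q) := by
  have := h.continuous_twist
  unfold stretch
  fun_prop

lemma sq_stretch (h : IsOrthogonalStrip L ε q) (p : ℝ × ℝ) :
    stretch ε q p ^ 2 = 1 + (ε * p.2) ^ 2 * q p.1 := by
  rw [stretch, Real.sq_sqrt]
  have := mul_nonneg (sq_nonneg (ε * p.2)) (h.twist_nonneg p.1)
  linarith

lemma norm_tangentVec_zero (h : IsOrthogonalStrip L ε q) (p : ℝ × ℝ) :
    ‖tangentVec L 0 p‖ = stretch ε q p := by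
  rw [stretch, ← h.norm_sq_tangentVec_zero, Real.sqrt_sq (norm_nonneg _)]

lemma sqrt_det (h : IsOrthogonalStrip L ε q) (p : ℝ × ℝ) :
    √(inducedMetric L p).det = ε * stretch ε q p := by
  have : (inducedMetric L p).det = (ε * stretch ε q p) ^ 2 := by
    rw [inducedMetric, Matrix.det_fin_two]
    simp only [Matrix.gram_apply]
    rw [real_inner_self_eq_norm_sq, real_inner_self_eq_norm_sq, h.inner_tangentVec,
      h.norm_tangentVec_one, h.norm_tangentVec_zero]
    ring
  rw [this, Real.sqrt_sq (mul_pos h.pos (h.stretch_pos p)).le]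

lemma area_eq (h : IsOrthogonalStrip L ε q) :
    area L = (volume.restrict Lam).withDensity fun p => ENNReal.ofReal (ε * stretch ε q p) := by
  simp only [area, h.sqrt_det]

end IsOrthogonalStrip

/-! ### The parameter strip -/

lemma isOpen_Lam : IsOpen Lam :=
  (isOpen_lt continuous_const continuous_snd).inter (isOpen_lt continuous_snd continuous_const)

lemma measurableSet_Lam : MeasurableSet Lam := isOpen_Lam.measurableSet

lemma convex_Lam : Convex ℝ Lam := by
  have : Lam = (LinearMap.snd ℝ ℝ ℝ) ⁻¹' Ioo (0 : ℝ) 1 := rfl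
  rw [this]
  exact (convex_Ioo 0 1).linear_preimage _

lemma ae_snd_ne (c : ℝ) : ∀ᵐ p : ℝ × ℝ, p.2 ≠ c := by
  have h : {p : ℝ × ℝ | ¬ p.2 ≠ c} = univ ×ˢ {c} := by ext p; simp
  rw [ae_iff, h, Measure.volume_eq_prod, Measure.prod_prod]
  simp

/-- The edge t = 0 is a null set, so integrability up to the edge can be read off from the measure
on the open strip. -/
lemma restrict_LamBottom :
    (volume : Measure (ℝ × ℝ)).restrict LamBottom = volume.restrict Lam := by
  refine Measure.restrict_congr_set ?_
  filter_upwards [ae_snd_ne 0] with p hp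
  have : (p ∈ LamBottom) = (p ∈ Lam) := by
    simp only [LamBottom, Lam, mem_ofPred_eq, eq_iff_iff]
    exact ⟨fun h => ⟨lt_of_le_of_ne h.1 (Ne.symm hp), h.2⟩, fun h => ⟨h.1.le, h.2⟩⟩
  exact this

lemma locallyIntegrableOn_Lam {F : Type*} [NormedAddCommGroup F] {u : ℝ × ℝ → F}
    (h : LocallyIntegrable u (volume.restrict Lam)) : LocallyIntegrableOn u Lam :=
  locallyIntegrableOn_of_locallyIntegrable_restrict h

lemma locallyIntegrableOn_LamBottom {F : Type*} [NormedAddCommGroup F] {u : ℝ × ℝ → F}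
    (h : LocallyIntegrable u (volume.restrict Lam)) : LocallyIntegrableOn u LamBottom := by
  rw [← restrict_LamBottom] at h
  exact locallyIntegrableOn_of_locallyIntegrable_restrict h

namespace IsOrthogonalStrip

variable {d : ℕ} {L : ℝ × ℝ → EuclideanSpace ℝ (Fin d)} {ε : ℝ} {q : ℝ → ℝ}

/-! ### The area measure of an orthogonal strip -/

lemma density_pos (h : IsOrthogonalStrip L ε q) (p : ℝ × ℝ) : 0 < ε * stretch ε q p :=
  mul_pos h.pos (h.stretch_pos p)

lemma continuous_density (h : IsOrthogonalStrip L ε q) :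
    Continuous fun p => ε * stretch ε q p :=
  h.continuous_stretch.const_mul ε

lemma measurable_density (h : IsOrthogonalStrip L ε q) :
    Measurable fun p => ENNReal.ofReal (ε * stretch ε q p) :=
  h.continuous_density.measurable.ennreal_ofReal

lemma ae_area_iff (h : IsOrthogonalStrip L ε q) {P : ℝ × ℝ → Prop} :
    (∀ᵐ p ∂area L, P p) ↔ ∀ᵐ p ∂(volume.restrict Lam), P p := by
  rw [h.area_eq, ae_withDensity_iff h.measurable_density]
  simp only [ne_eq, ENNReal.ofReal_eq_zero, not_le, h.density_pos, forall_const]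

lemma integral_area (h : IsOrthogonalStrip L ε q) {F : Type*} [NormedAddCommGroup F]
    [NormedSpace ℝ F] (f : ℝ × ℝ → F) :
    ∫ p, f p ∂area L = ∫ p in Lam, (ε * stretch ε q p) • f p := by
  rw [h.area_eq, integral_withDensity_eq_integral_toReal_smul h.measurable_density (by simp)]
  simp only [ENNReal.toReal_ofReal (h.density_pos _).le]

/-- Because h ≥ 1, square integrability on the surface controls square integrability for ds dt, even
where the twist is unbounded. All local integrability conditions up to the edges follow from this.
-/
lemma volume_restrict_le (h : IsOrthogonalStrip L ε q) :
    (volume : Measure (ℝ × ℝ)).restrict Lam ≤ (ENNReal.ofReal ε)⁻¹ • area L := by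
  refine Measure.le_iff.2 fun s hs => ?_
  rw [Measure.smul_apply, smul_eq_mul, h.area_eq, withDensity_apply _ hs]
  have h0 : ENNReal.ofReal ε ≠ 0 := by simpa using h.pos
  rw [← ENNReal.mul_le_iff_le_inv h0 ENNReal.ofReal_ne_top, ← setLIntegral_const]
  refine lintegral_mono fun p => ENNReal.ofReal_le_ofReal ?_
  nlinarith [h.one_le_stretch p, h.pos]

lemma isFiniteMeasureOnCompacts_area (h : IsOrthogonalStrip L ε q) :
    IsFiniteMeasureOnCompacts (area L) := by
  refine ⟨fun K hK => ?_⟩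
  obtain ⟨C, hC⟩ := hK.exists_bound_of_continuousOn h.continuous_density.continuousOn
  rw [h.area_eq, withDensity_apply _ hK.measurableSet]
  calc ∫⁻ p in K, ENNReal.ofReal (ε * stretch ε q p) ∂(volume.restrict Lam)
      ≤ ∫⁻ p in K, ENNReal.ofReal C ∂(volume.restrict Lam) :=
        setLIntegral_mono measurable_const fun p hp =>
          ENNReal.ofReal_le_ofReal ((le_abs_self _).trans (hC p hp))
    _ = ENNReal.ofReal C * (volume.restrict Lam) K := setLIntegral_const _ _
    _ < ⊤ := ENNReal.mul_lt_top ENNReal.ofReal_lt_top hK.measure_lt_top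

lemma memLp_restrict (h : IsOrthogonalStrip L ε q) {F : Type*} [NormedAddCommGroup F]
    {u : ℝ × ℝ → F} (hu : MemLp u 2 (area L)) : MemLp u 2 (volume.restrict Lam) :=
  hu.of_measure_le_smul (by simpa using h.pos) h.volume_restrict_le

lemma locallyIntegrable_restrict (h : IsOrthogonalStrip L ε q) {F : Type*} [NormedAddCommGroup F]
    {u : ℝ × ℝ → F} (hu : MemLp u 2 (area L)) : LocallyIntegrable u (volume.restrict Lam) :=
  (h.memLp_restrict hu).locallyIntegrable (by norm_num)

lemma locallyIntegrable_tangentPairing (h : IsOrthogonalStrip L ε q) (i : Fin 2)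
    {V : ℝ × ℝ → EuclideanSpace ℂ (Fin d)} (hV : MemLp V 2 (area L)) :
    LocallyIntegrable (fun p => tangentPairing L i p (V p)) (volume.restrict Lam) := by
  have hV' := h.memLp_restrict hV
  refine locallyIntegrable_finsetSum _ fun m _ => ?_
  refine LocallyIntegrable.continuous_mul ?_ ?_
  · exact Complex.continuous_ofReal.comp
      ((EuclideanSpace.proj m : EuclideanSpace ℝ (Fin d) →L[ℝ] ℝ).continuous.comp
        (h.continuous_tangentVec i))
  · have : MemLp (fun p => V p m) 2 (volume.restrict Lam) :=
      (EuclideanSpace.proj m : EuclideanSpace ℂ (Fin d) →L[ℂ] ℂ).comp_memLp' hV'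
    exact this.locallyIntegrable (by norm_num)

/-- For square integrable data, the local integrability conditions are automatic. -/
lemma hasDirichletGradient_iff (h : IsOrthogonalStrip L ε q) {u : ℝ × ℝ → ℂ}
    {V : ℝ × ℝ → EuclideanSpace ℂ (Fin d)} (hu : MemLp u 2 (area L)) (hV : MemLp V 2 (area L)) :
    HasDirichletGradient L u V ↔ (∀ᵐ p ∂(volume.restrict Lam), IsTangent L p (V p)) ∧
      (∀ (i : Fin 2) (φ : ℝ × ℝ → ℝ), ContDiff ℝ ∞ φ → HasCompactSupport φ → tsupport φ ⊆ Lam →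
        ∫ p in Lam, (fderiv ℝ φ p (coordDir i) • u p + φ p • tangentPairing L i p (V p)) = 0) ∧
      (∀ φ : ℝ × ℝ → ℝ, ContDiff ℝ ∞ φ → HasCompactSupport φ → tsupport φ ⊆ {p | p.2 < 1} →
        ∫ p in Lam, (fderiv ℝ φ p (coordDir 1) • u p + φ p • tangentPairing L 1 p (V p)) = 0) := by
  have hu1 := h.locallyIntegrable_restrict hu
  have hV1 := fun i => h.locallyIntegrable_tangentPairing i hV
  have key : ∀ (i : Fin 2) (φ : ℝ × ℝ → ℝ), ContDiff ℝ ∞ φ → HasCompactSupport φ →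
      ∫ p in Lam, (fderiv ℝ φ p (coordDir i) • u p + φ p • tangentPairing L i p (V p)) =
        (∫ p in Lam, fderiv ℝ φ p (coordDir i) • u p) +
          ∫ p in Lam, φ p • tangentPairing L i p (V p) := fun i φ hφ hc =>
    integral_add (hu1.integrable_smul_left_of_hasCompactSupport (continuous_deriv hφ i)
      (hasCompactSupport_deriv hc i)) ((hV1 i).integrable_smul_left_of_hasCompactSupport
        hφ.continuous hc)
  constructor
  · rintro ⟨⟨h1, h2⟩, h3⟩
    refine ⟨h1, fun i φ hφ hc hs => ?_, fun φ hφ hc hs => ?_⟩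
    · rw [key i φ hφ hc, (h2 i).2.2 φ hφ hc hs, neg_add_cancel]
    · rw [h3.2.2.2 φ hφ hc hs]; simp
  · rintro ⟨h1, h2, h3⟩
    refine ⟨⟨h1, fun i => ⟨locallyIntegrableOn_Lam hu1, locallyIntegrableOn_Lam (hV1 i),
      fun φ hφ hc hs => ?_⟩⟩, locallyIntegrableOn_LamBottom hu1,
      locallyIntegrableOn_LamBottom (hV1 1), locallyIntegrable_zero, fun φ hφ hc hs => ?_⟩
    · have := h2 i φ hφ hc hs
      rw [key i φ hφ hc] at this
      exact eq_neg_of_add_eq_zero_left this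
    · rw [h3 φ hφ hc hs]; simp

/-- Tangency and the weak identities depend only on almost everywhere classes, since surface area
and ds dt have the same null sets in Λ. The chosen representatives of `Lp` elements can therefore be
used throughout. -/
lemma mem_gradientGraph_iff (h : IsOrthogonalStrip L ε q) {x : L2 L × L2Vec L} :
    x ∈ gradientGraph L ↔ HasDirichletGradient L x.1 x.2 := by
  constructor
  · rintro ⟨u, V, hu, hV, hg⟩
    have hu2 : MemLp u 2 (area L) := (memLp_congr_ae hu).1 (Lp.memLp x.1)
    have hV2 : MemLp V 2 (area L) := (memLp_congr_ae hV).1 (Lp.memLp x.2)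
    rw [h.hasDirichletGradient_iff hu2 hV2] at hg
    rw [h.hasDirichletGradient_iff (Lp.memLp _) (Lp.memLp _)]
    have hu' := h.ae_area_iff.1 hu
    have hV' := h.ae_area_iff.1 hV
    have e : ∀ (i : Fin 2) (φ : ℝ × ℝ → ℝ),
        ∫ p in Lam, (fderiv ℝ φ p (coordDir i) • x.1 p + φ p • tangentPairing L i p (x.2 p)) =
        ∫ p in Lam, (fderiv ℝ φ p (coordDir i) • u p + φ p • tangentPairing L i p (V p)) := by
      intro i φ
      refine integral_congr_ae ?_
      filter_upwards [hu', hV'] with p h1 h2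
      rw [h1, h2]
    simp only [e]
    refine ⟨?_, hg.2⟩
    filter_upwards [hg.1, hV'] with p h1 h2
    rwa [h2]
  · exact fun hg => ⟨_, _, ae_eq_refl _, ae_eq_refl _, hg⟩

lemma mk_mem_gradientGraph {u : ℝ × ℝ → ℂ}
    {V : ℝ × ℝ → EuclideanSpace ℂ (Fin d)} (hu : MemLp u 2 (area L)) (hV : MemLp V 2 (area L))
    (hg : HasDirichletGradient L u V) : (hu.toLp u, hV.toLp V) ∈ gradientGraph L :=
  ⟨u, V, hu.coeFn_toLp, hV.coeFn_toLp, hg⟩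

/-! ### Closedness of the gradient -/

/-- Integration over the strip against a continuous compactly supported function is a continuous
functional on `L²`. -/
lemma exists_integral_eq_inner (h : IsOrthogonalStrip L ε q) {F : Type*} [NormedAddCommGroup F]
    [InnerProductSpace ℂ F] [InnerProductSpace ℝ F] {w : ℝ × ℝ → F} (hw : Continuous w)
    (hc : HasCompactSupport w) :
    ∃ f : Lp F 2 (area L), ∀ v : Lp F 2 (area L), ∫ p in Lam, ⟪w p, v p⟫_ℂ = ⟪f, v⟫_ℂ := by
  have := h.isFiniteMeasureOnCompacts_area
  have hcont : Continuous fun p => (((ε * stretch ε q p)⁻¹ : ℝ) : ℂ) • w p :=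
    (Complex.continuous_ofReal.comp
      (h.continuous_density.inv₀ fun p => (h.density_pos p).ne')).smul hw
  have hcs : HasCompactSupport fun p => (((ε * stretch ε q p)⁻¹ : ℝ) : ℂ) • w p := hc.smul_left
  have hm : MemLp (fun p => (((ε * stretch ε q p)⁻¹ : ℝ) : ℂ) • w p) 2 (area L) :=
    hcont.memLp_of_hasCompactSupport hcs
  refine ⟨hm.toLp _, fun v => ?_⟩
  rw [L2.inner_def, h.integral_area]
  refine integral_congr_ae ?_
  filter_upwards [h.ae_area_iff.1 hm.coeFn_toLp] with p hp
  rw [hp, inner_smul_left, Complex.conj_ofReal, Complex.real_smul, ← mul_assoc,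
    ← Complex.ofReal_mul, mul_inv_cancel₀ (h.density_pos p).ne', Complex.ofReal_one, one_mul]

/-- For a fixed test function the left side of the weak identity is a continuous functional of (u,
V). It is written as inner products so that the identity passes to L² limits. -/
lemma exists_identity_eq_inner (h : IsOrthogonalStrip L ε q) (i : Fin 2) {φ : ℝ × ℝ → ℝ}
    (hφ : ContDiff ℝ ∞ φ) (hc : HasCompactSupport φ) :
    ∃ (f : L2 L) (g : L2Vec L), ∀ x : L2 L × L2Vec L,
      ∫ p in Lam, (fderiv ℝ φ p (coordDir i) • x.1 p + φ p • tangentPairing L i p (x.2 p)) =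
        ⟪f, x.1⟫_ℂ + ⟪g, x.2⟫_ℂ := by
  obtain ⟨f, hf⟩ := h.exists_integral_eq_inner
    (w := fun p => ((fderiv ℝ φ p (coordDir i) : ℝ) : ℂ))
    (Complex.continuous_ofReal.comp (continuous_deriv hφ i))
    ((hasCompactSupport_deriv hc i).comp_left Complex.ofReal_zero)
  let X : ℝ × ℝ → EuclideanSpace ℂ (Fin d) := fun p =>
    WithLp.toLp 2 fun m => ((tangentVec L i p m : ℝ) : ℂ)
  have hX : Continuous X := by
    refine (PiLp.continuous_toLp 2 _).comp (continuous_pi fun m => ?_)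
    exact Complex.continuous_ofReal.comp
      ((EuclideanSpace.proj m : EuclideanSpace ℝ (Fin d) →L[ℝ] ℝ).continuous.comp
        (h.continuous_tangentVec i))
  obtain ⟨g, hg⟩ := h.exists_integral_eq_inner (w := fun p => ((φ p : ℝ) : ℂ) • X p)
    ((Complex.continuous_ofReal.comp hφ.continuous).smul hX)
    (HasCompactSupport.smul_right (f := fun p => ((φ p : ℝ) : ℂ))
      (hc.comp_left (g := fun r : ℝ => (r : ℂ)) Complex.ofReal_zero))
  refine ⟨f, g, fun x => ?_⟩
  rw [← hf, ← hg]
  rw [integral_add ((h.locallyIntegrable_restrict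
      (Lp.memLp x.1)).integrable_smul_left_of_hasCompactSupport (continuous_deriv hφ i)
      (hasCompactSupport_deriv hc i)) ((h.locallyIntegrable_tangentPairing i
      (Lp.memLp x.2)).integrable_smul_left_of_hasCompactSupport hφ.continuous hc)]
  congr 1
  · refine integral_congr_ae (Eventually.of_forall fun p => ?_)
    simp [mul_comm]
  · refine integral_congr_ae (Eventually.of_forall fun p => ?_)
    simp only [inner_smul_left, Complex.conj_ofReal, Complex.real_smul, tangentPairing]
    congr 1
    rw [PiLp.inner_apply]
    exact Finset.sum_congr rfl fun m _ => by simp [X, mul_comm]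

lemma isClosed_setOf_isTangent (p : ℝ × ℝ) : IsClosed {v | IsTangent L p v} := by
  let X : Fin 2 → EuclideanSpace ℂ (Fin d) := fun i =>
    WithLp.toLp 2 fun m => ((tangentVec L i p m : ℝ) : ℂ)
  have : {v | IsTangent L p v} = (Submodule.span ℂ (range X) : Set (EuclideanSpace ℂ (Fin d))) := by
    ext v
    rw [SetLike.mem_coe, Submodule.mem_span_range_iff_exists_fun]
    refine exists_congr fun c => ⟨fun hv => ?_, fun hv m => ?_⟩
    · ext m; rw [hv]; simp [X]
    · rw [← hv]; simp [X]
  rw [this]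
  exact Submodule.closed_of_finiteDimensional _

/-- The weak identities, including the one encoding the zero trace, are kernels of continuous
functionals. Tangency is pointwise and passes to the limit along an almost everywhere convergent
subsequence. -/
theorem isClosed_gradientGraph (h : IsOrthogonalStrip L ε q) :
    IsClosed (gradientGraph L : Set (L2 L × L2Vec L)) := by
  refine IsSeqClosed.isClosed fun x a hx ha => ?_
  have hx' : ∀ n, _ := fun n => (h.hasDirichletGradient_iff (Lp.memLp _) (Lp.memLp _)).1
    (h.mem_gradientGraph_iff.1 (hx n))
  have h1 : Tendsto (fun n => (x n).1) atTop (𝓝 a.1) := (continuous_fst.tendsto a).comp ha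
  have h2 : Tendsto (fun n => (x n).2) atTop (𝓝 a.2) := (continuous_snd.tendsto a).comp ha
  have key : ∀ (i : Fin 2) (φ : ℝ × ℝ → ℝ), ContDiff ℝ ∞ φ → HasCompactSupport φ →
      (∀ n, ∫ p in Lam, (fderiv ℝ φ p (coordDir i) • (x n).1 p +
        φ p • tangentPairing L i p ((x n).2 p)) = 0) →
      ∫ p in Lam, (fderiv ℝ φ p (coordDir i) • a.1 p +
        φ p • tangentPairing L i p (a.2 p)) = 0 := by
    intro i φ hφ hc h0
    obtain ⟨f, g, hfg⟩ := h.exists_identity_eq_inner i hφ hc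
    rw [hfg]
    simp only [hfg] at h0
    have hl : Tendsto (fun n => ⟪f, (x n).1⟫_ℂ + ⟪g, (x n).2⟫_ℂ) atTop
        (𝓝 (⟪f, a.1⟫_ℂ + ⟪g, a.2⟫_ℂ)) :=
      (((innerSL ℂ f).continuous.tendsto _).comp h1).add
        (((innerSL ℂ g).continuous.tendsto _).comp h2)
    simp only [h0] at hl
    exact (tendsto_nhds_unique hl tendsto_const_nhds)
  refine h.mem_gradientGraph_iff.2 ((h.hasDirichletGradient_iff (Lp.memLp _) (Lp.memLp _)).2
    ⟨?_, fun i φ hφ hc hs => key i φ hφ hc fun n => (hx' n).2.1 i φ hφ hc hs,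
      fun φ hφ hc hs => key 1 φ hφ hc fun n => (hx' n).2.2 φ hφ hc hs⟩)
  obtain ⟨ns, -, hns⟩ := (tendstoInMeasure_of_tendsto_Lp h2).exists_seq_tendsto_ae
  have hall : ∀ᵐ p ∂(volume.restrict Lam), ∀ n, IsTangent L p ((x n).2 p) :=
    ae_all_iff.2 fun n => (hx' n).1
  filter_upwards [hall, h.ae_area_iff.1 hns] with p hp1 hp2
  exact (isClosed_setOf_isTangent p).mem_of_tendsto hp2 (Eventually.of_forall fun n => hp1 _)

end IsOrthogonalStrip

/-! ### Smooth functions in the form domain -/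

lemma hasDerivAt_fst_line {F : Type*} [NormedAddCommGroup F] [NormedSpace ℝ F] {f : ℝ × ℝ → F}
    (hf : Differentiable ℝ f) (s t : ℝ) :
    HasDerivAt (fun s => f (s, t)) (fderiv ℝ f (s, t) (coordDir 0)) s := by
  have hl : HasDerivAt (fun s : ℝ => (s, t)) ((1 : ℝ), (0 : ℝ)) s :=
    (hasDerivAt_id s).prodMk (hasDerivAt_const s t)
  exact HasFDerivAt.comp_hasDerivAt s (hf (s, t)).hasFDerivAt hl

lemma hasDerivAt_snd_line {F : Type*} [NormedAddCommGroup F] [NormedSpace ℝ F] {f : ℝ × ℝ → F}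
    (hf : Differentiable ℝ f) (s t : ℝ) :
    HasDerivAt (fun t => f (s, t)) (fderiv ℝ f (s, t) (coordDir 1)) t := by
  have hl : HasDerivAt (fun t : ℝ => (s, t)) ((0 : ℝ), (1 : ℝ)) t :=
    (hasDerivAt_const t s).prodMk (hasDerivAt_id t)
  exact HasFDerivAt.comp_hasDerivAt t (hf (s, t)).hasFDerivAt hl

lemma Lam_eq_prod : Lam = univ ×ˢ Ioo (0 : ℝ) 1 := by
  ext p; simp [Lam]

lemma setIntegral_Lam {F : Type*} [NormedAddCommGroup F] [NormedSpace ℝ F] {f : ℝ × ℝ → F}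
    (hf : IntegrableOn f Lam) : ∫ p in Lam, f p = ∫ s, ∫ t in (0 : ℝ)..1, f (s, t) := by
  rw [Lam_eq_prod] at hf ⊢
  rw [Measure.volume_eq_prod] at hf ⊢
  rw [setIntegral_prod f hf, Measure.restrict_univ]
  refine integral_congr_ae (Eventually.of_forall fun s => ?_)
  simp only
  rw [intervalIntegral.integral_of_le zero_le_one, integral_Ioc_eq_integral_Ioo]

lemma integrableOn_Lam_of_continuous {F : Type*} [NormedAddCommGroup F] {f : ℝ × ℝ → F}
    (hf : Continuous f) {M : ℝ} (hM : ∀ p, M < |p.1| → f p = 0) : IntegrableOn f Lam := by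
  have hK : IsCompact (Icc (-M) M ×ˢ Icc (0 : ℝ) 1) := isCompact_Icc.prod isCompact_Icc
  refine (hf.continuousOn.integrableOn_compact hK).of_forall_sdiff_eq_zero measurableSet_Lam ?_
  rintro p ⟨hp, hpK⟩
  refine hM p ?_
  by_contra! h
  exact hpK ⟨abs_le.1 h, hp.1.le, hp.2.le⟩

/-- The complexification of a real vector. -/
def complexify {d : ℕ} (v : EuclideanSpace ℝ (Fin d)) : EuclideanSpace ℂ (Fin d) :=
  WithLp.toLp 2 fun m => ((v m : ℝ) : ℂ)

lemma continuous_complexify {d : ℕ} : Continuous (complexify (d := d)) := by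
  refine (PiLp.continuous_toLp 2 _).comp (continuous_pi fun m => ?_)
  exact Complex.continuous_ofReal.comp
    (EuclideanSpace.proj m : EuclideanSpace ℝ (Fin d) →L[ℝ] ℝ).continuous

lemma norm_complexify {d : ℕ} (v : EuclideanSpace ℝ (Fin d)) : ‖complexify v‖ = ‖v‖ := by
  rw [EuclideanSpace.norm_eq, EuclideanSpace.norm_eq]
  simp [complexify]

lemma tangentPairing_complexify {d : ℕ} (L : ℝ × ℝ → EuclideanSpace ℝ (Fin d)) (i : Fin 2)
    (p : ℝ × ℝ) (v : EuclideanSpace ℝ (Fin d)) :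
    tangentPairing L i p (complexify v) = ((⟪tangentVec L i p, v⟫_ℝ : ℝ) : ℂ) := by
  rw [PiLp.inner_apply, Complex.ofReal_sum]
  exact Finset.sum_congr rfl fun m _ => by simp [complexify, mul_comm]

/-- The gradient of a smooth real function on an orthogonal strip. -/
def smoothGradient {d : ℕ} (L : ℝ × ℝ → EuclideanSpace ℝ (Fin d)) (ε : ℝ) (q : ℝ → ℝ)
    (f : ℝ × ℝ → ℝ) (p : ℝ × ℝ) : EuclideanSpace ℝ (Fin d) :=
  (fderiv ℝ f p (coordDir 0) / stretch ε q p ^ 2) • tangentVec L 0 p +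
    (fderiv ℝ f p (coordDir 1) / ε ^ 2) • tangentVec L 1 p

lemma integral_deriv_mul_eq_zero {φ f : ℝ × ℝ → ℝ} (hφ : ContDiff ℝ ∞ φ) (hc : HasCompactSupport φ)
    (hs : tsupport φ ⊆ Lam) (hf : ContDiff ℝ ∞ f) (i : Fin 2) :
    ∫ p in Lam, (fderiv ℝ φ p (coordDir i) * f p + φ p * fderiv ℝ f p (coordDir i)) = 0 := by
  have h1 : Integrable fun p => fderiv ℝ φ p (coordDir i) * f p :=
    ((continuous_deriv hφ i).mul hf.continuous).integrable_of_hasCompactSupport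
      (hasCompactSupport_deriv hc i).mul_right
  have h2 : Integrable fun p => φ p * fderiv ℝ f p (coordDir i) :=
    (hφ.continuous.mul (continuous_deriv hf i)).integrable_of_hasCompactSupport hc.mul_right
  have h3 : Integrable fun p => φ p * f p :=
    (hφ.continuous.mul hf.continuous).integrable_of_hasCompactSupport hc.mul_right
  have e := integral_mul_fderiv_eq_neg_fderiv_mul_of_integrable h1 h2 h3
    (fun x _ => (hφ.differentiable (by simp)) x) (fun x _ => (hf.differentiable (by simp)) x)
  rw [setIntegral_eq_integral_of_forall_compl_eq_zero, integral_add h1 h2, e, add_neg_cancel]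
  intro p hp
  have a1 : p ∉ tsupport φ := fun h => hp (hs h)
  have a2 : p ∉ tsupport fun p => fderiv ℝ φ p (coordDir i) :=
    fun h => a1 (tsupport_deriv_subset φ i h)
  rw [image_eq_zero_of_notMem_tsupport a1, image_eq_zero_of_notMem_tsupport a2]
  simp

/-- The fundamental theorem of calculus on each vertical segment leaves two boundary terms: the one
at t = 1 vanishes by the support of φ, the one at t = 0 by the Dirichlet condition on f. -/
lemma integral_deriv_mul_eq_zero_of_bottom {φ f : ℝ × ℝ → ℝ} (hφ : ContDiff ℝ ∞ φ)
    (hc : HasCompactSupport φ) (hs : tsupport φ ⊆ {p | p.2 < 1}) (hf : ContDiff ℝ ∞ f)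
    (hf0 : ∀ s, f (s, 0) = 0) :
    ∫ p in Lam, (fderiv ℝ φ p (coordDir 1) * f p + φ p * fderiv ℝ f p (coordDir 1)) = 0 := by
  have hcont : Continuous fun p =>
      fderiv ℝ φ p (coordDir 1) * f p + φ p * fderiv ℝ f p (coordDir 1) :=
    ((continuous_deriv hφ 1).mul hf.continuous).add (hφ.continuous.mul (continuous_deriv hf 1))
  have hcs : HasCompactSupport fun p =>
      fderiv ℝ φ p (coordDir 1) * f p + φ p * fderiv ℝ f p (coordDir 1) :=
    (hasCompactSupport_deriv hc 1).mul_right.add hc.mul_right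
  rw [setIntegral_Lam (hcont.integrable_of_hasCompactSupport hcs).integrableOn]
  rw [integral_eq_zero_of_ae]
  refine Eventually.of_forall fun s => ?_
  simp only [Pi.zero_apply]
  have hd : ∀ t ∈ uIcc (0 : ℝ) 1, HasDerivAt (fun t => φ (s, t) * f (s, t))
      (fderiv ℝ φ (s, t) (coordDir 1) * f (s, t) + φ (s, t) * fderiv ℝ f (s, t) (coordDir 1)) t :=
    fun t _ => (hasDerivAt_snd_line (hφ.differentiable (by simp)) s t).mul
      (hasDerivAt_snd_line (hf.differentiable (by simp)) s t)
  have hi : IntervalIntegrable (fun t => fderiv ℝ φ (s, t) (coordDir 1) * f (s, t) +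
      φ (s, t) * fderiv ℝ f (s, t) (coordDir 1)) volume 0 1 :=
    Continuous.intervalIntegrable (hcont.comp (Continuous.prodMk_right s)) _ _
  rw [intervalIntegral.integral_eq_sub_of_hasDerivAt hd hi, hf0]
  have : φ (s, 1) = 0 := image_eq_zero_of_notMem_tsupport fun h => lt_irrefl (1 : ℝ) (hs h)
  simp [this]

namespace IsOrthogonalStrip

variable {d : ℕ} {L : ℝ × ℝ → EuclideanSpace ℝ (Fin d)} {ε : ℝ} {q : ℝ → ℝ}

lemma inner_smoothGradient (h : IsOrthogonalStrip L ε q) (f : ℝ × ℝ → ℝ) (i : Fin 2) (p : ℝ × ℝ) :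
    ⟪tangentVec L i p, smoothGradient L ε q f p⟫_ℝ = fderiv ℝ f p (coordDir i) := by
  have h1 := (h.stretch_pos p).ne'
  have h2 := h.pos.ne'
  have h3 : ⟪tangentVec L 1 p, tangentVec L 0 p⟫_ℝ = 0 := by
    rw [real_inner_comm]; exact h.inner_tangentVec p
  rw [smoothGradient, inner_add_right, inner_smul_right, inner_smul_right]
  fin_cases i
  · simp only [Fin.zero_eta]
    rw [h.inner_tangentVec, real_inner_self_eq_norm_sq, h.norm_tangentVec_zero]
    field_simp
    ring
  · simp only [Fin.mk_one]
    rw [h3, real_inner_self_eq_norm_sq, h.norm_tangentVec_one]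
    field_simp
    ring

lemma norm_sq_smoothGradient (h : IsOrthogonalStrip L ε q) (f : ℝ × ℝ → ℝ) (p : ℝ × ℝ) :
    ‖smoothGradient L ε q f p‖ ^ 2 = fderiv ℝ f p (coordDir 0) ^ 2 / stretch ε q p ^ 2 +
      fderiv ℝ f p (coordDir 1) ^ 2 / ε ^ 2 := by
  have h1 := (h.stretch_pos p).ne'
  have h2 := h.pos.ne'
  rw [smoothGradient, norm_add_sq_real, inner_smul_left, inner_smul_right, h.inner_tangentVec,
    norm_smul, norm_smul, mul_pow, mul_pow, h.norm_tangentVec_one, h.norm_tangentVec_zero,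
    Real.norm_eq_abs, Real.norm_eq_abs, sq_abs, sq_abs]
  field_simp
  ring

lemma continuous_smoothGradient (h : IsOrthogonalStrip L ε q) {f : ℝ × ℝ → ℝ}
    (hf : ContDiff ℝ ∞ f) : Continuous (smoothGradient L ε q f) :=
  (((continuous_deriv hf 0).div (h.continuous_stretch.pow 2)
    fun p => (pow_pos (h.stretch_pos p) 2).ne').smul (h.continuous_tangentVec 0)).add
    (((continuous_deriv hf 1).div_const _).smul (h.continuous_tangentVec 1))

lemma hasCompactSupport_smoothGradient {f : ℝ × ℝ → ℝ} (hc : HasCompactSupport f) :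
    HasCompactSupport (smoothGradient L ε q f) := by
  have h0 := (hasCompactSupport_deriv hc 0).mul_right (f' := fun p => (stretch ε q p ^ 2)⁻¹)
  have h1 := (hasCompactSupport_deriv hc 1).mul_right (f' := fun _ => (ε ^ 2)⁻¹)
  exact (h0.smul_right (f' := tangentVec L 0)).add (h1.smul_right (f' := tangentVec L 1))

lemma memLp_ofReal (h : IsOrthogonalStrip L ε q) {f : ℝ × ℝ → ℝ} (hf : ContDiff ℝ ∞ f)
    (hc : HasCompactSupport f) : MemLp (fun p => ((f p : ℝ) : ℂ)) 2 (area L) := by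
  have := h.isFiniteMeasureOnCompacts_area
  exact (Complex.continuous_ofReal.comp hf.continuous).memLp_of_hasCompactSupport
    (hc.comp_left Complex.ofReal_zero)

lemma memLp_complexify_smoothGradient (h : IsOrthogonalStrip L ε q) {f : ℝ × ℝ → ℝ}
    (hf : ContDiff ℝ ∞ f) (hc : HasCompactSupport f) :
    MemLp (fun p => complexify (smoothGradient L ε q f p)) 2 (area L) := by
  have := h.isFiniteMeasureOnCompacts_area
  exact (continuous_complexify.comp (h.continuous_smoothGradient hf)).memLp_of_hasCompactSupport
    ((hasCompactSupport_smoothGradient hc).comp_left (by ext m; simp [complexify]))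

lemma hasDirichletGradient_ofReal (h : IsOrthogonalStrip L ε q) {f : ℝ × ℝ → ℝ}
    (hf : ContDiff ℝ ∞ f) (hc : HasCompactSupport f) (hf0 : ∀ s, f (s, 0) = 0) :
    HasDirichletGradient L (fun p => ((f p : ℝ) : ℂ))
      (fun p => complexify (smoothGradient L ε q f p)) := by
  rw [h.hasDirichletGradient_iff (h.memLp_ofReal hf hc) (h.memLp_complexify_smoothGradient hf hc)]
  have e : ∀ (i : Fin 2) (φ : ℝ × ℝ → ℝ), ∫ p in Lam, (fderiv ℝ φ p (coordDir i) • ((f p : ℝ) : ℂ) +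
      φ p • tangentPairing L i p (complexify (smoothGradient L ε q f p))) =
      ((∫ p in Lam, (fderiv ℝ φ p (coordDir i) * f p + φ p * fderiv ℝ f p (coordDir i)) : ℝ) : ℂ) := by
    intro i φ
    rw [← integral_complex_ofReal]
    refine integral_congr_ae (Eventually.of_forall fun p => ?_)
    simp only [tangentPairing_complexify, h.inner_smoothGradient, Complex.real_smul]
    push_cast
    rfl
  refine ⟨Eventually.of_forall fun p => ?_, fun i φ hφ hφc hs => ?_, fun φ hφ hφc hs => ?_⟩
  · refine ⟨![((fderiv ℝ f p (coordDir 0) / stretch ε q p ^ 2 : ℝ) : ℂ),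
      ((fderiv ℝ f p (coordDir 1) / ε ^ 2 : ℝ) : ℂ)], fun m => ?_⟩
    simp [complexify, smoothGradient, Fin.sum_univ_two]
  · rw [e, integral_deriv_mul_eq_zero hφ hφc hs hf, Complex.ofReal_zero]
  · rw [e, integral_deriv_mul_eq_zero_of_bottom hφ hφc hs hf hf0, Complex.ofReal_zero]

/-- The form domain is dense. -/
theorem eq_zero_of_inner_domain_eq_zero (h : IsOrthogonalStrip L ε q) (x : L2 L)
    (hx : ∀ v W, (v, W) ∈ gradientGraph L → ⟪v, x⟫_ℂ = 0) : x = 0 := by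
  have hloc : LocallyIntegrable (fun p => (ε * stretch ε q p) • x p) (volume.restrict Lam) :=
    (h.locallyIntegrable_restrict (Lp.memLp x)).continuous_smul h.continuous_density
  have key := isOpen_Lam.ae_eq_zero_of_integral_contDiff_smul_eq_zero
    (locallyIntegrableOn_Lam hloc) (fun φ hφ hc hs => ?_)
  · rw [Lp.eq_zero_iff_ae_eq_zero]
    refine h.ae_area_iff.2 ((ae_restrict_iff' measurableSet_Lam).2 ?_)
    filter_upwards [key] with p hp hpL
    have := hp hpL
    rwa [smul_eq_zero_iff_right (h.density_pos p).ne'] at this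
  · have hf0 : ∀ s, φ (s, 0) = 0 := fun s =>
      image_eq_zero_of_notMem_tsupport fun hm => lt_irrefl (0 : ℝ) (hs hm).1
    have h1 := hx _ _ (mk_mem_gradientGraph (h.memLp_ofReal hφ hc)
      (h.memLp_complexify_smoothGradient hφ hc) (h.hasDirichletGradient_ofReal hφ hc hf0))
    rw [L2.inner_def, h.integral_area] at h1
    rw [← setIntegral_eq_integral_of_forall_compl_eq_zero (s := Lam)]
    · rw [← h1]
      refine integral_congr_ae ?_
      filter_upwards [h.ae_area_iff.1 (h.memLp_ofReal hφ hc).coeFn_toLp] with p hp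
      rw [hp]
      simp only [RCLike.inner_apply, Complex.conj_ofReal, Complex.real_smul]
      ring
    · intro p hp
      rw [image_eq_zero_of_notMem_tsupport fun hm => hp (hs hm), zero_smul]

end IsOrthogonalStrip

/-! ### A trial function with energy below the threshold -/

lemma norm_sq_eq_integral {α F : Type*} [MeasurableSpace α] {μ : Measure α} [NormedAddCommGroup F]
    [InnerProductSpace ℂ F] {f : α → F} (hf : MemLp f 2 μ) :
    ‖hf.toLp f‖ ^ 2 = ∫ x, ‖f x‖ ^ 2 ∂μ := by
  have h1 : ⟪hf.toLp f, hf.toLp f⟫_ℂ = ((∫ x, ‖f x‖ ^ 2 ∂μ : ℝ) : ℂ) := by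
    rw [L2.inner_def, ← integral_complex_ofReal]
    refine integral_congr_ae ?_
    filter_upwards [hf.coeFn_toLp] with x hx
    rw [hx, inner_self_eq_norm_sq_to_K]
    push_cast
    rfl
  rw [inner_self_eq_norm_sq_to_K] at h1
  apply Complex.ofReal_injective
  rw [← h1]
  push_cast
  rfl

/-- The weighted average `∫₀¹ h(s,t) cos(πt) dt` governing the energy of the trial function. -/
def twistEnergy (ε : ℝ) (q : ℝ → ℝ) (s : ℝ) : ℝ :=
  ∫ t in (0 : ℝ)..1, stretch ε q (s, t) * Real.cos (Real.pi * t)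

lemma integral_cos_pi : ∫ t in (0 : ℝ)..1, Real.cos (Real.pi * t) = 0 := by
  rw [intervalIntegral.integral_comp_mul_left _ Real.pi_ne_zero]
  simp

/-- A smooth function with compact support equal to `sin (π t / 2)` on `[0, 1]`. -/
lemma exists_vertical_profile : ∃ ψ : ℝ → ℝ, ContDiff ℝ ∞ ψ ∧ (∀ t, 3 < |t| → ψ t = 0) ∧
    ψ 0 = 0 ∧ (∀ t ∈ Ioo (0 : ℝ) 1, ψ t = Real.sin (Real.pi / 2 * t)) ∧
    ∀ t ∈ Ioo (0 : ℝ) 1, deriv ψ t = Real.pi / 2 * Real.cos (Real.pi / 2 * t) := by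
  let β : ContDiffBump (0 : ℝ) := ⟨2, 3, by norm_num, by norm_num⟩
  have heq : ∀ t ∈ Ioo (0 : ℝ) 1,
      (fun t => Real.sin (Real.pi / 2 * t) * β t) =ᶠ[𝓝 t] fun t => Real.sin (Real.pi / 2 * t) := by
    intro t ht
    filter_upwards [isOpen_Ioo.mem_nhds ht] with r hr
    rw [β.one_of_mem_closedBall, mul_one]
    rw [mem_closedBall_zero_iff, Real.norm_eq_abs, abs_of_pos hr.1]
    exact hr.2.le.trans (by norm_num [β])
  refine ⟨fun t => Real.sin (Real.pi / 2 * t) * β t, ?_, fun t ht => ?_, by simp,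
    fun t ht => (heq t ht).eq_of_nhds, fun t ht => ?_⟩
  · exact (Real.contDiff_sin.comp (contDiff_const.mul contDiff_id)).mul β.contDiff
  · have : β t = 0 := β.zero_of_le_dist (by rw [Real.dist_eq, sub_zero]; exact ht.le)
    simp [this]
  · rw [(heq t ht).deriv_eq]
    have h1 : HasDerivAt (fun t => Real.pi / 2 * t) (Real.pi / 2) t := by
      simpa using (hasDerivAt_id t).const_mul (Real.pi / 2)
    rw [h1.sin.deriv, mul_comm]

/-- Smooth plateau functions with small Dirichlet energy. -/
lemma exists_plateau : ∃ C : ℝ, ∀ R : ℝ, 0 < R → ∃ φ : ℝ → ℝ, ContDiff ℝ ∞ φ ∧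
    (∀ s, |s| ≤ R → φ s = 1) ∧ (∀ s, 2 * R < |s| → φ s = 0) ∧ (∀ s, 0 ≤ φ s ∧ φ s ≤ 1) ∧
    ∫ s, deriv φ s ^ 2 ≤ C / R := by
  let χ : ContDiffBump (0 : ℝ) := ⟨1, 2, by norm_num, by norm_num⟩
  refine ⟨∫ s, deriv χ s ^ 2, fun R hR => ⟨fun s => χ (s / R), ?_, fun s hs => ?_, fun s hs => ?_,
    fun s => ⟨χ.nonneg, χ.le_one⟩, ?_⟩⟩
  · exact χ.contDiff.comp (contDiff_id.div_const R)
  · refine χ.one_of_mem_closedBall ?_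
    rw [mem_closedBall_zero_iff, Real.norm_eq_abs, abs_div, abs_of_pos hR, div_le_iff₀ hR]
    change |s| ≤ 1 * R
    linarith
  · refine χ.zero_of_le_dist ?_
    rw [Real.dist_eq, sub_zero, abs_div, abs_of_pos hR, le_div_iff₀ hR]
    exact hs.le
  · have hd : ∀ s, deriv (fun s => χ (s / R)) s = deriv χ (s / R) / R := fun s => by
      have h1 : HasDerivAt χ (deriv χ (s / R)) (s / R) :=
        ((χ.contDiff (n := 1)).differentiable (by simp) _).hasDerivAt
      have h2 := h1.comp s ((hasDerivAt_id s).div_const R)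
      rw [mul_one_div] at h2
      exact h2.deriv
    simp only [hd, div_pow]
    rw [integral_div, Measure.integral_comp_div (fun s => deriv χ s ^ 2), abs_of_pos hR,
      smul_eq_mul]
    apply le_of_eq
    field_simp

namespace IsOrthogonalStrip

variable {d : ℕ} {L : ℝ × ℝ → EuclideanSpace ℝ (Fin d)} {ε : ℝ} {q : ℝ → ℝ}

lemma continuous_twistEnergy (h : IsOrthogonalStrip L ε q) : Continuous (twistEnergy ε q) := by
  refine intervalIntegral.continuous_parametric_intervalIntegral_of_continuous' ?_ 0 1
  have := h.continuous_stretch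
  fun_prop

lemma stretch_le_stretch (h : IsOrthogonalStrip L ε q) {s t t' : ℝ} (ht : 0 ≤ t) (htt' : t ≤ t') :
    stretch ε q (s, t) ≤ stretch ε q (s, t') := by
  refine Real.sqrt_le_sqrt ?_
  have h1 : (ε * t) ^ 2 ≤ (ε * t') ^ 2 :=
    pow_le_pow_left₀ (mul_nonneg h.pos.le ht) (mul_le_mul_of_nonneg_left htt' h.pos.le) 2
  have := mul_le_mul_of_nonneg_right h1 (h.twist_nonneg s)
  simpa using this

/-- Since cos(πt) has mean zero on (0, 1), the value of h at t = 1/2 may be subtracted. The two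
factors then change sign at the same point in opposite directions, so the integrand is nowhere
positive. -/
lemma twistEnergy_eq (h : IsOrthogonalStrip L ε q) (s : ℝ) :
    twistEnergy ε q s = ∫ t in (0 : ℝ)..1,
      (stretch ε q (s, t) - stretch ε q (s, 1 / 2)) * Real.cos (Real.pi * t) := by
  have hc := h.continuous_stretch
  simp only [sub_mul]
  rw [intervalIntegral.integral_sub (Continuous.intervalIntegrable (by fun_prop) _ _)
    (Continuous.intervalIntegrable (by fun_prop) _ _), intervalIntegral.integral_const_mul,
    integral_cos_pi, mul_zero, sub_zero, twistEnergy]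

lemma twist_integrand_nonpos (h : IsOrthogonalStrip L ε q) {s t : ℝ} (ht : t ∈ Icc (0 : ℝ) 1) :
    (stretch ε q (s, t) - stretch ε q (s, 1 / 2)) * Real.cos (Real.pi * t) ≤ 0 := by
  have hpi := Real.pi_pos
  rcases le_total t (1 / 2) with h1 | h1
  · refine mul_nonpos_of_nonpos_of_nonneg (sub_nonpos.2 (h.stretch_le_stretch ht.1 h1)) ?_
    exact Real.cos_nonneg_of_neg_pi_div_two_le_of_le (by nlinarith [ht.1]) (by nlinarith)
  · refine mul_nonpos_of_nonneg_of_nonpos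
      (sub_nonneg.2 (h.stretch_le_stretch (by norm_num) h1)) ?_
    exact Real.cos_nonpos_of_pi_div_two_le_of_le (by nlinarith) (by nlinarith [ht.2])

lemma twistEnergy_nonpos (h : IsOrthogonalStrip L ε q) (s : ℝ) : twistEnergy ε q s ≤ 0 := by
  rw [h.twistEnergy_eq, ← neg_nonneg, ← intervalIntegral.integral_neg]
  exact intervalIntegral.integral_nonneg zero_le_one fun t ht =>
    neg_nonneg.2 (h.twist_integrand_nonpos ht)

lemma twistEnergy_neg (h : IsOrthogonalStrip L ε q) {s : ℝ} (hs : 0 < q s) :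
    twistEnergy ε q s < 0 := by
  have hc := h.continuous_stretch
  rw [h.twistEnergy_eq]
  have hcont : Continuous fun t : ℝ =>
      (stretch ε q (s, t) - stretch ε q (s, 1 / 2)) * Real.cos (Real.pi * t) := by fun_prop
  refine lt_of_lt_of_eq (b := ∫ _t in (0 : ℝ)..1, (0 : ℝ)) ?_ (by simp)
  -- The strict inequality is witnessed at t = 1, where the cosine is −1 and h exceeds its value at
  -- t = 1/2.
  refine intervalIntegral.integral_lt_integral_of_continuousOn_of_le_of_exists_lt zero_lt_one
    hcont.continuousOn continuousOn_const
    (fun t ht => h.twist_integrand_nonpos ⟨ht.1.le, ht.2⟩) ⟨1, ⟨zero_le_one, le_rfl⟩, ?_⟩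
  rw [mul_one, Real.cos_pi, mul_neg_one, neg_lt_zero, sub_pos]
  refine Real.sqrt_lt_sqrt ?_ ?_
  · have := mul_nonneg (sq_nonneg (ε * (1 / 2))) hs.le
    simp only; linarith
  · have := mul_pos (pow_pos h.pos 2) hs
    simp only
    nlinarith

/-- The energy of the trial function `φ(s) sin(πt/2)`. -/
lemma exists_trial_energy_le (h : IsOrthogonalStrip L ε q) {φ : ℝ → ℝ} (hφ : ContDiff ℝ ∞ φ)
    {M : ℝ} (hM : ∀ s, M < |s| → φ s = 0) :
    ∃ u V, (u, V) ∈ gradientGraph L ∧ ‖V‖ ^ 2 - (Real.pi / (2 * ε)) ^ 2 * ‖u‖ ^ 2 ≤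
      ε * (∫ s, deriv φ s ^ 2) +
        Real.pi ^ 2 / (4 * ε) * ∫ s, φ s ^ 2 * twistEnergy ε q s := by
  obtain ⟨ψ, hψ, hψ3, hψ0, hψs, hψc⟩ := exists_vertical_profile
  set f : ℝ × ℝ → ℝ := fun p => φ p.1 * ψ p.2 with hf
  have hfc : ContDiff ℝ ∞ f := (hφ.comp contDiff_fst).mul (hψ.comp contDiff_snd)
  have hcs : HasCompactSupport f := by
    refine HasCompactSupport.intro (isCompact_Icc.prod isCompact_Icc :
      IsCompact (Icc (-M) M ×ˢ Icc (-3 : ℝ) 3)) fun p hp => ?_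
    by_cases h1 : M < |p.1|
    · simp [hf, hM _ h1]
    · have h2 : 3 < |p.2| := by
        by_contra! h2
        exact hp ⟨abs_le.1 (not_lt.1 h1), abs_le.1 h2⟩
      simp [hf, hψ3 _ h2]
  have hu := h.memLp_ofReal hfc hcs
  have hV := h.memLp_complexify_smoothGradient hfc hcs
  refine ⟨hu.toLp _, hV.toLp _, mk_mem_gradientGraph hu hV
    (h.hasDirichletGradient_ofReal hfc hcs fun s => by simp [hf, hψ0]), ?_⟩
  have hφd : ∀ s, HasDerivAt φ (deriv φ s) s := fun s =>
    ((hφ.differentiable (by simp)) s).hasDerivAt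
  have hψd : ∀ s, HasDerivAt ψ (deriv ψ s) s := fun s =>
    ((hψ.differentiable (by simp)) s).hasDerivAt
  have hd0 : ∀ p : ℝ × ℝ, fderiv ℝ f p (coordDir 0) = deriv φ p.1 * ψ p.2 := fun p =>
    (hasDerivAt_fst_line (hfc.differentiable (by simp)) p.1 p.2).unique
      ((hφd p.1).mul_const (ψ p.2))
  have hd1 : ∀ p : ℝ × ℝ, fderiv ℝ f p (coordDir 1) = φ p.1 * deriv ψ p.2 := fun p =>
    (hasDerivAt_snd_line (hfc.differentiable (by simp)) p.1 p.2).unique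
      ((hψd p.2).const_mul (φ p.1))
  have hdφ : Continuous (deriv φ) := hφ.continuous_deriv (by simp)
  have hdφ0 : ∀ s, M < |s| → deriv φ s = 0 := fun s hs => by
    have : φ =ᶠ[𝓝 s] fun _ => 0 := by
      filter_upwards [(isOpen_lt continuous_const continuous_abs).mem_nhds hs] with r hr
      exact hM r hr
    rw [this.deriv_eq, deriv_const]
  rw [norm_sq_eq_integral, norm_sq_eq_integral, h.integral_area, h.integral_area]
  simp only [norm_complexify, h.norm_sq_smoothGradient, Complex.norm_real, Real.norm_eq_abs,
    sq_abs, smul_eq_mul]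
  have hst := h.continuous_stretch
  have hst0 : ∀ p, stretch ε q p ^ 2 ≠ 0 := fun p => (pow_pos (h.stretch_pos p) 2).ne'
  have hφcont := hφ.continuous
  have hf0 : ∀ p : ℝ × ℝ, M < |p.1| → f p = 0 := fun p hp => by simp [hf, hM _ hp]
  have i1 : IntegrableOn (fun p => ε * stretch ε q p *
      (fderiv ℝ f p (coordDir 0) ^ 2 / stretch ε q p ^ 2 +
        fderiv ℝ f p (coordDir 1) ^ 2 / ε ^ 2)) Lam := by
    refine integrableOn_Lam_of_continuous (M := M) ?_ fun p hp => ?_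
    · exact (hst.const_mul ε).mul ((((continuous_deriv hfc 0).pow 2).div (hst.pow 2) hst0).add
        (((continuous_deriv hfc 1).pow 2).div_const _))
    · rw [hd0, hd1, hM _ hp, hdφ0 _ hp]; simp
  have i2 : IntegrableOn (fun p => ε * stretch ε q p * f p ^ 2) Lam := by
    refine integrableOn_Lam_of_continuous (M := M) ?_ fun p hp => ?_
    · exact (hst.const_mul ε).mul (hfc.continuous.pow 2)
    · rw [hf0 p hp]; simp
  have i3 : IntegrableOn (fun p : ℝ × ℝ => ε * deriv φ p.1 ^ 2 + Real.pi ^ 2 / (4 * ε) *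
      (φ p.1 ^ 2 * (stretch ε q p * Real.cos (Real.pi * p.2)))) Lam := by
    refine integrableOn_Lam_of_continuous (M := M) (by fun_prop) fun p hp => ?_
    rw [hM _ hp, hdφ0 _ hp]; simp
  rw [← integral_const_mul, ← integral_sub i1 (i2.const_mul _)]
  refine (setIntegral_mono_on (i1.sub (i2.const_mul _)) i3 measurableSet_Lam
    fun p hp => ?_).trans (le_of_eq ?_)
  · simp only [Pi.sub_apply]
    rw [hd0, hd1, hf]
    simp only
    rw [hψs _ hp, hψc _ hp]
    have e1 : Real.cos (Real.pi * p.2) =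
        Real.cos (Real.pi / 2 * p.2) ^ 2 - Real.sin (Real.pi / 2 * p.2) ^ 2 := by
      rw [← Real.cos_two_mul']; congr 1; ring
    set c := Real.cos (Real.pi / 2 * p.2)
    set σ := Real.sin (Real.pi / 2 * p.2) with hσ
    have hε := h.pos
    have hH := h.one_le_stretch p
    set H := stretch ε q p
    rw [e1]
    -- The threshold term merges with the vertical derivative into h(cos² − sin²), whose integral in
    -- t is `twistEnergy`.
    have e2 : ε * H * ((deriv φ p.1 * σ) ^ 2 / H ^ 2 + (φ p.1 * (Real.pi / 2 * c)) ^ 2 / ε ^ 2) -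
        (Real.pi / (2 * ε)) ^ 2 * (ε * H * (φ p.1 * σ) ^ 2) =
        ε * deriv φ p.1 ^ 2 * (σ ^ 2 / H) +
          Real.pi ^ 2 / (4 * ε) * (φ p.1 ^ 2 * (H * (c ^ 2 - σ ^ 2))) := by
      have : H ≠ 0 := by linarith
      field_simp
      ring
    rw [e2]
    -- In the longitudinal term the density h and the inverse metric 1/h² leave a factor 1/h ≤ 1.
    -- Its cost is thus bounded independently of the twist.
    have e3 : σ ^ 2 / H ≤ 1 := by
      rw [div_le_one (by linarith)]
      have := Real.sin_sq_le_one (Real.pi / 2 * p.2)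
      rw [← hσ] at this
      linarith
    have e4 : 0 ≤ ε * deriv φ p.1 ^ 2 := by positivity
    nlinarith
  · rw [setIntegral_Lam i3]
    have e : ∀ s, ∫ t in (0 : ℝ)..1, (ε * deriv φ s ^ 2 + Real.pi ^ 2 / (4 * ε) *
        (φ s ^ 2 * (stretch ε q (s, t) * Real.cos (Real.pi * t)))) =
        ε * deriv φ s ^ 2 + Real.pi ^ 2 / (4 * ε) * (φ s ^ 2 * twistEnergy ε q s) := fun s => by
      rw [intervalIntegral.integral_add (Continuous.intervalIntegrable (by fun_prop) _ _)
        (Continuous.intervalIntegrable (by fun_prop) _ _), intervalIntegral.integral_const,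
        intervalIntegral.integral_const_mul, intervalIntegral.integral_const_mul, twistEnergy]
      simp
    simp only [e]
    have hK : ∀ g : ℝ → ℝ, Continuous g → (∀ s, M < |s| → g s = 0) → Integrable g :=
      fun g hg hg0 => hg.integrable_of_hasCompactSupport (HasCompactSupport.intro
        (isCompact_Icc (a := -M) (b := M)) fun s hs => hg0 s (by
          by_contra! h1; exact hs (abs_le.1 h1)))
    have hJ := h.continuous_twistEnergy
    rw [integral_add, integral_const_mul, integral_const_mul]
    · exact hK _ (by fun_prop) fun s hs => by simp [hdφ0 s hs]
    · exact hK _ (by fun_prop) fun s hs => by simp [hM s hs]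

/-- The energy of a twisted strip goes below the threshold `(π / (2ε))²`. -/
theorem exists_trial (h : IsOrthogonalStrip L ε q) (hq : ∃ s, 0 < q s) :
    ∃ u V, (u, V) ∈ gradientGraph L ∧ ‖V‖ ^ 2 < (Real.pi / (2 * ε)) ^ 2 * ‖u‖ ^ 2 := by
  obtain ⟨s₀, hs₀⟩ := hq
  obtain ⟨C, hC⟩ := exists_plateau
  have hJ := h.continuous_twistEnergy
  have hK : ∀ (M : ℝ) (g : ℝ → ℝ), Continuous g → (∀ s, M < |s| → g s = 0) →
      HasCompactSupport g := fun M g hg hg0 => HasCompactSupport.intro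
        (isCompact_Icc (a := -M) (b := M)) fun s hs => hg0 s (by
          by_contra! h1; exact hs (abs_le.1 h1))
  -- A first plateau, equal to 1 at the twisted point s₀, fixes a gain c > 0 before the long plateau
  -- is chosen.
  set R₀ := |s₀| + 1 with hR₀
  have hR₀pos : 0 < R₀ := by positivity
  obtain ⟨φ₀, hφ₀, hφ₀1, hφ₀0, hφ₀01, -⟩ := hC R₀ hR₀pos
  have hc0 : Continuous fun s => -(φ₀ s ^ 2 * twistEnergy ε q s) :=
    ((hφ₀.continuous.pow 2).mul hJ).neg
  have hcs0 := hK (2 * R₀) _ hc0 fun s hs => by simp [hφ₀0 s hs]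
  have hpos : 0 < ∫ s, -(φ₀ s ^ 2 * twistEnergy ε q s) := by
    refine hc0.integral_pos_of_hasCompactSupport_nonneg_nonzero (x := s₀) hcs0 (fun s => ?_) ?_
    · exact neg_nonneg.2 (mul_nonpos_of_nonneg_of_nonpos (sq_nonneg _) (h.twistEnergy_nonpos s))
    · rw [hφ₀1 s₀ (by rw [hR₀]; linarith)]
      simpa using (h.twistEnergy_neg hs₀).ne
  set c := ∫ s, -(φ₀ s ^ 2 * twistEnergy ε q s) with hc
  have hε := h.pos
  have hκ : 0 < Real.pi ^ 2 / (4 * ε) * c := by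
    have := Real.pi_pos; positivity
  -- With R ≥ 2R₀ the long plateau equals 1 on the support of φ₀ and keeps at least the gain c. The
  -- other requirement makes its longitudinal cost smaller than that gain.
  obtain ⟨R, hR1, hR2⟩ : ∃ R, 2 * R₀ ≤ R ∧ ε * (C / R) < Real.pi ^ 2 / (4 * ε) * c := by
    have hl : Tendsto (fun R : ℝ => ε * (C / R)) atTop (𝓝 (ε * 0)) :=
      (tendsto_const_nhds.div_atTop tendsto_id).const_mul ε
    rw [mul_zero] at hl
    obtain ⟨R, h1, h2⟩ := ((eventually_ge_atTop (2 * R₀)).and (hl.eventually_lt_const hκ)).exists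
    exact ⟨R, h1, h2⟩
  obtain ⟨φ, hφ, hφ1, hφ0, hφ01, hφE⟩ := hC R (by linarith)
  obtain ⟨u, V, huV, hle⟩ := h.exists_trial_energy_le hφ hφ0
  refine ⟨u, V, huV, ?_⟩
  have hc1 : Continuous fun s => -(φ s ^ 2 * twistEnergy ε q s) :=
    ((hφ.continuous.pow 2).mul hJ).neg
  have hmono : c ≤ ∫ s, -(φ s ^ 2 * twistEnergy ε q s) := by
    refine integral_mono (hc0.integrable_of_hasCompactSupport hcs0)
      (hc1.integrable_of_hasCompactSupport (hK (2 * R) _ hc1 fun s hs => by simp [hφ0 s hs]))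
      fun s => ?_
    have hJs := h.twistEnergy_nonpos s
    have hsq : φ₀ s ^ 2 ≤ φ s ^ 2 := by
      by_cases hs : 2 * R₀ < |s|
      · rw [hφ₀0 s hs]; nlinarith [sq_nonneg (φ s)]
      · rw [hφ1 s (by linarith)]
        have := hφ₀01 s
        nlinarith
    simp only
    nlinarith
  rw [integral_neg] at hmono
  have h1 : Real.pi ^ 2 / (4 * ε) * ∫ s, φ s ^ 2 * twistEnergy ε q s ≤
      Real.pi ^ 2 / (4 * ε) * (-c) :=
    mul_le_mul_of_nonneg_left (by linarith) (by positivity)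
  have h2 := mul_le_mul_of_nonneg_left hφE hε.le
  linarith

end IsOrthogonalStrip

/-! ### Weakly differentiable functions along segments -/

/-- The uniform measure on the parameter interval of a segment. -/
abbrev unitMeasure : Measure ℝ := volume.restrict (Ioc 0 1)

instance isProbabilityMeasure_unitMeasure : IsProbabilityMeasure unitMeasure :=
  ⟨by simp [unitMeasure]⟩

lemma measurePreserving_shear (e : ℝ × ℝ) :
    MeasurePreserving (fun z : ℝ × (ℝ × ℝ) => (z.1, z.2 + z.1 • e)) (unitMeasure.prod volume)
      (unitMeasure.prod volume) := by
  refine MeasurePreserving.skew_product (g := fun σ p => p + σ • e)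
    (MeasurePreserving.id unitMeasure) (by fun_prop) (Eventually.of_forall fun σ => ?_)
  exact map_add_right_eq_self volume (σ • e)

/-- The average of a test function along segments. -/
def segmentAverage (e : ℝ × ℝ) (Ψ : ℝ × ℝ → ℝ) (p : ℝ × ℝ) : ℝ :=
  ∫ σ, Ψ (p - σ • e) ∂unitMeasure

/-- The union of the segments in direction `e` issuing from a set. -/
def segmentSweep (e : ℝ × ℝ) (S : Set (ℝ × ℝ)) : Set (ℝ × ℝ) :=
  (fun z : (ℝ × ℝ) × ℝ => z.1 + z.2 • e) '' (S ×ˢ Icc 0 1)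

lemma isCompact_segmentSweep (e : ℝ × ℝ) {S : Set (ℝ × ℝ)} (hS : IsCompact S) :
    IsCompact (segmentSweep e S) :=
  (hS.prod isCompact_Icc).image (by fun_prop)

lemma mem_segmentSweep {e p : ℝ × ℝ} {S : Set (ℝ × ℝ)} {σ : ℝ} (hσ : σ ∈ Ioc (0 : ℝ) 1)
    (hp : p - σ • e ∈ S) : p ∈ segmentSweep e S :=
  ⟨(p - σ • e, σ), ⟨hp, hσ.1.le, hσ.2⟩, by simp⟩

section Segment

variable {e : ℝ × ℝ} {Ψ : ℝ × ℝ → ℝ}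

lemma integrable_test_sub {g : ℝ × ℝ → ℂ} (hΨ : Continuous Ψ) (hc : HasCompactSupport Ψ)
    (hg : LocallyIntegrable g) : Integrable (fun z : ℝ × (ℝ × ℝ) => Ψ (z.2 - z.1 • e) • g z.2)
      (unitMeasure.prod volume) := by
  have hK := isCompact_segmentSweep e hc.isCompact
  have h1 : Integrable ((segmentSweep e (tsupport Ψ)).indicator g) :=
    (integrable_indicator_iff hK.measurableSet).2 (hg.integrableOn_isCompact hK)
  have h2 : Integrable (fun z : ℝ × (ℝ × ℝ) => (segmentSweep e (tsupport Ψ)).indicator g z.2)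
    (unitMeasure.prod volume) := h1.comp_snd unitMeasure
  obtain ⟨C, hC⟩ := hc.exists_bound_of_continuous hΨ
  have h3 := h2.bdd_smul (φ := fun z => Ψ (z.2 - z.1 • e)) C
    (by fun_prop) (Eventually.of_forall fun z => hC _)
  refine h3.congr ?_
  have hmem : ∀ᵐ z ∂(unitMeasure.prod (volume : Measure (ℝ × ℝ))), z.1 ∈ Ioc (0 : ℝ) 1 :=
    Measure.quasiMeasurePreserving_fst.ae (ae_restrict_mem measurableSet_Ioc)
  filter_upwards [hmem] with z hz
  simp only [Pi.smul_apply']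
  by_cases h : z.2 - z.1 • e ∈ tsupport Ψ
  · rw [indicator_of_mem (mem_segmentSweep hz h)]
  · rw [image_eq_zero_of_notMem_tsupport h, zero_smul, zero_smul]

lemma integrable_test_add {g : ℝ × ℝ → ℂ} (hΨ : Continuous Ψ) (hc : HasCompactSupport Ψ)
    (hg : LocallyIntegrable g) : Integrable (fun z : ℝ × (ℝ × ℝ) => Ψ z.2 • g (z.2 + z.1 • e))
      (unitMeasure.prod volume) := by
  have := (measurePreserving_shear e).integrable_comp_of_integrable
    (integrable_test_sub (e := e) hΨ hc hg)
  simpa [Function.comp_def] using this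

/-- Averaging the test function backwards along e is adjoint to integrating g forwards along e, by
Fubini and the measure preserving shear (σ, p) ↦ (σ, p + σe). -/
lemma integral_segmentAverage_smul {g : ℝ × ℝ → ℂ} (hΨ : Continuous Ψ) (hc : HasCompactSupport Ψ)
    (hg : LocallyIntegrable g) :
    ∫ p, segmentAverage e Ψ p • g p = ∫ p, Ψ p • ∫ σ, g (p + σ • e) ∂unitMeasure := by
  have h1 := integrable_test_sub (e := e) hΨ hc hg
  have h2 := integrable_test_add (e := e) hΨ hc hg
  calc ∫ p, segmentAverage e Ψ p • g p
      = ∫ p, ∫ σ, Ψ (p - σ • e) • g p ∂unitMeasure := by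
        refine integral_congr_ae (Eventually.of_forall fun p => ?_)
        simp only [segmentAverage]
        rw [integral_smul_const]
    _ = ∫ z, Ψ (z.2 - z.1 • e) • g z.2 ∂(unitMeasure.prod volume) :=
        (integral_prod_symm _ h1).symm
    _ = ∫ z, Ψ z.2 • g (z.2 + z.1 • e) ∂(unitMeasure.prod volume) := by
        rw [← (measurePreserving_shear e).map_eq] at h1
        have := integral_map (measurePreserving_shear e).measurable.aemeasurable
          h1.aestronglyMeasurable
        rw [(measurePreserving_shear e).map_eq] at this
        rw [this]
        simp
    _ = ∫ p, ∫ σ, Ψ p • g (p + σ • e) ∂unitMeasure := integral_prod_symm _ h2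
    _ = ∫ p, Ψ p • ∫ σ, g (p + σ • e) ∂unitMeasure := by simp only [integral_smul]

lemma locallyIntegrable_segmentIntegral {g : ℝ × ℝ → ℂ} (hg : LocallyIntegrable g) :
    LocallyIntegrable fun p => ∫ σ, g (p + σ • e) ∂unitMeasure := by
  rw [locallyIntegrable_iff]
  intro K hK
  obtain ⟨χ, hχ1, -, hχc, -⟩ := exists_continuous_one_zero_of_isCompact hK isClosed_empty
    (disjoint_empty K)
  have h := (integrable_test_add (e := e) χ.continuous hχc hg).integral_prod_right
  refine (h.integrableOn (s := K)).congr ?_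
  filter_upwards [ae_restrict_mem hK.measurableSet] with p hp
  have : χ p = 1 := hχ1 hp
  simp only [this, one_smul]

/-- The average is the convolution of Ψ with the uniform probability measure on the segment from 0
to e, so it inherits smoothness. -/
lemma contDiff_segmentAverage (hΨ : ContDiff ℝ ∞ Ψ) (hc : HasCompactSupport Ψ) :
    ContDiff ℝ ∞ (segmentAverage e Ψ) := by
  have hm : Measurable fun σ : ℝ => σ • e := by fun_prop
  let μ : Measure (ℝ × ℝ) := Measure.map (fun σ : ℝ => σ • e) unitMeasure
  have : IsProbabilityMeasure μ := Measure.isProbabilityMeasure_map hm.aemeasurable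
  have h1 : LocallyIntegrable (fun _ : ℝ × ℝ => (1 : ℝ)) μ := locallyIntegrable_const 1
  have h2 := hc.contDiff_convolution_right (ContinuousLinearMap.lsmul ℝ ℝ) h1
    (hΨ : ContDiff ℝ ((⊤ : ℕ∞) : WithTop ℕ∞) Ψ)
  convert! h2 using 1
  funext p
  rw [segmentAverage, convolution_def]
  simp only [ContinuousLinearMap.lsmul_apply, one_smul]
  rw [integral_map hm.aemeasurable]
  exact (hΨ.continuous.comp (continuous_const.sub continuous_id)).aestronglyMeasurable

lemma segmentAverage_eq_zero {p : ℝ × ℝ} (hp : p ∉ segmentSweep e (tsupport Ψ)) :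
    segmentAverage e Ψ p = 0 := by
  refine integral_eq_zero_of_ae ?_
  filter_upwards [ae_restrict_mem measurableSet_Ioc] with σ hσ
  exact image_eq_zero_of_notMem_tsupport fun h => hp (mem_segmentSweep hσ h)

lemma tsupport_segmentAverage (hc : HasCompactSupport Ψ) :
    tsupport (segmentAverage e Ψ) ⊆ segmentSweep e (tsupport Ψ) :=
  closure_minimal (fun _ hp => by_contra fun h => hp (segmentAverage_eq_zero h))
    (isCompact_segmentSweep e hc.isCompact).isClosed

lemma hasCompactSupport_segmentAverage (hc : HasCompactSupport Ψ) :
    HasCompactSupport (segmentAverage e Ψ) :=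
  HasCompactSupport.intro (isCompact_segmentSweep e hc.isCompact) fun _ => segmentAverage_eq_zero

/-- Along the line p + re the average is the integral of Ψ over the parameters in [r − 1, r], that
is F(r) − F(r − 1) for a primitive F. Used as a test function, it therefore turns the weak identity
into a statement about u(p + e) − u(p). -/
lemma fderiv_segmentAverage (hΨ : ContDiff ℝ ∞ Ψ) (hc : HasCompactSupport Ψ) (p : ℝ × ℝ) :
    fderiv ℝ (segmentAverage e Ψ) p e = Ψ p - Ψ (p - e) := by
  have hd := ((contDiff_segmentAverage (e := e) hΨ hc).differentiable (by simp) p).hasFDerivAt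
  have hl : HasDerivAt (fun r : ℝ => p + r • e) e 0 := by
    simpa using ((hasDerivAt_id (0 : ℝ)).smul_const e).const_add p
  have h1 : HasDerivAt (fun r : ℝ => segmentAverage e Ψ (p + r • e))
      (fderiv ℝ (segmentAverage e Ψ) p e) 0 := by
    have hd' : HasFDerivAt (segmentAverage e Ψ) (fderiv ℝ (segmentAverage e Ψ) p)
        (p + (0 : ℝ) • e) := by simpa using hd
    exact hd'.comp_hasDerivAt (0 : ℝ) hl
  set F : ℝ → ℝ := fun r => ∫ τ in (0 : ℝ)..r, Ψ (p + τ • e) with hF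
  have hcont : Continuous fun τ : ℝ => Ψ (p + τ • e) := by
    have := hΨ.continuous
    fun_prop
  have hFd : ∀ r, HasDerivAt F (Ψ (p + r • e)) r := fun r =>
    intervalIntegral.integral_hasDerivAt_right (hcont.intervalIntegrable _ _)
      (hcont.stronglyMeasurableAtFilter _ _) hcont.continuousAt
  have h2 : ∀ r, segmentAverage e Ψ (p + r • e) = F r - F (r - 1) := fun r => by
    rw [hF]
    simp only
    rw [intervalIntegral.integral_interval_sub_left
      (hcont.intervalIntegrable _ _) (hcont.intervalIntegrable _ _)]
    have := intervalIntegral.integral_comp_sub_left (a := (0 : ℝ)) (b := 1)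
      (fun τ => Ψ (p + τ • e)) r
    rw [sub_zero] at this
    rw [← this, intervalIntegral.integral_of_le zero_le_one, segmentAverage]
    refine integral_congr_ae (Eventually.of_forall fun σ => ?_)
    simp only [sub_smul, add_sub_assoc]
  have h3 : HasDerivAt (fun r => F r - F (r - 1)) (Ψ (p + (0 : ℝ) • e) -
      Ψ (p + ((0 : ℝ) - 1) • e)) 0 :=
    (hFd 0).sub ((hFd (0 - 1)).comp_sub_const 0 1)
  rw [show (fun r : ℝ => segmentAverage e Ψ (p + r • e)) = fun r => F r - F (r - 1) from
    funext h2] at h1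
  have := h1.unique h3
  simpa [sub_eq_add_neg] using this

/-- A function with weak derivative `g` in direction `e` is, almost everywhere, the integral of `g`
along segments in direction `e`. -/
theorem ae_sub_eq_segmentIntegral {W : Set (ℝ × ℝ)} (hWo : IsOpen W) (hWc : Convex ℝ W)
    {u g : ℝ × ℝ → ℂ} (hu : LocallyIntegrable (Lam.indicator u))
    (hg : LocallyIntegrable (Lam.indicator g))
    (hweak : ∀ φ : ℝ × ℝ → ℝ, ContDiff ℝ ∞ φ → HasCompactSupport φ → tsupport φ ⊆ W →
      ∫ p in Lam, (fderiv ℝ φ p e • u p + φ p • g p) = 0) :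
    ∀ᵐ p, p ∈ W → p + e ∈ W → Lam.indicator u (p + e) - Lam.indicator u p =
      ∫ σ, Lam.indicator g (p + σ • e) ∂unitMeasure := by
  set v := Lam.indicator u with hv
  set k := Lam.indicator g with hk
  have hU : IsOpen (W ∩ {p | p + e ∈ W}) :=
    hWo.inter (hWo.preimage (continuous_id.add continuous_const))
  have hshift : LocallyIntegrable fun p => v (p + e) := by
    have hmp : MeasurePreserving (fun p : ℝ × ℝ => p + e) := measurePreserving_add_right volume e
    rw [locallyIntegrable_iff]
    intro K hK
    have h1 := hu.integrableOn_isCompact (hK.image (continuous_id.add continuous_const :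
      Continuous fun p : ℝ × ℝ => p + e))
    have h2 := (hmp.integrableOn_comp_preimage (measurableEmbedding_addRight e)
      (f := v) (s := (fun p => p + e) '' K)).2 h1
    rwa [preimage_image_eq _ (add_left_injective e)] at h2
  have hseg := locallyIntegrable_segmentIntegral (e := e) hg
  have hloc : LocallyIntegrable fun p => v (p + e) - v p - ∫ σ, k (p + σ • e) ∂unitMeasure :=
    (hshift.sub hu).sub hseg
  have key := hU.ae_eq_zero_of_integral_contDiff_smul_eq_zero (hloc.locallyIntegrableOn _)
    fun Ψ hΨ hc hs => ?_
  · filter_upwards [key] with p hp h1 h2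
    exact sub_eq_zero.1 (hp ⟨h1, h2⟩)
  · have hsub : tsupport (segmentAverage e Ψ) ⊆ W := by
      refine (tsupport_segmentAverage hc).trans ?_
      rintro _ ⟨z, ⟨hz1, hz2⟩, rfl⟩
      exact hWc.add_smul_mem (hs hz1).1 (hs hz1).2 hz2
    have hφ := contDiff_segmentAverage (e := e) hΨ hc
    have hφc := hasCompactSupport_segmentAverage (e := e) hc
    have h0 := hweak _ hφ hφc hsub
    rw [← integral_indicator measurableSet_Lam] at h0
    have hΨ' : Continuous fun p => Ψ (p - e) := by
      have := hΨ.continuous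
      fun_prop
    have hc' : HasCompactSupport fun p => Ψ (p - e) :=
      hc.comp_homeomorph (Homeomorph.subRight e)
    have i1 : Integrable fun p => Ψ p • v p :=
      hu.integrable_smul_left_of_hasCompactSupport hΨ.continuous hc
    have i2 : Integrable fun p => Ψ (p - e) • v p :=
      hu.integrable_smul_left_of_hasCompactSupport hΨ' hc'
    have i3 : Integrable fun p => segmentAverage e Ψ p • k p :=
      hg.integrable_smul_left_of_hasCompactSupport hφ.continuous hφc
    have i4 : Integrable fun p => Ψ p • v (p + e) :=
      hshift.integrable_smul_left_of_hasCompactSupport hΨ.continuous hc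
    have i5 : Integrable fun p => Ψ p • ∫ σ, k (p + σ • e) ∂unitMeasure :=
      hseg.integrable_smul_left_of_hasCompactSupport hΨ.continuous hc
    have e1 : ∀ p, Lam.indicator (fun p => fderiv ℝ (segmentAverage e Ψ) p e • u p +
        segmentAverage e Ψ p • g p) p =
        (Ψ p • v p - Ψ (p - e) • v p) + segmentAverage e Ψ p • k p := fun p => by
      by_cases hp : p ∈ Lam
      · rw [indicator_of_mem hp, hv, hk, indicator_of_mem hp, indicator_of_mem hp,
          fderiv_segmentAverage hΨ hc, sub_smul]
      · rw [indicator_of_notMem hp, hv, hk, indicator_of_notMem hp, indicator_of_notMem hp]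
        simp
    have e2 : ∫ p, Ψ (p - e) • v p = ∫ p, Ψ p • v (p + e) := by
      rw [← integral_add_right_eq_self (fun p => Ψ (p - e) • v p) e]
      simp
    simp only [e1] at h0
    have e3 := integral_add (i1.sub i2) i3
    have e4 := integral_sub (i4.sub i1) i5
    simp only [Pi.sub_apply] at e3 e4
    rw [e3, integral_sub i1 i2, e2, integral_segmentAverage_smul hΨ.continuous hc hg] at h0
    simp only [smul_sub]
    rw [e4, integral_sub i4 i1]
    linear_combination -h0

end Segment

/-! ### A sharp one-dimensional Poincaré inequality -/

lemma sq_lintegral_mul_le {α : Type*} [MeasurableSpace α] (μ : Measure α) {f g : α → ENNReal}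
    (hf : AEMeasurable f μ) (hg : AEMeasurable g μ) :
    (∫⁻ x, f x * g x ∂μ) ^ 2 ≤ (∫⁻ x, f x ^ 2 ∂μ) * ∫⁻ x, g x ^ 2 ∂μ := by
  have h := ENNReal.lintegral_mul_le_Lp_mul_Lq μ Real.HolderConjugate.two_two hf hg
  have e : ∀ a : ENNReal, (a ^ (1 / 2 : ℝ)) ^ 2 = a := fun a => by
    rw [← ENNReal.rpow_natCast, ← ENNReal.rpow_mul]; norm_num
  calc (∫⁻ x, f x * g x ∂μ) ^ 2
      ≤ ((∫⁻ x, f x ^ (2 : ℝ) ∂μ) ^ (1 / 2 : ℝ) * (∫⁻ x, g x ^ (2 : ℝ) ∂μ) ^ (1 / 2 : ℝ)) ^ 2 :=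
        pow_le_pow_left' h 2
    _ = _ := by
        rw [mul_pow, e, e]
        simp only [ENNReal.rpow_ofNat]

lemma sq_lintegral_le {α : Type*} [MeasurableSpace α] (μ : Measure α) {f : α → ENNReal}
    (hf : AEMeasurable f μ) : (∫⁻ x, f x ∂μ) ^ 2 ≤ μ univ * ∫⁻ x, f x ^ 2 ∂μ := by
  have h := sq_lintegral_mul_le μ (aemeasurable_const (b := 1)) hf
  simpa using h

lemma sq_lintegral_le_weighted {α : Type*} [MeasurableSpace α] (μ : Measure α)
    {f w : α → ENNReal} (hf : Measurable f) (hw : Measurable w)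
    (hw0 : ∀ᵐ x ∂μ, w x ≠ 0 ∧ w x ≠ ⊤) :
    (∫⁻ x, f x ∂μ) ^ 2 ≤ (∫⁻ x, f x ^ 2 * (w x)⁻¹ ∂μ) * ∫⁻ x, w x ∂μ := by
  have hr : Measurable fun x => w x ^ (1 / 2 : ℝ) := hw.pow_const _
  have e : ∀ a : ENNReal, (a ^ (1 / 2 : ℝ)) ^ 2 = a := fun a => by
    rw [← ENNReal.rpow_natCast, ← ENNReal.rpow_mul]; norm_num
  have h := sq_lintegral_mul_le μ (f := fun x => f x * (w x ^ (1 / 2 : ℝ))⁻¹)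
    (hf.mul hr.inv).aemeasurable hr.aemeasurable
  have h1 : ∫⁻ x, f x * (w x ^ (1 / 2 : ℝ))⁻¹ * w x ^ (1 / 2 : ℝ) ∂μ = ∫⁻ x, f x ∂μ := by
    refine lintegral_congr_ae ?_
    filter_upwards [hw0] with x hx
    have a1 : w x ^ (1 / 2 : ℝ) ≠ 0 := fun h0 => by
      rw [ENNReal.rpow_eq_zero_iff] at h0
      rcases h0 with h0 | h0
      · exact hx.1 h0.1
      · exact hx.2 h0.1
    have a2 : w x ^ (1 / 2 : ℝ) ≠ ⊤ := ENNReal.rpow_ne_top_of_nonneg (by norm_num) hx.2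
    rw [mul_assoc, ENNReal.inv_mul_cancel a1 a2, mul_one]
  have h2 : ∀ x, (f x * (w x ^ (1 / 2 : ℝ))⁻¹) ^ 2 = f x ^ 2 * (w x)⁻¹ := fun x => by
    rw [mul_pow, ← ENNReal.inv_pow, e]
  calc (∫⁻ x, f x ∂μ) ^ 2 = _ := by rw [← h1]
    _ ≤ _ := h
    _ = _ := by simp only [h2, e]

lemma lintegral_ofReal_Ioo {f : ℝ → ℝ} (hf : Continuous f) {a b : ℝ} (hab : a ≤ b)
    (h0 : ∀ x ∈ Ioo a b, 0 ≤ f x) :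
    ∫⁻ x in Ioo a b, ENNReal.ofReal (f x) = ENNReal.ofReal (∫ x in a..b, f x) := by
  rw [intervalIntegral.integral_of_le hab, integral_Ioc_eq_integral_Ioo,
    ofReal_integral_eq_lintegral_ofReal]
  · exact (hf.continuousOn.integrableOn_Icc).mono_set Ioo_subset_Icc_self
  · exact (ae_restrict_iff' measurableSet_Ioo).2 (Eventually.of_forall h0)

lemma lintegral_triangle_swap {A B : ℝ → ENNReal} (hA : Measurable A) (hB : Measurable B) :
    ∫⁻ t in Ioo (0 : ℝ) 1, (∫⁻ τ in Ioo 0 t, A τ) * B t =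
      ∫⁻ τ in Ioo (0 : ℝ) 1, A τ * ∫⁻ t in Ioo τ 1, B t := by
  let T : Set (ℝ × ℝ) := {z | 0 < z.2 ∧ z.2 < z.1 ∧ z.1 < 1}
  have hT : MeasurableSet T :=
    (measurableSet_lt measurable_const measurable_snd).inter
      ((measurableSet_lt measurable_snd measurable_fst).inter
        (measurableSet_lt measurable_fst measurable_const))
  let F : ℝ → ℝ → ENNReal := fun t τ => T.indicator (fun z => A z.2 * B z.1) (t, τ)
  have hF : Measurable (Function.uncurry F) :=
    ((hA.comp measurable_snd).mul (hB.comp measurable_fst)).indicator hT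
  have h1 : ∫⁻ t in Ioo (0 : ℝ) 1, (∫⁻ τ in Ioo 0 t, A τ) * B t = ∫⁻ t, ∫⁻ τ, F t τ := by
    rw [← lintegral_indicator measurableSet_Ioo]
    refine lintegral_congr fun t => ?_
    by_cases ht : t ∈ Ioo (0 : ℝ) 1
    · rw [indicator_of_mem ht, ← lintegral_mul_const _ hA, ← lintegral_indicator measurableSet_Ioo]
      refine lintegral_congr fun τ => ?_
      by_cases hτ : τ ∈ Ioo 0 t
      · have : (t, τ) ∈ T := ⟨hτ.1, hτ.2, ht.2⟩
        simp only [F]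
        rw [indicator_of_mem hτ, indicator_of_mem this]
      · have : (t, τ) ∉ T := fun h => hτ ⟨h.1, h.2.1⟩
        simp only [F]
        rw [indicator_of_notMem hτ, indicator_of_notMem this]
    · rw [indicator_of_notMem ht]
      have : ∀ τ, F t τ = 0 := fun τ =>
        indicator_of_notMem (fun h : (t, τ) ∈ T => ht ⟨h.1.trans h.2.1, h.2.2⟩) _
      simp only [this, lintegral_zero]
  have h2 : ∫⁻ τ in Ioo (0 : ℝ) 1, A τ * ∫⁻ t in Ioo τ 1, B t = ∫⁻ τ, ∫⁻ t, F t τ := by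
    rw [← lintegral_indicator measurableSet_Ioo]
    refine lintegral_congr fun τ => ?_
    by_cases hτ : τ ∈ Ioo (0 : ℝ) 1
    · rw [indicator_of_mem hτ, ← lintegral_const_mul _ hB, ← lintegral_indicator measurableSet_Ioo]
      refine lintegral_congr fun t => ?_
      by_cases ht : t ∈ Ioo τ 1
      · have : (t, τ) ∈ T := ⟨hτ.1, ht.1, ht.2⟩
        simp only [F]
        rw [indicator_of_mem ht, indicator_of_mem this]
      · have : (t, τ) ∉ T := fun h => ht ⟨h.2.1, h.2.2⟩
        simp only [F]
        rw [indicator_of_notMem ht, indicator_of_notMem this]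
    · rw [indicator_of_notMem hτ]
      have : ∀ t, F t τ = 0 := fun t =>
        indicator_of_notMem (fun h : (t, τ) ∈ T => hτ ⟨h.1, h.2.1.trans h.2.2⟩) _
      simp only [this, lintegral_zero]
  rw [h1, h2, lintegral_lintegral_swap hF.aemeasurable]

lemma integral_cos_half (t : ℝ) : ∫ τ in (0 : ℝ)..t, Real.cos (Real.pi / 2 * τ) =
    2 / Real.pi * Real.sin (Real.pi / 2 * t) := by
  rw [intervalIntegral.integral_comp_mul_left _ (by positivity : Real.pi / 2 ≠ 0)]
  simp

lemma integral_sin_half (τ : ℝ) :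
    ∫ t in τ..1, 2 / Real.pi * Real.sin (Real.pi / 2 * t) =
      4 / Real.pi ^ 2 * Real.cos (Real.pi / 2 * τ) := by
  rw [intervalIntegral.integral_const_mul,
    intervalIntegral.integral_comp_mul_left _ (by positivity : Real.pi / 2 ≠ 0), integral_sin,
    mul_one, Real.cos_pi_div_two]
  have := Real.pi_ne_zero
  simp only [sub_zero, smul_eq_mul]
  field_simp
  ring

/-- The sharp Poincaré inequality on `(0,1)` for functions vanishing at `0`. -/
theorem lintegral_sq_primitive_le {G : ℝ → ENNReal} (hG : Measurable G) :
    ∫⁻ t in Ioo (0 : ℝ) 1, (∫⁻ τ in Ioo 0 t, G τ) ^ 2 ≤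
      ENNReal.ofReal (4 / Real.pi ^ 2) * ∫⁻ t in Ioo (0 : ℝ) 1, G t ^ 2 := by
  have hpi := Real.pi_pos
  -- The weight is, up to a constant, the derivative of the extremal sin(πt/2). Its primitive B
  -- satisfies ∫_τ^1 B = (4/π²) w(τ), so weighted Cauchy–Schwarz followed by exchange of the
  -- integrals reproduces the weight and yields the sharp constant.
  set w : ℝ → ENNReal := fun τ => ENNReal.ofReal (Real.cos (Real.pi / 2 * τ)) with hw
  have hcos : ∀ τ ∈ Ioo (0 : ℝ) 1, 0 < Real.cos (Real.pi / 2 * τ) := fun τ hτ =>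
    Real.cos_pos_of_mem_Ioo ⟨by nlinarith [hτ.1], by nlinarith [hτ.2]⟩
  have hwm : Measurable w := by
    have : Continuous fun τ => Real.cos (Real.pi / 2 * τ) := by fun_prop
    exact this.measurable.ennreal_ofReal
  have hw0 : ∀ τ ∈ Ioo (0 : ℝ) 1, w τ ≠ 0 ∧ w τ ≠ ⊤ := fun τ hτ =>
    ⟨by simpa [hw] using hcos τ hτ, ENNReal.ofReal_ne_top⟩
  set B : ℝ → ENNReal := fun t => ENNReal.ofReal (2 / Real.pi * Real.sin (Real.pi / 2 * t)) with hB
  have hBc : Continuous fun t => 2 / Real.pi * Real.sin (Real.pi / 2 * t) := by fun_prop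
  have hBm : Measurable B := hBc.measurable.ennreal_ofReal
  calc ∫⁻ t in Ioo (0 : ℝ) 1, (∫⁻ τ in Ioo 0 t, G τ) ^ 2
      ≤ ∫⁻ t in Ioo (0 : ℝ) 1, (∫⁻ τ in Ioo 0 t, G τ ^ 2 * (w τ)⁻¹) * B t := by
        refine setLIntegral_mono' measurableSet_Ioo fun t ht => ?_
        refine (sq_lintegral_le_weighted _ hG hwm ?_).trans (le_of_eq ?_)
        · filter_upwards [ae_restrict_mem measurableSet_Ioo] with τ hτ
          exact hw0 τ ⟨hτ.1, hτ.2.trans ht.2⟩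
        · rw [hw, lintegral_ofReal_Ioo (by fun_prop) ht.1.le fun τ hτ =>
            (hcos τ ⟨hτ.1, hτ.2.trans ht.2⟩).le, integral_cos_half]
    _ = ∫⁻ τ in Ioo (0 : ℝ) 1, (G τ ^ 2 * (w τ)⁻¹) * ∫⁻ t in Ioo τ 1, B t :=
        lintegral_triangle_swap ((hG.pow_const 2).mul hwm.inv) hBm
    _ = ∫⁻ τ in Ioo (0 : ℝ) 1, ENNReal.ofReal (4 / Real.pi ^ 2) * G τ ^ 2 := by
        refine setLIntegral_congr_fun measurableSet_Ioo fun τ hτ => ?_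
        rw [hB, lintegral_ofReal_Ioo hBc hτ.2.le fun t ht => ?_, integral_sin_half,
          ENNReal.ofReal_mul (by positivity)]
        · have e : G τ ^ 2 * (w τ)⁻¹ * (ENNReal.ofReal (4 / Real.pi ^ 2) * w τ) =
              ENNReal.ofReal (4 / Real.pi ^ 2) * G τ ^ 2 * ((w τ)⁻¹ * w τ) := by ring
          exact e.trans (by rw [ENNReal.inv_mul_cancel (hw0 τ hτ).1 (hw0 τ hτ).2, mul_one])
        · refine mul_nonneg (by positivity) (Real.sin_nonneg_of_nonneg_of_le_pi ?_ ?_)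
          · have := hτ.1.trans ht.1
            positivity
          · nlinarith [ht.2]
    _ = _ := lintegral_const_mul _ (hG.pow_const 2)

namespace IsOrthogonalStrip

variable {d : ℕ} {L : ℝ × ℝ → EuclideanSpace ℝ (Fin d)} {ε : ℝ} {q : ℝ → ℝ}

/-! ### Poincaré inequality in the vertical direction -/

lemma measurable_tangentPairing (h : IsOrthogonalStrip L ε q) (i : Fin 2) (V : L2Vec L) :
    Measurable fun p => tangentPairing L i p (V p) := by
  refine Finset.measurable_sum _ fun m _ => Measurable.mul ?_ ?_
  · exact (Complex.continuous_ofReal.comp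
      ((EuclideanSpace.proj m : EuclideanSpace ℝ (Fin d) →L[ℝ] ℝ).continuous.comp
        (h.continuous_tangentVec i))).measurable
  · exact (EuclideanSpace.proj m : EuclideanSpace ℂ (Fin d) →L[ℂ] ℂ).continuous.measurable.comp
      (Lp.stronglyMeasurable V).measurable

lemma locallyIntegrable_indicator_of_restrict {F : Type*} [NormedAddCommGroup F] {f : ℝ × ℝ → F}
    (hf : LocallyIntegrable f (volume.restrict Lam)) : LocallyIntegrable (Lam.indicator f) := by
  rw [locallyIntegrable_iff] at hf ⊢
  intro K hK
  have := hf K hK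
  rw [IntegrableOn, Measure.restrict_restrict hK.measurableSet] at this
  rw [IntegrableOn, integrable_indicator_iff measurableSet_Lam, IntegrableOn,
    Measure.restrict_restrict measurableSet_Lam, inter_comm]
  exact this

lemma ae_sub_eq (h : IsOrthogonalStrip L ε q) {x : L2 L × L2Vec L} (hx : x ∈ gradientGraph L)
    (z : ℝ × ℝ) : ∀ᵐ p, p ∈ Lam → p + z ∈ Lam → x.1 (p + z) - x.1 p =
      ∫ σ, Lam.indicator (fun p => z.1 • tangentPairing L 0 p (x.2 p) +
        z.2 • tangentPairing L 1 p (x.2 p)) (p + σ • z) ∂unitMeasure := by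
  obtain ⟨-, h2, -⟩ := (h.hasDirichletGradient_iff (Lp.memLp _) (Lp.memLp _)).1
    (h.mem_gradientGraph_iff.1 hx)
  have hu := h.locallyIntegrable_restrict (Lp.memLp x.1)
  have hg := fun i => h.locallyIntegrable_tangentPairing i (Lp.memLp x.2)
  have key := ae_sub_eq_segmentIntegral (e := z) isOpen_Lam convex_Lam (u := x.1)
    (g := fun p => z.1 • tangentPairing L 0 p (x.2 p) + z.2 • tangentPairing L 1 p (x.2 p))
    (locallyIntegrable_indicator_of_restrict hu)
    (locallyIntegrable_indicator_of_restrict (((hg 0).smul z.1).add ((hg 1).smul z.2)))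
    fun φ hφ hc hs => ?_
  · filter_upwards [key] with p hp h1 h2
    rw [← hp h1 h2, indicator_of_mem h1, indicator_of_mem h2]
  · have hi : ∀ i, IntegrableOn (fun p => fderiv ℝ φ p (coordDir i) • x.1 p +
        φ p • tangentPairing L i p (x.2 p)) Lam := fun i =>
      (hu.integrable_smul_left_of_hasCompactSupport (continuous_deriv hφ i)
        (hasCompactSupport_deriv hc i)).add
        ((hg i).integrable_smul_left_of_hasCompactSupport hφ.continuous hc)
    have e : ∀ p, fderiv ℝ φ p z • x.1 p + φ p • (z.1 • tangentPairing L 0 p (x.2 p) +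
        z.2 • tangentPairing L 1 p (x.2 p)) =
        z.1 • (fderiv ℝ φ p (coordDir 0) • x.1 p + φ p • tangentPairing L 0 p (x.2 p)) +
        z.2 • (fderiv ℝ φ p (coordDir 1) • x.1 p + φ p • tangentPairing L 1 p (x.2 p)) :=
      fun p => by
        have hz : z = z.1 • coordDir 0 + z.2 • coordDir 1 := by
          ext <;> simp [coordDir]
        have : fderiv ℝ φ p z = z.1 * fderiv ℝ φ p (coordDir 0) +
            z.2 * fderiv ℝ φ p (coordDir 1) := by
          conv_lhs => rw [hz]
          simp
        rw [this]
        simp only [Complex.real_smul]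
        push_cast
        ring
    simp only [e]
    have e3 := integral_add ((hi 0).smul z.1) ((hi 1).smul z.2)
    simp only [Pi.smul_apply] at e3
    rw [e3, integral_smul, integral_smul, h2 0 φ hφ hc hs, h2 1 φ hφ hc hs]
    simp

/-- The zero trace makes the weak vertical identity valid for test functions that do not vanish at t
= 0, so the segment formula applies on {t < 1} to the extension of u by zero. A unit step in the
direction (0, −1) ends below the strip, where the extension vanishes. The derivative changes sign
with the direction. -/
lemma ae_eq_vertical_integral (h : IsOrthogonalStrip L ε q) {x : L2 L × L2Vec L}
    (hx : x ∈ gradientGraph L) : ∀ᵐ p, p ∈ Lam → x.1 p =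
      ∫ σ, Lam.indicator (fun p => tangentPairing L 1 p (x.2 p)) (p - σ • (0, 1)) ∂unitMeasure := by
  obtain ⟨-, -, h3⟩ := (h.hasDirichletGradient_iff (Lp.memLp _) (Lp.memLp _)).1
    (h.mem_gradientGraph_iff.1 hx)
  have hu := h.locallyIntegrable_restrict (Lp.memLp x.1)
  have hg := h.locallyIntegrable_tangentPairing 1 (Lp.memLp x.2)
  have hW : IsOpen {p : ℝ × ℝ | p.2 < 1} := isOpen_lt continuous_snd continuous_const
  have hWc : Convex ℝ {p : ℝ × ℝ | p.2 < 1} :=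
    (convex_Iio (1 : ℝ)).linear_preimage (LinearMap.snd ℝ ℝ ℝ)
  have key := ae_sub_eq_segmentIntegral (e := -(0, 1)) hW hWc (u := x.1)
    (g := fun p => -tangentPairing L 1 p (x.2 p))
    (locallyIntegrable_indicator_of_restrict hu)
    (locallyIntegrable_indicator_of_restrict hg.neg) fun φ hφ hc hs => ?_
  · filter_upwards [key] with p hp hpL
    have h1 : p + -(0, 1) ∉ Lam := fun hm => by
      have a := hm.1
      have b := hpL.2
      simp only [Prod.snd_add, Prod.snd_neg] at a
      linarith
    have h2 := hp hpL.2 (by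
      have b := hpL.2
      simp only [Prod.snd_add, Prod.snd_neg]
      linarith)
    rw [indicator_of_notMem h1, indicator_of_mem hpL, zero_sub] at h2
    rw [← neg_inj, h2, ← integral_neg]
    refine integral_congr_ae (Eventually.of_forall fun σ => ?_)
    simp only [smul_neg, ← sub_eq_add_neg]
    by_cases hm : p - σ • ((0 : ℝ), (1 : ℝ)) ∈ Lam
    · rw [indicator_of_mem hm, indicator_of_mem hm]
    · rw [indicator_of_notMem hm, indicator_of_notMem hm, neg_zero]
  · have := h3 φ hφ hc hs
    rw [← neg_eq_zero, ← integral_neg] at this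
    rw [← this]
    refine integral_congr_ae (Eventually.of_forall fun p => ?_)
    have hd : coordDir 1 = ((0 : ℝ), (1 : ℝ)) := rfl
    simp only [map_neg, neg_smul, smul_neg, neg_add, hd]

lemma ae_enorm_le_vertical (h : IsOrthogonalStrip L ε q) {x : L2 L × L2Vec L}
    (hx : x ∈ gradientGraph L) : ∀ᵐ p, p ∈ Lam → ‖x.1 p‖ₑ ≤
      ∫⁻ τ in Ioo 0 p.2, ‖tangentPairing L 1 (p.1, τ) (x.2 (p.1, τ))‖ₑ := by
  filter_upwards [h.ae_eq_vertical_integral hx] with p hp hpL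
  rw [hp hpL]
  set g : ℝ × ℝ → ℂ := fun p => tangentPairing L 1 p (x.2 p) with hg
  calc ‖∫ σ, Lam.indicator g (p - σ • (0, 1)) ∂unitMeasure‖ₑ
      ≤ ∫⁻ σ, ‖Lam.indicator g (p - σ • (0, 1))‖ₑ ∂unitMeasure := enorm_integral_le_lintegral_enorm _
    _ ≤ ∫⁻ σ in Ioc (0 : ℝ) 1, (Ioo 0 p.2).indicator (fun τ => ‖g (p.1, τ)‖ₑ) (p.2 - σ) := by
        refine setLIntegral_mono' measurableSet_Ioc fun σ hσ => ?_
        have e : p - σ • ((0 : ℝ), (1 : ℝ)) = (p.1, p.2 - σ) := by ext <;> simp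
        rw [e]
        by_cases hm : (p.1, p.2 - σ) ∈ Lam
        · have : p.2 - σ ∈ Ioo 0 p.2 := ⟨hm.1, by linarith [hσ.1]⟩
          rw [indicator_of_mem hm, indicator_of_mem this]
        · rw [indicator_of_notMem hm]; simp
    _ ≤ ∫⁻ σ, (Ioo 0 p.2).indicator (fun τ => ‖g (p.1, τ)‖ₑ) (p.2 - σ) := setLIntegral_le_lintegral _ _
    _ = ∫⁻ τ, (Ioo 0 p.2).indicator (fun τ => ‖g (p.1, τ)‖ₑ) τ :=
        lintegral_sub_left_eq_self (fun τ => (Ioo 0 p.2).indicator (fun τ => ‖g (p.1, τ)‖ₑ) τ) p.2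
    _ = _ := lintegral_indicator measurableSet_Ioo _

/-- The Poincaré inequality on vertical segments of the strip. -/
theorem lintegral_sq_le_vertical (h : IsOrthogonalStrip L ε q) {x : L2 L × L2Vec L}
    (hx : x ∈ gradientGraph L) {A : Set ℝ} (hA : MeasurableSet A) :
    ∫⁻ p in A ×ˢ Ioo (0 : ℝ) 1, ‖x.1 p‖ₑ ^ 2 ≤ ENNReal.ofReal (4 / Real.pi ^ 2) *
      ∫⁻ p in A ×ˢ Ioo (0 : ℝ) 1, ‖tangentPairing L 1 p (x.2 p)‖ₑ ^ 2 := by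
  have hum : Measurable fun p => ‖x.1 p‖ₑ ^ 2 :=
    (Lp.stronglyMeasurable x.1).measurable.enorm.pow_const 2
  have hgm : Measurable fun p => ‖tangentPairing L 1 p (x.2 p)‖ₑ :=
    (h.measurable_tangentPairing 1 x.2).enorm
  have hsub : A ×ˢ Ioo (0 : ℝ) 1 ⊆ Lam := fun p hp => hp.2
  have hae : ∀ᵐ p ∂((volume.restrict A).prod (volume.restrict (Ioo (0 : ℝ) 1))), ‖x.1 p‖ₑ ≤
      ∫⁻ τ in Ioo 0 p.2, ‖tangentPairing L 1 (p.1, τ) (x.2 (p.1, τ))‖ₑ := by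
    rw [Measure.prod_restrict, ← Measure.volume_eq_prod,
      ae_restrict_iff' (hA.prod measurableSet_Ioo)]
    filter_upwards [h.ae_enorm_le_vertical hx] with p hp hpA
    exact hp (hsub hpA)
  rw [Measure.volume_eq_prod, ← Measure.prod_restrict, lintegral_prod _ hum.aemeasurable,
    lintegral_prod _ (hgm.pow_const 2).aemeasurable, ← lintegral_const_mul' _ _ ENNReal.ofReal_ne_top]
  refine lintegral_mono_ae ?_
  filter_upwards [Measure.ae_ae_of_ae_prod hae] with s hs
  -- On almost every vertical segment, |u| is dominated by the primitive of |∂_t u| starting at the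
  -- Dirichlet edge, to which the one-dimensional inequality applies.
  refine (lintegral_mono_ae (g := fun t => (∫⁻ τ in Ioo 0 t,
    ‖tangentPairing L 1 (s, τ) (x.2 (s, τ))‖ₑ) ^ 2) ?_).trans
    (lintegral_sq_primitive_le (hgm.comp measurable_prodMk_left))
  filter_upwards [hs] with t ht
  exact pow_le_pow_left' ht 2

end IsOrthogonalStrip

/-! ### Oscillation and variance -/

lemma enorm_sq_combination_le {x y ℓ : ℝ} (hx : |x| ≤ ℓ) (hy : |y| ≤ ℓ) (a b : ℂ) :
    ‖x • a + y • b‖ₑ ^ 2 ≤ ENNReal.ofReal (2 * ℓ ^ 2) * (‖a‖ₑ ^ 2 + ‖b‖ₑ ^ 2) := by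
  have hℓ : 0 ≤ ℓ := (abs_nonneg x).trans hx
  simp only [← ofReal_norm, ← ENNReal.ofReal_pow (norm_nonneg _)]
  rw [← ENNReal.ofReal_add (by positivity) (by positivity), ← ENNReal.ofReal_mul (by positivity)]
  refine ENNReal.ofReal_le_ofReal ?_
  have h1 : ‖x • a + y • b‖ ≤ ℓ * (‖a‖ + ‖b‖) := by
    refine (norm_add_le _ _).trans ?_
    rw [norm_smul, norm_smul, Real.norm_eq_abs, Real.norm_eq_abs, mul_add]
    gcongr
  calc ‖x • a + y • b‖ ^ 2 ≤ (ℓ * (‖a‖ + ‖b‖)) ^ 2 := pow_le_pow_left₀ (norm_nonneg _) h1 2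
    _ = ℓ ^ 2 * (‖a‖ + ‖b‖) ^ 2 := by ring
    _ ≤ ℓ ^ 2 * (2 * (‖a‖ ^ 2 + ‖b‖ ^ 2)) := by
      gcongr
      exact add_sq_le
    _ = _ := by ring

/-- The variance is bounded by the mean square oscillation. -/
lemma measure_mul_lintegral_sq_le {α : Type*} [MeasurableSpace α] (μ : Measure α)
    [IsFiniteMeasure μ] {u : α → ℂ} (hu : Integrable u μ) (h0 : ∫ p, u p ∂μ = 0) :
    μ univ * ∫⁻ p, ‖u p‖ₑ ^ 2 ∂μ ≤ ∫⁻ p, ∫⁻ p', ‖u p' - u p‖ₑ ^ 2 ∂μ ∂μ := by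
  rw [← lintegral_const_mul' _ _ (measure_ne_top μ _)]
  refine lintegral_mono fun p => ?_
  rcases eq_or_ne (μ univ) 0 with hz | hz
  · simp [hz]
  -- For a function of mean zero, integrating u(p') − u(p) in p' isolates −μ(univ) u(p).
  -- Cauchy–Schwarz then leaves one surplus factor μ(univ) to cancel.
  have h1 : ∫ p', (u p' - u p) ∂μ = -(μ.real univ • u p) := by
    rw [integral_sub hu (integrable_const _), h0, integral_const, zero_sub]
  have h2 : μ univ * ‖u p‖ₑ ≤ ∫⁻ p', ‖u p' - u p‖ₑ ∂μ := by
    have := enorm_integral_le_lintegral_enorm (μ := μ) fun p' => u p' - u p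
    rw [h1, enorm_neg, enorm_smul, Real.enorm_eq_ofReal measureReal_nonneg,
      ofReal_measureReal] at this
    exact this
  have h3 := (pow_le_pow_left' h2 2).trans
    (sq_lintegral_le μ (hu.aestronglyMeasurable.sub aestronglyMeasurable_const).enorm)
  rw [mul_pow, sq (μ univ), mul_assoc] at h3
  exact (ENNReal.mul_le_mul_iff_right hz (measure_ne_top μ _)).1 h3

namespace IsOrthogonalStrip

variable {d : ℕ} {L : ℝ × ℝ → EuclideanSpace ℝ (Fin d)} {ε : ℝ} {q : ℝ → ℝ}

lemma norm_tangentPairing_le (L : ℝ × ℝ → EuclideanSpace ℝ (Fin d)) (i : Fin 2) (p : ℝ × ℝ)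
    (v : EuclideanSpace ℂ (Fin d)) : ‖tangentPairing L i p v‖ ≤ ‖tangentVec L i p‖ * ‖v‖ := by
  let w : EuclideanSpace ℂ (Fin d) := WithLp.toLp 2 fun m => ((tangentVec L i p m : ℝ) : ℂ)
  have h1 : tangentPairing L i p v = ⟪w, v⟫_ℂ := by
    simp [tangentPairing, w, PiLp.inner_apply, mul_comm]
  have h2 : ‖w‖ = ‖tangentVec L i p‖ := by
    simp [w, EuclideanSpace.norm_eq]
  rw [h1, ← h2]
  exact norm_inner_le_norm _ _

lemma enorm_sq_tangentPairing_le {i : Fin 2} {H : ℝ} {p : ℝ × ℝ} (hp : ‖tangentVec L i p‖ ≤ H)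
    (v : EuclideanSpace ℂ (Fin d)) :
    ‖tangentPairing L i p v‖ₑ ^ 2 ≤ ENNReal.ofReal (H ^ 2) * ‖v‖ₑ ^ 2 := by
  simp only [← ofReal_norm, ← ENNReal.ofReal_pow (norm_nonneg _)]
  rw [← ENNReal.ofReal_mul (by positivity), ← mul_pow]
  refine ENNReal.ofReal_le_ofReal (pow_le_pow_left₀ (norm_nonneg _) ?_ 2)
  exact (norm_tangentPairing_le L i p v).trans (by gcongr)

/-! ### Oscillation of functions of finite energy on convex sets -/

/-- Convexity keeps the segment from p to p + z inside C, so Cauchy–Schwarz bounds |u(p + z) −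
u(p)|² by 2ℓ² times the mean of |∂₀u|² + |∂₁u|² along it. For fixed z, integrating in p removes the
segment by translation invariance. The increments z fill at most a square of side 2ℓ, whence (2ℓ)² ·
2ℓ² = 8ℓ⁴. -/
lemma lintegral_sq_sub_le (h : IsOrthogonalStrip L ε q) {x : L2 L × L2Vec L}
    (hx : x ∈ gradientGraph L) {C : Set (ℝ × ℝ)} (hC : MeasurableSet C) (hCc : Convex ℝ C)
    (hCL : C ⊆ Lam) {ℓ : ℝ} (hℓ : 0 ≤ ℓ)
    (hd : ∀ p ∈ C, ∀ p' ∈ C, |p'.1 - p.1| ≤ ℓ ∧ |p'.2 - p.2| ≤ ℓ) :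
    ∫⁻ p in C, ∫⁻ p' in C, ‖x.1 p' - x.1 p‖ₑ ^ 2 ≤ ENNReal.ofReal (8 * ℓ ^ 4) *
      ∫⁻ p in C, (‖tangentPairing L 0 p (x.2 p)‖ₑ ^ 2 + ‖tangentPairing L 1 p (x.2 p)‖ₑ ^ 2) := by
  have hu : Measurable x.1 := (Lp.stronglyMeasurable x.1).measurable
  set g : Fin 2 → ℝ × ℝ → ℂ := fun i p => tangentPairing L i p (x.2 p) with hg
  have hgm : ∀ i, Measurable (g i) := fun i => h.measurable_tangentPairing i x.2
  let G : ℝ × ℝ → ENNReal := C.indicator fun p => ‖g 0 p‖ₑ ^ 2 + ‖g 1 p‖ₑ ^ 2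
  have hG : Measurable G :=
    (((hgm 0).enorm.pow_const 2).add ((hgm 1).enorm.pow_const 2)).indicator hC
  let T : Set ((ℝ × ℝ) × (ℝ × ℝ)) := {w | w.1 ∈ C ∧ w.1 + w.2 ∈ C}
  have hT : MeasurableSet T :=
    (measurable_fst hC).inter ((measurable_fst.add measurable_snd) hC)
  let F : ℝ × ℝ → ℝ × ℝ → ENNReal := fun p z =>
    T.indicator (fun w => ‖x.1 (w.1 + w.2) - x.1 w.1‖ₑ ^ 2) (p, z)
  have hF : Measurable (Function.uncurry F) :=
    ((((hu.comp (measurable_fst.add measurable_snd)).sub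
      (hu.comp measurable_fst)).enorm.pow_const 2)).indicator hT
  have h1 : ∫⁻ p in C, ∫⁻ p' in C, ‖x.1 p' - x.1 p‖ₑ ^ 2 = ∫⁻ p, ∫⁻ z, F p z := by
    rw [← lintegral_indicator hC]
    refine lintegral_congr fun p => ?_
    by_cases hp : p ∈ C
    · rw [indicator_of_mem hp, ← lintegral_indicator hC, ← lintegral_add_left_eq_self _ p]
      refine lintegral_congr fun z => ?_
      by_cases hz : p + z ∈ C
      · have : (p, z) ∈ T := ⟨hp, hz⟩
        simp only [F]
        rw [indicator_of_mem hz, indicator_of_mem this]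
      · have : (p, z) ∉ T := fun hm => hz hm.2
        simp only [F]
        rw [indicator_of_notMem hz, indicator_of_notMem this]
    · rw [indicator_of_notMem hp]
      have : ∀ z, F p z = 0 := fun z => indicator_of_notMem (fun hm : (p, z) ∈ T => hp hm.1) _
      simp only [this, lintegral_zero]
  have h2 : ∀ z : ℝ × ℝ, ∫⁻ p, F p z ≤ (Icc (-ℓ) ℓ ×ˢ Icc (-ℓ) ℓ).indicator
      (fun _ => ENNReal.ofReal (2 * ℓ ^ 2) * ∫⁻ p, G p) z := fun z => by
    by_cases hz : z ∈ Icc (-ℓ) ℓ ×ˢ Icc (-ℓ) ℓ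
    · rw [indicator_of_mem hz]
      have hz1 : |z.1| ≤ ℓ := abs_le.2 hz.1
      have hz2 : |z.2| ≤ ℓ := abs_le.2 hz.2
      have hGσ : Measurable (Function.uncurry fun (p : ℝ × ℝ) (σ : ℝ) => G (p + σ • z)) :=
        hG.comp (by fun_prop)
      calc ∫⁻ p, F p z ≤ ∫⁻ p, ENNReal.ofReal (2 * ℓ ^ 2) * ∫⁻ σ, G (p + σ • z) ∂unitMeasure := by
            refine lintegral_mono_ae ?_
            filter_upwards [h.ae_sub_eq hx z] with p hp
            have hGp : Measurable fun σ : ℝ => G (p + σ • z) := hG.comp (by fun_prop)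
            by_cases hm : (p, z) ∈ T
            · simp only [F]
              rw [indicator_of_mem hm, hp (hCL hm.1) (hCL hm.2),
                ← lintegral_const_mul _ hGp]
              set f := Lam.indicator fun p => z.1 • g 0 p + z.2 • g 1 p with hf
              have hfm : Measurable f :=
                (((hgm 0).const_smul z.1).add ((hgm 1).const_smul z.2)).indicator measurableSet_Lam
              have hfσ : Measurable fun σ : ℝ => f (p + σ • z) := hfm.comp (by fun_prop)
              refine (pow_le_pow_left' (enorm_integral_le_lintegral_enorm _) 2).trans ?_
              refine (sq_lintegral_le _ hfσ.enorm.aemeasurable).trans ?_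
              rw [measure_univ, one_mul]
              refine setLIntegral_mono' measurableSet_Ioc fun σ hσ => ?_
              have hmem : p + σ • z ∈ C := by
                have := hCc.add_smul_sub_mem hm.1 hm.2 ⟨hσ.1.le, hσ.2⟩
                simpa using this
              simp only [hf, G]
              rw [indicator_of_mem (hCL hmem), indicator_of_mem hmem]
              exact enorm_sq_combination_le hz1 hz2 _ _
            · simp only [F]
              rw [indicator_of_notMem hm]
              exact zero_le
        _ = ENNReal.ofReal (2 * ℓ ^ 2) * ∫⁻ σ, (∫⁻ p, G (p + σ • z)) ∂unitMeasure := by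
            rw [lintegral_const_mul _ hGσ.lintegral_prod_right,
              lintegral_lintegral_swap hGσ.aemeasurable]
        _ = _ := by
            simp only [lintegral_add_right_eq_self (μ := (volume : Measure (ℝ × ℝ))) G]
            simp
    · rw [indicator_of_notMem hz]
      have : ∀ p, F p z = 0 := fun p => by
        refine indicator_of_notMem (fun hm : (p, z) ∈ T => hz ?_) _
        have := hd p hm.1 (p + z) hm.2
        simp only [Prod.fst_add, Prod.snd_add, add_sub_cancel_left] at this
        exact ⟨abs_le.1 this.1, abs_le.1 this.2⟩
      simp only [this, lintegral_zero, le_refl]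
  rw [h1, lintegral_lintegral_swap hF.aemeasurable]
  refine (lintegral_mono h2).trans (le_of_eq ?_)
  rw [lintegral_indicator (measurableSet_Icc.prod measurableSet_Icc), setLIntegral_const,
    Measure.volume_eq_prod, Measure.prod_prod, Real.volume_Icc, lintegral_indicator hC,
    ← ENNReal.ofReal_mul (by linarith), mul_right_comm, ← ENNReal.ofReal_mul (by positivity)]
  congr 2
  ring

/-! ### Local energy bounds with respect to surface area -/

lemma restrict_area_le (h : IsOrthogonalStrip L ε q) {C : Set (ℝ × ℝ)} (hC : MeasurableSet C)
    {H : ℝ} (hH : ∀ p ∈ C, stretch ε q p ≤ H) :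
    (area L).restrict C ≤ ENNReal.ofReal (ε * H) • volume.restrict C := by
  refine Measure.le_iff.2 fun s hs => ?_
  rw [Measure.smul_apply, smul_eq_mul, h.area_eq, restrict_withDensity hC, withDensity_apply _ hs,
    Measure.restrict_restrict hC, Measure.restrict_restrict hs, Measure.restrict_apply hs]
  calc ∫⁻ p in s ∩ (C ∩ Lam), ENNReal.ofReal (ε * stretch ε q p)
      ≤ ∫⁻ p in s ∩ (C ∩ Lam), ENNReal.ofReal (ε * H) := by
        refine setLIntegral_mono' (hs.inter (hC.inter measurableSet_Lam)) fun p hp => ?_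
        exact ENNReal.ofReal_le_ofReal (mul_le_mul_of_nonneg_left (hH p hp.2.1) h.pos.le)
    _ ≤ _ := by
        rw [setLIntegral_const]
        gcongr
        exact inter_subset_left

lemma restrict_volume_le (h : IsOrthogonalStrip L ε q) {C : Set (ℝ × ℝ)} (hC : MeasurableSet C)
    (hCL : C ⊆ Lam) :
    (volume : Measure (ℝ × ℝ)).restrict C ≤ (ENNReal.ofReal ε)⁻¹ • (area L).restrict C := by
  have := Measure.restrict_mono_measure h.volume_restrict_le C
  rwa [Measure.restrict_restrict hC, inter_eq_left.2 hCL, Measure.restrict_smul] at this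

/-- A Poincaré inequality for functions of mean zero on a small convex set. -/
lemma lintegral_sq_le_of_integral_eq_zero (h : IsOrthogonalStrip L ε q) {x : L2 L × L2Vec L}
    (hx : x ∈ gradientGraph L) {C : Set (ℝ × ℝ)} (hC : MeasurableSet C) (hCc : Convex ℝ C)
    (hCL : C ⊆ Lam) {ℓ H E : ℝ} (hℓ : 0 < ℓ) (hE : 0 ≤ E)
    (hd : ∀ p ∈ C, ∀ p' ∈ C, |p'.1 - p.1| ≤ ℓ ∧ |p'.2 - p.2| ≤ ℓ)
    (hvol : ENNReal.ofReal (ℓ ^ 2) ≤ volume C) (hfin : volume C ≠ ⊤)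
    (hH : ∀ p ∈ C, stretch ε q p ≤ H) (hsmall : E * (8 * ℓ ^ 2 * H ^ 2 * (H ^ 2 + ε ^ 2)) ≤ 1)
    (h0 : ∫ p in C, x.1 p ∂area L = 0) :
    ENNReal.ofReal E * ∫⁻ p in C, ‖x.1 p‖ₑ ^ 2 ∂area L ≤ ∫⁻ p in C, ‖x.2 p‖ₑ ^ 2 ∂area L := by
  have hε := h.pos
  have hu : Measurable x.1 := (Lp.stronglyMeasurable x.1).measurable
  have hV : Measurable x.2 := (Lp.stronglyMeasurable x.2).measurable
  have hH0 : 0 ≤ H := by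
    obtain ⟨p, hp⟩ : C.Nonempty := by
      rw [nonempty_iff_ne_empty]
      rintro rfl
      rw [measure_empty, nonpos_iff_eq_zero, ENNReal.ofReal_eq_zero] at hvol
      exact absurd hvol (not_le.2 (by positivity))
    exact (h.stretch_pos p).le.trans (hH p hp)
  have hle := h.restrict_area_le hC hH
  have hge := h.restrict_volume_le hC hCL
  have : IsFiniteMeasure ((area L).restrict C) := by
    refine ⟨(hle univ).trans_lt ?_⟩
    rw [Measure.smul_apply, Measure.restrict_apply_univ, smul_eq_mul]
    exact ENNReal.mul_lt_top ENNReal.ofReal_lt_top hfin.lt_top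
  have hui : Integrable x.1 ((area L).restrict C) :=
    ((Lp.memLp x.1).restrict C).integrable (by norm_num)
  set X := ∫⁻ p in C, ‖x.1 p‖ₑ ^ 2 ∂area L with hX
  set Y := ∫⁻ p in C, ‖x.2 p‖ₑ ^ 2 ∂area L with hY
  have hεn : ENNReal.ofReal ε ≠ 0 := by simpa using hε
  have s1 : ENNReal.ofReal (ε * ℓ ^ 2) ≤ (area L).restrict C univ := by
    have := hge univ
    rw [Measure.smul_apply, Measure.restrict_apply_univ, smul_eq_mul,
      ← ENNReal.mul_le_iff_le_inv hεn ENNReal.ofReal_ne_top] at this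
    rw [ENNReal.ofReal_mul hε.le]
    exact (mul_le_mul_right hvol _).trans this
  have s2 := measure_mul_lintegral_sq_le _ hui h0
  have s3 : ∫⁻ p in C, ∫⁻ p' in C, ‖x.1 p' - x.1 p‖ₑ ^ 2 ∂area L ∂area L ≤
      ENNReal.ofReal (ε * H) * (ENNReal.ofReal (ε * H) *
        ∫⁻ p in C, ∫⁻ p' in C, ‖x.1 p' - x.1 p‖ₑ ^ 2) := by
    refine (lintegral_mono' hle fun p => lintegral_mono' hle le_rfl).trans (le_of_eq ?_)
    simp only [lintegral_smul_measure, smul_eq_mul]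
    rw [lintegral_const_mul' _ _ ENNReal.ofReal_ne_top]
  have s4 := h.lintegral_sq_sub_le hx hC hCc hCL hℓ.le hd
  have s5 : ∫⁻ p in C, (‖tangentPairing L 0 p (x.2 p)‖ₑ ^ 2 + ‖tangentPairing L 1 p (x.2 p)‖ₑ ^ 2) ≤
      ENNReal.ofReal (H ^ 2 + ε ^ 2) * ∫⁻ p in C, ‖x.2 p‖ₑ ^ 2 := by
    rw [← lintegral_const_mul' _ _ ENNReal.ofReal_ne_top]
    refine setLIntegral_mono' hC fun p hp => ?_
    rw [ENNReal.ofReal_add (by positivity) (by positivity), add_mul]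
    exact add_le_add (enorm_sq_tangentPairing_le ((h.norm_tangentVec_zero p).le.trans (hH p hp)) _)
      (enorm_sq_tangentPairing_le (h.norm_tangentVec_one p).le _)
  have s6 : ∫⁻ p in C, ‖x.2 p‖ₑ ^ 2 ≤ (ENNReal.ofReal ε)⁻¹ * Y := by
    rw [hY, ← smul_eq_mul, ← lintegral_smul_measure]
    exact lintegral_mono' hge le_rfl
  -- The factors are (εH)² from replacing area by ds dt in the double integral, 8ℓ⁴ from the
  -- oscillation estimate, H² + ε² from the lengths of the two tangent vectors, and 1/ε from
  -- returning to area. The lower bound εℓ² on the area of C is then cancelled.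
  have s7 : ENNReal.ofReal (ε * ℓ ^ 2) * X ≤
      ENNReal.ofReal (ε * ℓ ^ 2) * (ENNReal.ofReal (8 * ℓ ^ 2 * H ^ 2 * (H ^ 2 + ε ^ 2)) * Y) := by
    calc ENNReal.ofReal (ε * ℓ ^ 2) * X ≤ (area L).restrict C univ * X := by gcongr
      _ ≤ _ := s2
      _ ≤ _ := s3
      _ ≤ ENNReal.ofReal (ε * H) * (ENNReal.ofReal (ε * H) * (ENNReal.ofReal (8 * ℓ ^ 4) *
          (ENNReal.ofReal (H ^ 2 + ε ^ 2) * ((ENNReal.ofReal ε)⁻¹ * Y)))) := by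
        gcongr
        exact s4.trans (by gcongr; exact s5.trans (by gcongr))
      _ = _ := by
        rw [← ENNReal.ofReal_inv_of_pos hε]
        simp only [← mul_assoc]
        rw [← ENNReal.ofReal_mul (by positivity), ← ENNReal.ofReal_mul (by positivity),
          ← ENNReal.ofReal_mul (by positivity), ← ENNReal.ofReal_mul (by positivity),
          ← ENNReal.ofReal_mul (by positivity)]
        congr 2
        field_simp
  have s8 := (ENNReal.mul_le_mul_iff_right (by simpa using by positivity)
    ENNReal.ofReal_ne_top).1 s7
  calc ENNReal.ofReal E * X
      ≤ ENNReal.ofReal E * (ENNReal.ofReal (8 * ℓ ^ 2 * H ^ 2 * (H ^ 2 + ε ^ 2)) * Y) := by gcongr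
    _ = ENNReal.ofReal (E * (8 * ℓ ^ 2 * H ^ 2 * (H ^ 2 + ε ^ 2))) * Y := by
        rw [← mul_assoc, ← ENNReal.ofReal_mul hE]
    _ ≤ ENNReal.ofReal 1 * Y := by gcongr
    _ = Y := by rw [ENNReal.ofReal_one, one_mul]

/-- The vertical Poincaré inequality where the strip is nearly flat. -/
lemma lintegral_sq_le_of_stretch_le (h : IsOrthogonalStrip L ε q) {x : L2 L × L2Vec L}
    (hx : x ∈ gradientGraph L) {A : Set ℝ} (hA : MeasurableSet A) {H E : ℝ} (hE : 0 ≤ E)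
    (hH : ∀ p ∈ A ×ˢ Ioo (0 : ℝ) 1, stretch ε q p ≤ H) (hH0 : 0 ≤ H)
    (hEH : E * H ≤ (Real.pi / (2 * ε)) ^ 2) :
    ENNReal.ofReal E * ∫⁻ p in A ×ˢ Ioo (0 : ℝ) 1, ‖x.1 p‖ₑ ^ 2 ∂area L ≤
      ∫⁻ p in A ×ˢ Ioo (0 : ℝ) 1, ‖x.2 p‖ₑ ^ 2 ∂area L := by
  have hε := h.pos
  set S := A ×ˢ Ioo (0 : ℝ) 1 with hS_def
  have hS : MeasurableSet S := hA.prod measurableSet_Ioo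
  have hSL : S ⊆ Lam := fun p hp => hp.2
  have hle := h.restrict_area_le hS hH
  have hge := h.restrict_volume_le hS hSL
  have s1 : ∫⁻ p in S, ‖x.1 p‖ₑ ^ 2 ∂area L ≤ ENNReal.ofReal (ε * H) * ∫⁻ p in S, ‖x.1 p‖ₑ ^ 2 := by
    rw [← smul_eq_mul, ← lintegral_smul_measure]
    exact lintegral_mono' hle le_rfl
  have s2 := h.lintegral_sq_le_vertical hx hA
  have s3 : ∫⁻ p in S, ‖tangentPairing L 1 p (x.2 p)‖ₑ ^ 2 ≤
      ENNReal.ofReal (ε ^ 2) * ∫⁻ p in S, ‖x.2 p‖ₑ ^ 2 := by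
    rw [← lintegral_const_mul' _ _ ENNReal.ofReal_ne_top]
    exact lintegral_mono fun p => enorm_sq_tangentPairing_le (h.norm_tangentVec_one p).le _
  have s4 : ∫⁻ p in S, ‖x.2 p‖ₑ ^ 2 ≤
      (ENNReal.ofReal ε)⁻¹ * ∫⁻ p in S, ‖x.2 p‖ₑ ^ 2 ∂area L := by
    rw [← smul_eq_mul, ← lintegral_smul_measure]
    exact lintegral_mono' hge le_rfl
  set Y := ∫⁻ p in S, ‖x.2 p‖ₑ ^ 2 ∂area L
  calc ENNReal.ofReal E * ∫⁻ p in S, ‖x.1 p‖ₑ ^ 2 ∂area L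
      ≤ ENNReal.ofReal E * (ENNReal.ofReal (ε * H) * (ENNReal.ofReal (4 / Real.pi ^ 2) *
        (ENNReal.ofReal (ε ^ 2) * ((ENNReal.ofReal ε)⁻¹ * Y)))) := by
        gcongr
        refine s1.trans ?_
        gcongr
        refine s2.trans ?_
        gcongr
        refine s3.trans ?_
        gcongr
    -- Passing between area and ds dt costs εH and 1/ε, the tangent vector ∂_t L costs ε², and the
    -- sharp Poincaré constant is 4/π². Their product is H(2ε/π)².
    _ = ENNReal.ofReal (E * H / (Real.pi / (2 * ε)) ^ 2) * Y := by
        have := Real.pi_pos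
        rw [← ENNReal.ofReal_inv_of_pos hε]
        simp only [← mul_assoc]
        rw [← ENNReal.ofReal_mul (by positivity), ← ENNReal.ofReal_mul (by positivity),
          ← ENNReal.ofReal_mul (by positivity), ← ENNReal.ofReal_mul (by positivity)]
        congr 2
        field_simp
        norm_num
    _ ≤ ENNReal.ofReal 1 * Y := by
        have := Real.pi_pos
        gcongr
        exact (div_le_one (by positivity)).2 hEH
    _ = Y := by rw [ENNReal.ofReal_one, one_mul]

end IsOrthogonalStrip

lemma ofReal_norm_sq_Lp {α F : Type*} [MeasurableSpace α] {μ : Measure α} [NormedAddCommGroup F]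
    (f : Lp F 2 μ) : ENNReal.ofReal (‖f‖ ^ 2) = ∫⁻ p, ‖f p‖ₑ ^ 2 ∂μ := by
  rw [ENNReal.ofReal_pow (norm_nonneg _), ofReal_norm, Lp.enorm_def]
  have := eLpNorm_nnreal_pow_eq_lintegral (f := f) (μ := μ) (p := 2) (by norm_num)
  simpa using this

/-! ### Decomposition of a bounded part of the strip into squares -/

/-- The cell of index `c` in the decomposition of `Λ` into squares of side `1/m`. -/
def cell (m : ℕ) (c : ℤ × ℤ) : Set (ℝ × ℝ) :=
  {p | p ∈ Lam ∧ ⌊m * p.1⌋ = c.1 ∧ ⌊m * p.2⌋ = c.2}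

lemma measurableSet_cell (m : ℕ) (c : ℤ × ℤ) : MeasurableSet (cell m c) := by
  have h1 : Measurable fun p : ℝ × ℝ => ⌊(m : ℝ) * p.1⌋ :=
    Int.measurable_floor.comp (measurable_fst.const_mul _)
  have h2 : Measurable fun p : ℝ × ℝ => ⌊(m : ℝ) * p.2⌋ :=
    Int.measurable_floor.comp (measurable_snd.const_mul _)
  exact measurableSet_Lam.inter ((h1 (measurableSet_singleton c.1)).inter
    (h2 (measurableSet_singleton c.2)))

lemma cell_subset_Lam (m : ℕ) (c : ℤ × ℤ) : cell m c ⊆ Lam := fun _ hp => hp.1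

lemma cell_eq {m : ℕ} (hm : 0 < m) (c : ℤ × ℤ) : cell m c =
    Lam ∩ Ico ((c.1 : ℝ) / m) ((c.1 + 1) / m) ×ˢ Ico ((c.2 : ℝ) / m) ((c.2 + 1) / m) := by
  have hm' : (0 : ℝ) < m := by exact_mod_cast hm
  ext p
  simp only [cell, mem_ofPred_eq, mem_inter_iff, mem_prod, mem_Ico, Int.floor_eq_iff,
    div_le_iff₀' hm', lt_div_iff₀' hm']

lemma convex_cell {m : ℕ} (hm : 0 < m) (c : ℤ × ℤ) : Convex ℝ (cell m c) := by
  rw [cell_eq hm]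
  exact convex_Lam.inter ((convex_Ico _ _).prod (convex_Ico _ _))

lemma abs_sub_le_of_mem_cell {m : ℕ} (hm : 0 < m) {c : ℤ × ℤ} {p p' : ℝ × ℝ} (hp : p ∈ cell m c)
    (hp' : p' ∈ cell m c) : |p'.1 - p.1| ≤ (m : ℝ)⁻¹ ∧ |p'.2 - p.2| ≤ (m : ℝ)⁻¹ := by
  rw [cell_eq hm] at hp hp'
  obtain ⟨-, ⟨a1, a2⟩, a3, a4⟩ := hp
  obtain ⟨-, ⟨b1, b2⟩, b3, b4⟩ := hp'
  rw [add_div, one_div] at a2 a4 b2 b4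
  constructor <;> rw [abs_le] <;> constructor <;> linarith

lemma volume_cell_lt_top {m : ℕ} (hm : 0 < m) (c : ℤ × ℤ) : volume (cell m c) < ⊤ := by
  rw [cell_eq hm]
  refine (measure_mono inter_subset_right).trans_lt ?_
  rw [Measure.volume_eq_prod, Measure.prod_prod, Real.volume_Ico, Real.volume_Ico]
  exact ENNReal.mul_lt_top ENNReal.ofReal_lt_top ENNReal.ofReal_lt_top

lemma le_volume_cell {m : ℕ} (hm : 0 < m) {c : ℤ × ℤ} (h0 : 0 ≤ c.2) (h1 : c.2 < m) :
    ENNReal.ofReal ((m : ℝ)⁻¹ ^ 2) ≤ volume (cell m c) := by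
  have hm' : (0 : ℝ) < m := by exact_mod_cast hm
  -- The vertical interval is taken open because cells of the bottom row do not contain the edge t =
  -- 0. The volume is unaffected.
  have hsub : Ico ((c.1 : ℝ) / m) ((c.1 + 1) / m) ×ˢ Ioo ((c.2 : ℝ) / m) ((c.2 + 1) / m) ⊆
      cell m c := by
    rintro p ⟨hp1, hp2⟩
    rw [cell_eq hm]
    refine ⟨⟨?_, ?_⟩, hp1, Ioo_subset_Ico_self hp2⟩
    · have : (0 : ℝ) ≤ c.2 := by exact_mod_cast h0
      exact lt_of_le_of_lt (by positivity) hp2.1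
    · refine hp2.2.trans_le ((div_le_one hm').2 ?_)
      exact_mod_cast h1
  refine le_trans (le_of_eq ?_) (measure_mono hsub)
  rw [Measure.volume_eq_prod, Measure.prod_prod, Real.volume_Ico, Real.volume_Ioo,
    ← ENNReal.ofReal_mul (by rw [← sub_div, add_sub_cancel_left]; positivity)]
  congr 1
  ring

lemma pairwise_disjoint_cell (m : ℕ) : Pairwise (Function.onFun Disjoint (cell m)) := by
  intro c c' hc
  refine Set.disjoint_left.2 fun p hp hp' => hc ?_
  exact Prod.ext (hp.2.1.symm.trans hp'.2.1) (hp.2.2.symm.trans hp'.2.2)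

/-- The indices of the cells that cover `[-M,M) × (0,1)`. -/
def cellIndices (m M : ℕ) : Finset (ℤ × ℤ) :=
  Finset.Ico (-(m * M : ℤ)) (m * M) ×ˢ Finset.Ico 0 (m : ℤ)

lemma biUnion_cell {m : ℕ} (hm : 0 < m) (M : ℕ) :
    ⋃ c ∈ cellIndices m M, cell m c = Ico (-(M : ℝ)) M ×ˢ Ioo (0 : ℝ) 1 := by
  have hm' : (0 : ℝ) < m := by exact_mod_cast hm
  have key : ∀ p : ℝ × ℝ, (-(m * M : ℤ) ≤ ⌊m * p.1⌋ ∧ ⌊m * p.1⌋ < (m * M : ℤ)) ↔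
      p.1 ∈ Ico (-(M : ℝ)) M := fun p => by
    rw [Int.le_floor, Int.floor_lt]
    push_cast
    rw [← mul_neg, mul_le_mul_iff_right₀ hm', mul_lt_mul_iff_right₀ hm']
    rfl
  ext p
  simp only [mem_iUnion, exists_prop, mem_prod]
  constructor
  · rintro ⟨c, hc, hp, h1, h2⟩
    simp only [cellIndices, Finset.mem_product, Finset.mem_Ico, ← h1] at hc
    exact ⟨(key p).1 hc.1, hp⟩
  · rintro ⟨h1, h2⟩
    refine ⟨(⌊m * p.1⌋, ⌊m * p.2⌋), ?_, h2, rfl, rfl⟩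
    simp only [cellIndices, Finset.mem_product, Finset.mem_Ico]
    refine ⟨(key p).2 h1, Int.floor_nonneg.2 (mul_nonneg hm'.le h2.1.le), ?_⟩
    rw [Int.floor_lt]
    push_cast
    nlinarith [h2.2]

/-! ### Energy bound in finite codimension and conclusion -/

namespace IsOrthogonalStrip

variable {d : ℕ} {L : ℝ × ℝ → EuclideanSpace ℝ (Fin d)} {ε : ℝ} {q : ℝ → ℝ}

lemma exists_stretch_le (h : IsOrthogonalStrip L ε q) (M : ℝ) :
    ∃ H, 0 < H ∧ ∀ p ∈ Ico (-M) M ×ˢ Ioo (0 : ℝ) 1, stretch ε q p ≤ H := by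
  obtain ⟨C, hC⟩ := ((isCompact_Icc (a := -M) (b := M)).prod
    (isCompact_Icc (a := (0 : ℝ)) (b := 1))).exists_bound_of_continuousOn
      h.continuous_stretch.continuousOn
  refine ⟨max C 1, by positivity, fun p hp => ?_⟩
  have := hC p ⟨Ico_subset_Icc_self hp.1, Ioo_subset_Icc_self hp.2⟩
  exact (le_abs_self _).trans (this.trans (le_max_left _ _))

lemma area_lt_top (h : IsOrthogonalStrip L ε q) {C : Set (ℝ × ℝ)} (hC : MeasurableSet C) {H : ℝ}
    (hH : ∀ p ∈ C, stretch ε q p ≤ H) (hv : volume C < ⊤) : area L C < ⊤ := by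
  have := h.restrict_area_le hC hH univ
  rw [Measure.smul_apply, Measure.restrict_apply_univ, Measure.restrict_apply_univ,
    smul_eq_mul] at this
  exact this.trans_lt (ENNReal.mul_lt_top ENNReal.ofReal_lt_top hv)

lemma exists_stretch_le_of_tendsto (h : IsOrthogonalStrip L ε q)
    (hq : Tendsto q (cocompact ℝ) (𝓝 0)) {H : ℝ} (hH : 1 < H) :
    ∃ M : ℕ, ∀ p ∈ (Ico (-(M : ℝ)) M)ᶜ ×ˢ Ioo (0 : ℝ) 1, stretch ε q p ≤ H := by
  have hε := h.pos
  -- For 0 < t < 1 one has h² ≤ 1 + ε²q, so q < (H² − 1)/ε² guarantees h ≤ H.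
  have hpos : 0 < (H ^ 2 - 1) / ε ^ 2 := div_pos (by nlinarith) (by positivity)
  obtain ⟨K, hK, hKq⟩ := mem_cocompact.1 (hq (gt_mem_nhds hpos))
  obtain ⟨r, hr⟩ := hK.isBounded.subset_closedBall 0
  obtain ⟨M, hM⟩ := exists_nat_gt r
  refine ⟨M, fun p hp => ?_⟩
  have h1 : p.1 ∉ K := fun hm => hp.1 (by
    have := hr hm
    rw [mem_closedBall_zero_iff, Real.norm_eq_abs, abs_le] at this
    exact ⟨by linarith, by linarith⟩)
  have h2 : q p.1 < (H ^ 2 - 1) / ε ^ 2 := hKq h1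
  rw [lt_div_iff₀ (by positivity)] at h2
  refine (pow_le_pow_iff_left₀ (h.stretch_pos p).le (by linarith) two_ne_zero).1 ?_
  rw [h.sq_stretch]
  have h3 : p.2 ^ 2 ≤ 1 := pow_le_one₀ hp.2.1.le hp.2.2.le
  have h4 := mul_nonneg (sq_nonneg ε) (h.twist_nonneg p.1)
  nlinarith [mul_le_mul_of_nonneg_left h3 h4]

/-- Below the bottom of the essential spectrum, the energy is bounded below on the orthogonal
complement of finitely many functions. -/
theorem exists_finite_orthogonality (h : IsOrthogonalStrip L ε q)
    (hq : Tendsto q (cocompact ℝ) (𝓝 0)) {E : ℝ} (hE : 0 < E) (hlt : E < (Real.pi / (2 * ε)) ^ 2) :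
    ∃ (s : Finset (ℤ × ℤ)) (f : s → L2 L), ∀ u V, (u, V) ∈ gradientGraph L →
      (∀ i, ⟪f i, u⟫_ℂ = 0) → E * ‖u‖ ^ 2 ≤ ‖V‖ ^ 2 := by
  -- The admissible stretch far out is the ratio of the threshold to E, which exceeds 1 precisely
  -- because E is strictly below the threshold.
  obtain ⟨M, hM⟩ := h.exists_stretch_le_of_tendsto hq ((one_lt_div hE).2 hlt)
  obtain ⟨H, hH0, hH⟩ := h.exists_stretch_le M
  -- Squares of side 1/m are small enough for the mean zero inequality to give E. Requiring m > 1
  -- lets the linear lower bound on m serve as one on m².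
  obtain ⟨m, hm⟩ := exists_nat_gt (max 1 (E * (8 * H ^ 2 * (H ^ 2 + ε ^ 2))))
  have hm1 : (1 : ℝ) < m := (le_max_left _ _).trans_lt hm
  have hm0 : 0 < m := by
    have : (0 : ℝ) < m := zero_lt_one.trans hm1
    exact_mod_cast this
  have hcell : ∀ c ∈ cellIndices m M, cell m c ⊆ Ico (-(M : ℝ)) M ×ˢ Ioo (0 : ℝ) 1 :=
    fun c hc => by
      rw [← biUnion_cell hm0]
      exact subset_biUnion_of_mem (u := fun c => cell m c) hc
  have hfin : ∀ c : cellIndices m M, area L (cell m c) ≠ ⊤ := fun c =>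
    (h.area_lt_top (measurableSet_cell m c) (fun p hp => hH p (hcell c c.2 hp))
      (volume_cell_lt_top hm0 c)).ne
  -- Orthogonality to the indicator of a cell says that u has mean zero there for the area measure.
  refine ⟨cellIndices m M, fun c => indicatorConstLp 2 (measurableSet_cell m c) (hfin c) 1,
    fun u V hx horth => ?_⟩
  have hinner : ∀ c ∈ cellIndices m M, ENNReal.ofReal E * ∫⁻ p in cell m c, ‖u p‖ₑ ^ 2 ∂area L ≤
      ∫⁻ p in cell m c, ‖V p‖ₑ ^ 2 ∂area L := fun c hc => by
    have h0 := horth ⟨c, hc⟩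
    rw [L2.inner_indicatorConstLp_one] at h0
    have hc2 := Finset.mem_Ico.1 (Finset.mem_product.1 hc).2
    refine h.lintegral_sq_le_of_integral_eq_zero hx (measurableSet_cell m c) (convex_cell hm0 c)
      (cell_subset_Lam m c) (ℓ := (m : ℝ)⁻¹) (by positivity) hE.le
      (fun p hp p' hp' => abs_sub_le_of_mem_cell hm0 hp hp') (le_volume_cell hm0 hc2.1 hc2.2)
      (volume_cell_lt_top hm0 c).ne (fun p hp => hH p (hcell c hc hp)) ?_ h0
    have h1 : E * (8 * H ^ 2 * (H ^ 2 + ε ^ 2)) ≤ (m : ℝ) ^ 2 :=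
      ((le_max_right _ _).trans_lt hm).le.trans (by nlinarith)
    calc E * (8 * (m : ℝ)⁻¹ ^ 2 * H ^ 2 * (H ^ 2 + ε ^ 2))
        = E * (8 * H ^ 2 * (H ^ 2 + ε ^ 2)) / (m : ℝ) ^ 2 := by field_simp
      _ ≤ 1 := (div_le_one (by positivity)).2 h1
  set S := Ico (-(M : ℝ)) M ×ˢ Ioo (0 : ℝ) 1 with hS_def
  have hS : MeasurableSet S := measurableSet_Ico.prod measurableSet_Ioo
  have hsum : ∀ f : ℝ × ℝ → ENNReal, ∫⁻ p in S, f p ∂area L =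
      ∑ c ∈ cellIndices m M, ∫⁻ p in cell m c, f p ∂area L := fun f => by
    rw [hS_def, ← biUnion_cell hm0, lintegral_biUnion_finset
      (fun _ _ _ _ hne => pairwise_disjoint_cell m hne) fun c _ => measurableSet_cell m c]
  -- The complement of the bounded piece also contains points outside Λ, which carry no area.
  have hcompl : ∀ f : ℝ × ℝ → ENNReal, ∫⁻ p in Sᶜ, f p ∂area L =
      ∫⁻ p in (Ico (-(M : ℝ)) M)ᶜ ×ˢ Ioo (0 : ℝ) 1, f p ∂area L := fun f => by
    refine setLIntegral_congr ?_
    have := h.ae_area_iff.2 (ae_restrict_mem measurableSet_Lam)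
    filter_upwards [this] with p hp
    have : p ∈ Sᶜ ↔ p ∈ (Ico (-(M : ℝ)) M)ᶜ ×ˢ Ioo (0 : ℝ) 1 :=
      ⟨fun hn => ⟨fun hs => hn ⟨hs, hp⟩, hp⟩, fun hn hs => hn.1 hs.1⟩
    exact propext this
  have houter := h.lintegral_sq_le_of_stretch_le hx measurableSet_Ico.compl hE.le hM
    (by positivity) (by rw [mul_div_cancel₀ _ hE.ne'])
  rw [← ENNReal.ofReal_le_ofReal_iff (sq_nonneg _), ENNReal.ofReal_mul hE.le, ofReal_norm_sq_Lp,
    ofReal_norm_sq_Lp, ← lintegral_add_compl _ hS, ← lintegral_add_compl (fun p => ‖V p‖ₑ ^ 2) hS,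
    mul_add, hsum, hsum, hcompl, hcompl, Finset.mul_sum]
  exact add_le_add (Finset.sum_le_sum hinner) houter

/-- The spectral properties of the Dirichlet–Neumann Laplacian of a twisted strip. -/
theorem spectrum_dnLaplacian (h : IsOrthogonalStrip L ε q) (hq : ∃ s, 0 < q s) :
    (IsSelfAdjoint (dnLaplacian L) ∧ (realSpectrum (dnLaplacian L)).Nonempty ∧
      BddBelow (realSpectrum (dnLaplacian L)) ∧
      sInf (realSpectrum (dnLaplacian L)) < (Real.pi / (2 * ε)) ^ 2) ∧
    (Tendsto q (cocompact ℝ) (𝓝 0) → (discreteSpectrum (dnLaplacian L)).Nonempty) := by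
  have hε := h.pos
  have hpi := Real.pi_pos
  obtain ⟨R, hR⟩ := exists_isFormResolvent h.isClosed_gradientGraph
  have hinj : ∀ x, R x = 0 → x = 0 := fun x =>
    hR.injective fun x hx => h.eq_zero_of_inner_domain_eq_zero x hx
  obtain ⟨u, V, huV, hlt⟩ := h.exists_trial hq
  set E := (Real.pi / (2 * ε)) ^ 2
  have hE : 0 < E := by positivity
  have : Nontrivial (L2 L) := by
    refine ⟨u, 0, fun h0 => ?_⟩
    rw [h0, norm_zero] at hlt
    nlinarith [sq_nonneg ‖V‖]
  have hr := lt_norm_of_trial hR huV hE hlt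
  have hr0 : 0 < ‖R‖ := lt_trans (by positivity) hr
  -- The number ‖R‖⁻¹ − 1 is the bottom of the spectrum. It suffices here that it belongs to the
  -- spectrum and lies below the threshold.
  have hl : ‖R‖⁻¹ - 1 < E := by
    have := (inv_lt_comm₀ (by positivity) hr0).1 hr
    linarith
  have hmem : ‖R‖⁻¹ - 1 ∈ realSpectrum (formOperatorGraph (gradientGraph L)).toLinearPMap := by
    have e : (1 : ℂ) + ((‖R‖⁻¹ - 1 : ℝ) : ℂ) = ((‖R‖ : ℝ) : ℂ)⁻¹ := by push_cast; ring
    have e0 : ((‖R‖ : ℝ) : ℂ)⁻¹ ≠ 0 := inv_ne_zero (by exact_mod_cast hr0.ne')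
    change ((‖R‖⁻¹ - 1 : ℝ) : ℂ) ∈ opSpectrum _
    rw [mem_opSpectrum_iff_mem_spectrum hR hinj (by rwa [e]), e, inv_inv]
    exact norm_mem_spectrum hR hinj
  have hbdd : BddBelow (realSpectrum (formOperatorGraph (gradientGraph L)).toLinearPMap) :=
    ⟨0, fun l => nonneg_of_mem_realSpectrum hR hinj⟩
  have hl0 : 0 ≤ ‖R‖⁻¹ - 1 := nonneg_of_mem_realSpectrum hR hinj hmem
  refine ⟨⟨isSelfAdjoint_formOperator hR hinj, ⟨_, hmem⟩, hbdd, (csInf_le hbdd hmem).trans_lt hl⟩,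
    fun hlim => ?_⟩
  -- The finite codimension bound holds only strictly below the threshold, so an intermediate level
  -- E' above ‖R‖⁻¹ − 1 is used.
  obtain ⟨E', h1, h2⟩ := exists_between hl
  have hE' : 0 < E' := hl0.trans_lt h1
  obtain ⟨s, f, hf⟩ := h.exists_finite_orthogonality hlim hE' h2
  refine discreteSpectrum_nonempty_of_form_bound hR hinj f hE' ?_ hf
  rw [inv_lt_comm₀ (by positivity) hr0]
  linarith

end IsOrthogonalStrip

end RuledStrip

end

open RuledStrip
theorem mainTheorem2 (n : ℕ) (hn : 1 ≤ n)
    (Γ : ℝ → EuclideanSpace ℝ (Fin (n + 1)))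
    (N : Fin n → ℝ → EuclideanSpace ℝ (Fin (n + 1))) (k : Fin n → ℝ → ℝ)
    (hframe : IsRelativelyParallelFrame Γ N k)
    (Θ : ℝ → EuclideanSpace ℝ (Fin n)) (hΘ : ContDiff ℝ 1 Θ)
    (hΘ_unit : ∀ s, ∑ j, Θ s j ^ 2 = 1)
    (ε : ℝ) (hε : 0 < ε)
    (hunbent : ∀ s, ∑ j, k j s * Θ s j = 0)
    (htwisted : ∃ s, deriv Θ s ≠ 0) :
    (IsSelfAdjoint (dnLaplacian (stripMap Γ N Θ ε)) ∧
      (realSpectrum (dnLaplacian (stripMap Γ N Θ ε))).Nonempty ∧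
      BddBelow (realSpectrum (dnLaplacian (stripMap Γ N Θ ε))) ∧
      sInf (realSpectrum (dnLaplacian (stripMap Γ N Θ ε))) < (Real.pi / (2 * ε)) ^ 2) ∧
    (Tendsto (fun s => ‖deriv Θ s‖) (cocompact ℝ) (𝓝 0) →
      (discreteSpectrum (dnLaplacian (stripMap Γ N Θ ε))).Nonempty) := by
  refine (isOrthogonalStrip_stripMap hframe hΘ hΘ_unit hε hunbent).spectrum_dnLaplacian ?_ |>.imp_right
    fun h hlim => h ?_
  · obtain ⟨s, hs⟩ := htwisted
    exact ⟨s, by positivity⟩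
  · simpa using hlim.pow 2
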